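/- Let $s,t,m\ge 0$ be integers, $k=2^{s+t}$, and let $\mathcal O=\mathcal Cl(s,t)$ be the real Clifford algebra with anticommuting generators, $s$ of square $1$ and $t$ of square $-1$; let $F_1=1,F_2,\dots,F_k$ be the ordered products of distinct generators and $\varepsilon_i\in\{\pm1\}$ the sign with $F_i^2=\varepsilon_i$. Let $\mathbb V=\mathcal O^m\cong\mathbb R^{km}$, on which $\mathcal O$ acts by multiplication, let $G=GL(m,\mathcal O)\,GL(1,\mathcal O)\subset GL(\mathbb V)$ be the group of products of an automorphism of $\mathbb V$ commuting with $\mathcal O$ and of multiplication by a unit of $\mathcal O$, and let $\mathfrak g=\mathfrak{gl}(m,\mathcal O)+\mathfrak{gl}(1,\mathcal O)$ be its Lie algebra. Let $M$ be an almost Cliffordian manifold based on $\mathcal O$, that is, a smooth (Hausdorff, $\sigma$-compact) manifold of dimension $km$ with a reduction $P$ of its linear frame bundle to $G$; a frame $p\in P_x$ is a linear isomorphism $p:\mathbb V\to T_xM$. Assume $\dim M=km\ge 2(s+t)$. Let $A\subset T^*M\otimes TM$ be the associated bundle of affinors, $A_x=\{p\circ a\circ p^{-1}: a\in\mathcal O\}$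 for $p\in P_x$. A smooth curve $c:\mathbb R\to M$ is $A$-planar for a linear connection $\nabla$ if $\nabla_{\dot c}\dot c\in A(\dot c)$ at every parameter. Let $\partial:\mathfrak g\otimes\mathbb V^*\to\mathbb V\otimes\Lambda^2\mathbb V^*$ be the alternation, and let $\mathcal D$ be a $G$-invariant complement, $\mathbb V\otimes\Lambda^2\mathbb V^*=\partial(\mathfrak g\otimes\mathbb V^*)\oplus\mathcal D$. A $\mathcal D$-connection is a smooth connection on $P$, regarded as a linear connection on $TM$, whose torsion function $P\to\mathbb V\otimes\Lambda^2\mathbb V^*$ has values in $\mathcal D$. Then there is a $\mathcal D$-connection preserving $A$; and for every such connection $\nabla$, the class $[\nabla]$ of all $\mathcal D$-connections preserving $A$ and having the same $A$-planar curves as $\nabla$ is an affine space modelled on the one-forms of $M$, with fibre $(\mathbb R^{km})^*$. Precisely: (i) the assignment $\Upsilon\mapsto\nabla+S^{\Upsilon}$ is a bijection from the smooth one-forms on $M$ onto $[\nabla]$, where $S^\Upsilon$ is the tensor field, linear in $\Upsilon$, given at $x$ in any frame $p\in P_x$ by $$S^{\Upsilon}(X,Y)=\sum_{i=1}^{k}\varepsilon_i\bigl(\Upsilon(F_iX)\,F_iY+\Upsilon(F_iY)\,F_iX\bigr),\qquad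 X,Y\in T_xM,$$ with $F_i$ acting on $T_xM$ as $p\circ F_i\circ p^{-1}$; (ii) for every $x\in M$ the set of values at $x$ of the difference tensors $\bar\nabla-\nabla$, $\bar\nabla\in[\nabla]$, is a vector space isomorphic to $(\mathbb R^{km})^*$. -/

import Mathlib

open Bundle
open scoped Manifold ContDiff Bundle

noncomputable section

namespace AlmostCliffordian

/-! ### The Clifford algebra `𝒪 = Cl(s,t)` and its standard basis -/

/-- The squares of the `s + t` anticommuting algebra generators: the first `s` of them are product
units (square `1`), the last `t` are complex units (square `-1`). -/
def weight (s t : ℕ) (i : Fin (s + t)) : ℝ := if (i : ℕ) < s then 1 else -1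

/-- The quadratic form `x₁² + ⋯ + x_s² - x_{s+1}² - ⋯ - x_{s+t}²`. -/
def quadForm (s t : ℕ) : QuadraticForm ℝ (Fin (s + t) → ℝ) :=
  QuadraticMap.weightedSumSquares ℝ (weight s t)

/-- The real Clifford algebra `Cl(s,t)`, with `s` product units and `t` complex units. -/
abbrev Cl (s t : ℕ) : Type := CliffordAlgebra (quadForm s t)

/-- The `i`-th algebra generator of `Cl(s,t)`. -/
def gen (s t : ℕ) (i : Fin (s + t)) : Cl s t :=
  CliffordAlgebra.ι (quadForm s t) (Pi.single i 1)

/-- The `2^(s+t)` standard basis elements of `Cl(s,t)`: for a set `S` of indices, the product of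
the generators with index in `S`, in increasing order (so `F ∅ = 1`). -/
def F (s t : ℕ) (S : Finset (Fin (s + t))) : Cl s t :=
  ((S.sort (· ≤ ·)).map (gen s t)).prod

/-- The sign `ε_S ∈ {1, -1}` for which `F_S * F_S = ε_S`. -/
def ε (s t : ℕ) (S : Finset (Fin (s + t))) : ℝ :=
  (-1) ^ (S.card.choose 2) * ∏ i ∈ S, weight s t i

/-! ### The linear model: `𝕍 = 𝒪^m ≅ ℝ^{km}`, the group `GL(m,𝒪) GL(1,𝒪)`, its Lie algebra -/

/-- The model vector space `𝒪^m`, of real dimension `2^(s+t) * m`; the affinors are the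
multiplications `v ↦ a • v` by elements `a` of `𝒪`. -/
abbrev V (s t m : ℕ) : Type := Fin m → Cl s t

/-- The group `G = GL(m,𝒪) GL(1,𝒪)`: the real linear automorphisms of `𝒪^m` that are the product
of one commuting with all affinors and of multiplication by a unit of `𝒪`. -/
def G (s t m : ℕ) : Subgroup (V s t m ≃ₗ[ℝ] V s t m) where
  carrier := {g | ∃ (q : (Cl s t)ˣ) (Q : V s t m ≃ₗ[Cl s t] V s t m),
    ∀ v, g v = (q : Cl s t) • Q v}
  one_mem' := ⟨1, LinearEquiv.refl _ _, fun v => by simp⟩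
  mul_mem' := by
    rintro g h ⟨q, Q, hg⟩ ⟨r, R, hh⟩
    refine ⟨q * r, R.trans Q, fun v => ?_⟩
    rw [LinearEquiv.mul_apply, hh, hg, map_smul, Units.val_mul, mul_smul]
    rfl
  inv_mem' := by
    rintro g ⟨q, Q, hg⟩
    refine ⟨q⁻¹, Q.symm, fun v => ?_⟩
    apply g.injective
    have h1 : g (g⁻¹ v) = v := g.apply_symm_apply v
    rw [h1, hg, map_smul, LinearEquiv.apply_symm_apply, smul_smul, Units.mul_inv, one_smul]

/-- The Lie algebra `𝔤 = 𝔤𝔩(m,𝒪) + 𝔤𝔩(1,𝒪)` of `G`, inside `End(𝒪^m)`. -/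
def lieAlg (s t m : ℕ) : Submodule ℝ (V s t m →ₗ[ℝ] V s t m) where
  carrier := {B | ∃ (a : Cl s t) (B₀ : V s t m →ₗ[Cl s t] V s t m), ∀ v, B v = B₀ v + a • v}
  zero_mem' := ⟨0, 0, fun v => by simp⟩
  add_mem' := by
    rintro B C ⟨a, B₀, hB⟩ ⟨c, C₀, hC⟩
    refine ⟨a + c, B₀ + C₀, fun v => ?_⟩
    rw [LinearMap.add_apply, hB, hC, LinearMap.add_apply, add_smul]
    abel
  smul_mem' := by
    rintro r B ⟨a, B₀, hB⟩
    refine ⟨r • a, r • B₀, fun v => ?_⟩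
    rw [LinearMap.smul_apply, hB, LinearMap.smul_apply, smul_add, smul_assoc]

/-- Real bilinear maps `𝕍 × 𝕍 → 𝕍`. -/
abbrev Bil (s t m : ℕ) : Type := V s t m →ₗ[ℝ] V s t m →ₗ[ℝ] V s t m

/-- The space `𝕍 ⊗ Λ²𝕍*` of alternating bilinear maps. -/
def altMaps (s t m : ℕ) : Submodule ℝ (Bil s t m) where
  carrier := {T | ∀ v, T v v = 0}
  zero_mem' := fun v => rfl
  add_mem' := by
    intro S T hS hT v
    rw [LinearMap.add_apply, LinearMap.add_apply, hS v, hT v, add_zero]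
  smul_mem' := by
    intro r T hT v
    rw [LinearMap.smul_apply, LinearMap.smul_apply, hT v, smul_zero]

/-- The space `𝔤 ⊗ 𝕍* = Hom(𝕍, 𝔤)`. -/
def homLieAlg (s t m : ℕ) : Submodule ℝ (Bil s t m) where
  carrier := {φ | ∀ v, φ v ∈ lieAlg s t m}
  zero_mem' := fun _ => (lieAlg s t m).zero_mem
  add_mem' := fun hφ hψ v => (lieAlg s t m).add_mem (hφ v) (hψ v)
  smul_mem' := fun r _ hφ v => (lieAlg s t m).smul_mem r (hφ v)

/-- The operator of alternation, `(∂φ)(v, w) = φ(v) w - φ(w) v`. -/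
def alternation (s t m : ℕ) : Bil s t m →ₗ[ℝ] Bil s t m where
  toFun φ := φ - φ.flip
  map_add' φ ψ := by
    refine LinearMap.ext fun v => LinearMap.ext fun w => ?_
    simp only [LinearMap.sub_apply, LinearMap.add_apply, LinearMap.flip_apply]
    abel
  map_smul' r φ := by
    refine LinearMap.ext fun v => LinearMap.ext fun w => ?_
    simp only [LinearMap.sub_apply, LinearMap.smul_apply, LinearMap.flip_apply, RingHom.id_apply,
      smul_sub]

/-- `𝒟` is a `G`-invariant complement: `𝕍 ⊗ Λ²𝕍* = ∂(𝔤 ⊗ 𝕍*) ⊕ 𝒟`. -/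
structure IsInvariantComplement (s t m : ℕ) (D : Submodule ℝ (Bil s t m)) : Prop where
  inf_eq : (homLieAlg s t m).map (alternation s t m) ⊓ D = ⊥
  sup_eq : (homLieAlg s t m).map (alternation s t m) ⊔ D = altMaps s t m
  invariant : ∀ g ∈ G s t m, ∀ T ∈ D, g.arrowCongr (g.arrowCongr g) T ∈ D

/-! ### Almost Cliffordian manifolds -/

/-- The model space `ℝ^{km}`, `k = 2^(s+t)`, of the manifold. -/
abbrev E (s t m : ℕ) : Type := EuclideanSpace ℝ (Fin (2 ^ (s + t) * m))

section manifold

variable {s t m : ℕ} {M : Type*} [TopologicalSpace M] [ChartedSpace (E s t m) M]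

/-- The tangent space of `M` at `x`. -/
abbrev TM (s t m : ℕ) {M : Type*} [TopologicalSpace M] [ChartedSpace (E s t m) M] (x : M) : Type :=
  TangentSpace 𝓘(ℝ, E s t m) x

variable [IsManifold 𝓘(ℝ, E s t m) ∞ M]

/-- A field `p` of linear frames (linear isomorphisms `p y : 𝕍 ≃ T_y M`) which over `U` takes
values in `P` and is smooth. -/
def IsSmoothFrameOn (P : ∀ x : M, Set (V s t m ≃ₗ[ℝ] TM s t m x)) (U : Set M)
    (p : ∀ x : M, V s t m ≃ₗ[ℝ] TM s t m x) : Prop :=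
  (∀ y ∈ U, p y ∈ P y) ∧
    ∀ v : V s t m, ContMDiffOn 𝓘(ℝ, E s t m) (𝓘(ℝ, E s t m).prod 𝓘(ℝ, E s t m)) ∞
      (fun y => TotalSpace.mk' (E s t m) (E := TangentSpace 𝓘(ℝ, E s t m)) y (p y v)) U

variable (s t m M) in
/-- An almost Cliffordian structure on `M` based on `Cl(s,t)`: a reduction of the bundle of linear
frames of `M` to `G = GL(m,𝒪) GL(1,𝒪)`. -/
structure CliffordianStructure where
  /-- The fibre over `x` of the reduced frame bundle. -/
  frames : ∀ x : M, Set (V s t m ≃ₗ[ℝ] TM s t m x)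
  /-- Every fibre is one orbit of `G`. -/
  mem_iff : ∀ x : M, ∀ p ∈ frames x, ∀ p' : V s t m ≃ₗ[ℝ] TM s t m x,
    p' ∈ frames x ↔ ∃ g ∈ G s t m, p' = g.trans p
  /-- There are smooth local sections around every point. -/
  exists_smooth : ∀ x : M, ∃ U : Set M, IsOpen U ∧ x ∈ U ∧
    ∃ p : ∀ y : M, V s t m ≃ₗ[ℝ] TM s t m y, IsSmoothFrameOn frames U p

/-- Linear connections on `M`, as covariant derivatives on `TM`. -/
abbrev Conn (s t m : ℕ) (M : Type*) [TopologicalSpace M] [ChartedSpace (E s t m) M]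
    [IsManifold 𝓘(ℝ, E s t m) ∞ M] : Type _ :=
  CovariantDerivative 𝓘(ℝ, E s t m) (E s t m) (TangentSpace 𝓘(ℝ, E s t m) : M → Type _)

/-- The fibre at `x` of the bundle `A ⊂ T*M ⊗ TM` of affinors: the endomorphisms of `T_x M` which
in some (equivalently, any) frame of the structure are multiplication by an element of `𝒪`. -/
def CliffordianStructure.affinors (P : CliffordianStructure s t m M) (x : M) :
    Set (TM s t m x →L[ℝ] TM s t m x) :=
  {f | ∃ p ∈ P.frames x, ∃ a : Cl s t, ∀ v, f (p v) = p (a • v)}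

/-- `∇` preserves `A`: if `f` is a smooth local section of `A`, then so is `∇_X f`, where
`(∇_X f)(Y) = ∇_X (f Y) - f (∇_X Y)`. -/
def PreservesAffinors (P : CliffordianStructure s t m M) (cov : Conn s t m M) : Prop :=
  ∀ U : Set M, IsOpen U → ∀ f : (∀ y : M, TM s t m y →L[ℝ] TM s t m y),
    (∀ y ∈ U, f y ∈ P.affinors y) →
    ContMDiffOn 𝓘(ℝ, E s t m) (𝓘(ℝ, E s t m).prod 𝓘(ℝ, E s t m →L[ℝ] E s t m)) ∞
      (fun y => TotalSpace.mk' (E s t m →L[ℝ] E s t m)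
        (E := fun z : M => TangentSpace 𝓘(ℝ, E s t m) z →L[ℝ] TangentSpace 𝓘(ℝ, E s t m) z)
        y (f y)) U →
    ∀ x ∈ U, ∀ X : TM s t m x, ∃ f' ∈ P.affinors x,
      ∀ Y : (∀ y : M, TM s t m y),
        MDifferentiableAt 𝓘(ℝ, E s t m) (𝓘(ℝ, E s t m).prod 𝓘(ℝ, E s t m))
          (fun y => TotalSpace.mk' (E s t m) (E := TangentSpace 𝓘(ℝ, E s t m)) y (Y y)) x →
        cov (fun y => f y (Y y)) x X = f x (cov Y x X) + f' (Y x)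

/-- `∇` is the covariant derivative of a connection on the principal bundle `P`: its local
connection forms with respect to smooth local sections of `P` have values in `𝔤`. -/
def IsGConnection (P : CliffordianStructure s t m M) (cov : Conn s t m M) : Prop :=
  ∀ (U : Set M), IsOpen U → ∀ p : (∀ y : M, V s t m ≃ₗ[ℝ] TM s t m y),
    IsSmoothFrameOn P.frames U p → ∀ x ∈ U, ∀ X : TM s t m x,
      ∃ B ∈ lieAlg s t m, ∀ v : V s t m, cov (fun y => p y v) x X = p x (B v)

/-- `∇` is a `𝒟`-connection: a (smooth) connection on `P` whose torsion function
`P → 𝕍 ⊗ Λ²𝕍*` has values in `𝒟`. -/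
structure IsDConnection (P : CliffordianStructure s t m M) (D : Submodule ℝ (Bil s t m))
    (cov : Conn s t m M) : Prop where
  smooth : cov.ContMDiffCovariantDerivative ∞
  isGConnection : IsGConnection P cov
  torsion_mem : ∀ x : M, ∀ p ∈ P.frames x, ∃ T ∈ D, ∀ v w : V s t m,
    cov.torsion x (p v) (p w) = p (T v w)

/-- The velocity of a curve. -/
def velocity (c : ℝ → M) (τ : ℝ) : TM s t m (c τ) :=
  mfderiv 𝓘(ℝ, ℝ) 𝓘(ℝ, E s t m) c τ (1 : ℝ)

/-- `∇_ċ ċ` at the parameter `τ`. In the local frame `∂_i` of `TM` given by the chart at `c τ`, in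
which `ċ = ∑ ċⁱ ∂_i`, it is `∑ (d/dτ ċⁱ) ∂_i + ∑ ċⁱ ∇_ċ ∂_i`. -/
def acceleration (cov : Conn s t m M) (c : ℝ → M) (τ : ℝ) : TM s t m (c τ) :=
  let e := trivializationAt (E s t m) (TangentSpace 𝓘(ℝ, E s t m) : M → Type _) (c τ)
  let ξ : ℝ → E s t m := fun σ =>
    (e (TotalSpace.mk' (E s t m) (E := TangentSpace 𝓘(ℝ, E s t m)) (c σ)
      (velocity (s := s) (t := t) (m := m) c σ))).2
  e.symm (c τ) (deriv ξ τ) +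
    cov (fun y => e.symm y (ξ τ)) (c τ) (velocity (s := s) (t := t) (m := m) c τ)

/-- `c` is a (smooth) `A`-planar curve for `∇`: `∇_ċ ċ ∈ A(ċ)`. -/
def IsPlanar (P : CliffordianStructure s t m M) (cov : Conn s t m M) (c : ℝ → M) : Prop :=
  ContMDiff 𝓘(ℝ, ℝ) 𝓘(ℝ, E s t m) ∞ c ∧
    ∀ τ : ℝ, ∃ f ∈ P.affinors (c τ),
      acceleration cov c τ = f (velocity (s := s) (t := t) (m := m) c τ)

/-- The class of `𝒟`-connections which preserve `A` and have the same `A`-planar curves as `∇`. -/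
def planarClass (P : CliffordianStructure s t m M) (D : Submodule ℝ (Bil s t m))
    (cov : Conn s t m M) : Set (Conn s t m M) :=
  {cov' | IsDConnection P D cov' ∧ PreservesAffinors P cov' ∧
    ∀ c : ℝ → M, IsPlanar P cov' c ↔ IsPlanar P cov c}

/-- Smooth one-forms on `M`. -/
abbrev OneForm (s t m : ℕ) (M : Type*) [TopologicalSpace M] [ChartedSpace (E s t m) M]
    [IsManifold 𝓘(ℝ, E s t m) ∞ M] : Type _ :=
  ContMDiffSection 𝓘(ℝ, E s t m) (E s t m →L[ℝ] ℝ) ∞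
    (fun x : M => TangentSpace 𝓘(ℝ, E s t m) x →L[ℝ] Trivial M ℝ x)

/-- Fields of bilinear maps `T_x M × T_x M → T_x M`, such as differences of connections. -/
abbrev TensorField (s t m : ℕ) (M : Type*) [TopologicalSpace M] [ChartedSpace (E s t m) M] :
    Type _ :=
  ∀ x : M, TM s t m x →L[ℝ] TM s t m x →L[ℝ] TM s t m x

end manifold

end AlmostCliffordian

end

/-!
The theorem is reduced to algebra on the model space `𝕍 = 𝒪^m` and then carried over to `M` with
smooth frames of the structure.

*Algebra.* The element `∑ ε_S F_S ⊗ F_S` of `𝒪 ⊗ 𝒪` is invariant (`casimir`). Hence, for a real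
linear form `Υ` on `𝕍`, the map `α(v) = ∑ ε_S Υ(F_S v) F_S` is `𝒪`-linear, the tensor
`S^Υ(v, w) = α(v) w + α(w) v` is a symmetric element of `𝔤 ⊗ 𝕍*` with `S^Υ(v, v) ∈ 𝒪 v`, and
`Υ ↦ S^Υ` commutes with the action of `G`, so that it makes sense on the tangent spaces of `M`.
Averaging over the standard basis also shows that `𝔤` is the normalizer of `𝒪` in `End 𝕍`
(`mem_lieAlg_iff`). Conversely every symmetric `S ∈ 𝔤 ⊗ 𝕍*` with `S(v, v) ∈ 𝒪 v` is an `S^Υ`. If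
`𝒪` is commutative, `S` is bilinear over `𝒪` and polarization gives the form `α`; otherwise some
commutator of `𝒪` is invertible, and comparing the expansions of `S(c v, d w)` gives it. The form
`Υ` is the composition of `α` with the coefficient of `1`, and it depends linearly on `S`
(`exists_recoverForm`).

*Existence.* The flat connection of a local frame in `P` preserves `A`. Its torsion can be moved
into `𝒟` by adding a `𝔤`-valued tensor, which depends linearly on the torsion and preserves `A`
because `𝔤` normalizes `𝒪`. The resulting local connections are glued with a partition of unity,
all the conditions being affine (`exists_isDConnection`).

*The class of a connection.* The difference `S` of two `𝒟`-connections has values in `𝔤`, and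
its alternation lies in `∂(𝔤 ⊗ 𝕍*) ∩ 𝒟 = 0`, so it is symmetric. Every tangent vector is, up to a
factor, the velocity of a planar curve defined on the whole line, namely of a local geodesic
composed with a multiple of the arctangent (`exists_planar_curve`); if the planar curves agree, this
gives `S(X, X) ∈ A(X)`. Therefore `S` is pointwise an `S^Υ`, and `Υ` is smooth since it is recovered
linearly from `S` (`exists_formTensor_eq_difference`). In the other direction, adding `S^Υ` changes
the acceleration of a curve `c` by `S^Υ(ċ, ċ) ∈ A(ċ)`, and changes neither the torsion nor the
preservation of `A` (`addOneForm_mem_planarClass`).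
-/

noncomputable section

namespace AlmostCliffordian

/-! ### The standard basis of the Clifford algebra -/

section clifford

variable {s t : ℕ}

lemma weight_mul_self (i : Fin (s + t)) : weight s t i * weight s t i = 1 := by
  unfold weight; split_ifs <;> norm_num

lemma gen_mul_self (i : Fin (s + t)) :
    gen s t i * gen s t i = algebraMap ℝ (Cl s t) (weight s t i) := by
  rw [gen, CliffordAlgebra.ι_sq_scalar]
  congr 1
  simp [quadForm, QuadraticMap.weightedSumSquares_apply, Pi.single_apply]

lemma gen_mul_gen_of_ne {i j : Fin (s + t)} (h : i ≠ j) :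
    gen s t i * gen s t j = -(gen s t j * gen s t i) := by
  rw [eq_neg_iff_add_eq_zero, gen, gen, CliffordAlgebra.ι_mul_ι_add_swap]
  rw [show QuadraticMap.polar (quadForm s t) (Pi.single i 1) (Pi.single j 1) = 0 from ?_, map_zero]
  simp only [QuadraticMap.polar, quadForm, QuadraticMap.weightedSumSquares_apply, smul_eq_mul,
    ← Finset.sum_sub_distrib, Pi.add_apply]
  refine Finset.sum_eq_zero fun k _ => ?_
  by_cases hi : k = i
  · subst hi; simp [h]
  · simp [hi]

@[simp]
lemma F_empty : F s t ∅ = 1 := by simp [F]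

lemma F_insert_of_lt {i : Fin (s + t)} {S : Finset (Fin (s + t))} (h : ∀ j ∈ S, i < j) :
    F s t (insert i S) = gen s t i * F s t S := by
  rw [F, Finset.sort_insert _ (fun j hj => (h j hj).le) (fun hi => lt_irrefl _ (h i hi))]
  simp [F]

lemma F_mul_gen_of_notMem {j : Fin (s + t)} {S : Finset (Fin (s + t))} (hj : j ∉ S) :
    F s t S * gen s t j = (-1 : ℝ) ^ S.card • (gen s t j * F s t S) := by
  induction S using Finset.induction_on_min with
  | empty => simp
  | insert i S hi ih =>
    have hiS : i ∉ S := fun h => lt_irrefl _ (hi i h)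
    rw [Finset.mem_insert, not_or] at hj
    rw [F_insert_of_lt hi, mul_assoc, ih hj.2, Finset.card_insert_of_notMem hiS, mul_smul_comm,
      ← mul_assoc, gen_mul_gen_of_ne (Ne.symm hj.1), pow_succ, mul_smul]
    simp [mul_assoc]

lemma ε_insert {i : Fin (s + t)} {S : Finset (Fin (s + t))} (hi : i ∉ S) :
    ε s t (insert i S) = (-1) ^ S.card * weight s t i * ε s t S := by
  rw [ε, ε, Finset.card_insert_of_notMem hi, Finset.prod_insert hi, Nat.choose_succ_succ,
    Nat.choose_one_right, pow_add]
  ring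

lemma ε_mul_self (S : Finset (Fin (s + t))) : ε s t S * ε s t S = 1 := by
  rw [ε, mul_mul_mul_comm, ← Finset.prod_mul_distrib]
  simp [weight_mul_self, ← mul_pow]

/-- The sign `ε` is the square of the standard basis element. -/
lemma F_mul_self (S : Finset (Fin (s + t))) : F s t S * F s t S = ε s t S • 1 := by
  induction S using Finset.induction_on_min with
  | empty => simp [ε]
  | insert i S hi ih =>
    have hiS : i ∉ S := fun h => lt_irrefl _ (hi i h)
    rw [F_insert_of_lt hi, ε_insert hiS, mul_assoc, ← mul_assoc (F s t S),
      F_mul_gen_of_notMem hiS, smul_mul_assoc, mul_smul_comm, mul_assoc, ih, ← mul_assoc,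
      gen_mul_self, mul_smul_comm, mul_one, Algebra.algebraMap_eq_smul_one, smul_smul, smul_smul]
    congr 1
    ring

/-- Multiplication by a generator permutes the standard basis up to nonzero factors. -/
lemma exists_gen_mul_F (j : Fin (s + t)) (S : Finset (Fin (s + t))) :
    ∃ r : ℝ, gen s t j * F s t S = r • F s t (symmDiff S {j}) := by
  induction S using Finset.induction_on_min with
  | empty => exact ⟨1, by rw [one_smul, ← Finset.bot_eq_empty, bot_symmDiff, ← insert_empty_eq,
      F_insert_of_lt (by simp), Finset.bot_eq_empty]⟩
  | insert i S hi ih =>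
    have hiS : i ∉ S := fun h => lt_irrefl _ (hi i h)
    rcases lt_trichotomy j i with h | h | h
    · refine ⟨1, ?_⟩
      have hj : ∀ k ∈ insert i S, j < k := by
        intro k hk
        rcases Finset.mem_insert.1 hk with rfl | hk
        exacts [h, h.trans (hi k hk)]
      rw [one_smul, ← F_insert_of_lt hj]
      congr 1
      have hjS : j ∉ insert i S := fun h => lt_irrefl _ (hj j h)
      ext k
      simp only [Finset.mem_insert, Finset.mem_symmDiff, Finset.mem_singleton] at hjS ⊢
      grind
    · subst h
      refine ⟨weight s t j, ?_⟩
      rw [F_insert_of_lt hi, ← mul_assoc, gen_mul_self, ← Algebra.smul_def]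
      congr 2
      ext k
      simp only [Finset.mem_insert, Finset.mem_symmDiff, Finset.mem_singleton]
      grind
    · obtain ⟨r, hr⟩ := ih
      refine ⟨-r, ?_⟩
      rw [F_insert_of_lt hi, ← mul_assoc, gen_mul_gen_of_ne h.ne', neg_mul, mul_assoc, hr,
        mul_smul_comm, neg_smul]
      have h1 : ∀ k ∈ symmDiff S {j}, i < k := by
        intro k hk
        simp only [Finset.mem_symmDiff, Finset.mem_singleton] at hk
        rcases hk with hk | hk
        exacts [hi k hk.1, hk.1 ▸ h]
      rw [← F_insert_of_lt h1]
      congr 3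
      ext k
      simp only [Finset.mem_insert, Finset.mem_symmDiff, Finset.mem_singleton]
      grind

lemma exists_F_mul_gen (j : Fin (s + t)) (S : Finset (Fin (s + t))) :
    ∃ r : ℝ, F s t S * gen s t j = r • F s t (symmDiff S {j}) := by
  obtain ⟨r, hr⟩ := exists_gen_mul_F j S
  by_cases hj : j ∈ S
  · -- write `F S` as a multiple of `gen j * F (S \ {j})`
    obtain ⟨q, hq⟩ := exists_gen_mul_F j (symmDiff S {j})
    have hSj : j ∉ symmDiff S {j} := by simp [Finset.mem_symmDiff, hj]
    rw [symmDiff_assoc, symmDiff_self, symmDiff_bot] at hq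
    have h1 : F s t S = (weight s t j * r) • (gen s t j * F s t (symmDiff S {j})) := by
      have := congrArg (gen s t j * ·) hr
      simp only [← mul_assoc, gen_mul_self, ← Algebra.smul_def, mul_smul_comm] at this
      rw [mul_smul, ← this, smul_smul, weight_mul_self, one_smul]
    have h2 := F_mul_gen_of_notMem hSj
    refine ⟨weight s t j * r * (-1 : ℝ) ^ (symmDiff S {j}).card * weight s t j, ?_⟩
    conv_lhs => rw [h1]
    rw [smul_mul_assoc, mul_assoc, h2, mul_smul_comm, ← mul_assoc, gen_mul_self,
      ← Algebra.smul_def, smul_smul, smul_smul]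
  · refine ⟨(-1) ^ S.card * r, ?_⟩
    rw [F_mul_gen_of_notMem hj, hr, smul_smul]

lemma exists_F_mul_F (S T : Finset (Fin (s + t))) :
    ∃ r : ℝ, F s t S * F s t T = r • F s t (symmDiff S T) := by
  induction S using Finset.induction_on_min with
  | empty => exact ⟨1, by rw [← Finset.bot_eq_empty, bot_symmDiff, Finset.bot_eq_empty]; simp⟩
  | insert i S hi ih =>
    have hiS : i ∉ S := fun h => lt_irrefl _ (hi i h)
    obtain ⟨r, hr⟩ := ih
    obtain ⟨q, hq⟩ := exists_gen_mul_F i (symmDiff S T)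
    refine ⟨r * q, ?_⟩
    rw [F_insert_of_lt hi, mul_assoc, hr, mul_smul_comm, hq, smul_smul]
    congr 2
    ext k
    simp only [Finset.mem_insert, Finset.mem_symmDiff, Finset.mem_singleton]
    grind

lemma ι_eq_sum_gen (v : Fin (s + t) → ℝ) :
    CliffordAlgebra.ι (quadForm s t) v = ∑ i, v i • gen s t i := by
  conv_lhs => rw [← Finset.univ_sum_single v]
  rw [map_sum]
  refine Finset.sum_congr rfl fun i _ => ?_
  rw [gen, ← map_smul]
  congr 1
  ext j
  simp [Pi.single_apply]

/-- Induction on the Clifford algebra, reduced to the standard generators. -/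
lemma cl_induction {C : Cl s t → Prop} (algebraMap : ∀ r : ℝ, C (algebraMap ℝ (Cl s t) r))
    (gen : ∀ i, C (gen s t i)) (mul : ∀ a b, C a → C b → C (a * b))
    (add : ∀ a b, C a → C b → C (a + b)) (a : Cl s t) : C a := by
  induction a using CliffordAlgebra.induction with
  | algebraMap r => exact algebraMap r
  | ι v =>
    rw [ι_eq_sum_gen]
    refine Finset.sum_induction _ C add (by simpa using algebraMap 0) fun i _ => ?_
    rw [Algebra.smul_def]
    exact mul _ _ (algebraMap _) (gen i)
  | mul a b ha hb => exact mul a b ha hb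
  | add a b ha hb => exact add a b ha hb

lemma span_range_F : Submodule.span ℝ (Set.range (F s t)) = ⊤ := by
  have key : ∀ a : Cl s t, ∀ b ∈ Submodule.span ℝ (Set.range (F s t)),
      a * b ∈ Submodule.span ℝ (Set.range (F s t)) := by
    intro a
    induction a using cl_induction with
    | algebraMap r =>
      intro b hb
      rw [← Algebra.smul_def]
      exact Submodule.smul_mem _ _ hb
    | gen i =>
      intro b hb
      induction hb using Submodule.span_induction with
      | mem x hx =>
        obtain ⟨S, rfl⟩ := hx
        obtain ⟨r, hr⟩ := exists_gen_mul_F i S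
        rw [hr]
        exact Submodule.smul_mem _ _ (Submodule.subset_span ⟨_, rfl⟩)
      | zero => simp
      | add x y _ _ hx hy => rw [mul_add]; exact Submodule.add_mem _ hx hy
      | smul r x _ hx => rw [mul_smul_comm]; exact Submodule.smul_mem _ _ hx
    | mul a b ha hb =>
      intro c hc
      rw [mul_assoc]
      exact ha _ (hb _ hc)
    | add a b ha hb =>
      intro c hc
      rw [add_mul]
      exact Submodule.add_mem _ (ha _ hc) (hb _ hc)
  refine Submodule.eq_top_iff'.2 fun a => ?_
  rw [← mul_one a]
  exact key a 1 (Submodule.subset_span ⟨∅, F_empty⟩)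

instance : FiniteDimensional ℝ (Cl s t) :=
  ⟨by rw [← span_range_F]; exact Submodule.fg_span (Set.finite_range _)⟩

/-- The element `∑ ε_S F_S ⊗ F_S` is invariant: a factor may be moved from the right of the first
tensor factor to the left of the second. -/
lemma casimir {W : Type*} [AddCommGroup W] [Module ℝ W] (c : Cl s t) :
    ∀ β : Cl s t →ₗ[ℝ] Cl s t →ₗ[ℝ] W,
      ∑ S, ε s t S • β (F s t S * c) (F s t S) = ∑ S, ε s t S • β (F s t S) (c * F s t S) := by
  induction c using cl_induction with
  | algebraMap r =>
    intro β
    refine Finset.sum_congr rfl fun S _ => ?_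
    rw [← Algebra.smul_def, ← Algebra.commutes, ← Algebra.smul_def, map_smul, map_smul,
      LinearMap.smul_apply]
  | gen j =>
    intro β
    have hinv : Function.Involutive fun S : Finset (Fin (s + t)) => symmDiff S {j} := by
      intro S
      simp only [symmDiff_assoc, symmDiff_self, symmDiff_bot]
    rw [← Equiv.sum_comp (Function.Involutive.toPerm _ hinv)
      fun S => ε s t S • β (F s t S) (gen s t j * F s t S)]
    refine Finset.sum_congr rfl fun S _ => ?_
    obtain ⟨r, hr⟩ := exists_F_mul_gen j S
    set S' := symmDiff S {j} with hS'
    -- multiply `F S * gen j = r • F S'` by the inverses of `F S` and `F S'`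
    have h1 : ε s t S' • (gen s t j * F s t S') = (r * ε s t S) • F s t S := by
      have h2 := congrArg (fun x => ε s t S • (F s t S * (x * (ε s t S' • F s t S')))) hr
      simp only [smul_mul_assoc, mul_smul_comm, F_mul_self, mul_one] at h2
      rw [mul_assoc, ← mul_assoc (F s t S), F_mul_self, smul_mul_assoc, one_mul] at h2
      simp only [smul_smul] at h2
      rw [mul_left_comm, ε_mul_self, mul_one, mul_left_comm (ε s t S') r, ε_mul_self,
        mul_one] at h2
      rw [h2, mul_comm]
    have h3 : Function.Involutive.toPerm _ hinv S = S' := rfl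
    rw [h3, hr, map_smul, LinearMap.smul_apply, ← map_smul (β (F s t S')) (ε s t S'), h1, map_smul,
      smul_smul, mul_comm]
  | mul a b ha hb =>
    intro β
    have h2 := ha (β.comp (LinearMap.mulRight ℝ b))
    have h3 := hb ((β.flip.comp (LinearMap.mulLeft ℝ a)).flip)
    simp only [LinearMap.comp_apply, LinearMap.mulRight_apply, LinearMap.mulLeft_apply,
      LinearMap.flip_apply] at h2 h3
    simp only [← mul_assoc] at h2 h3 ⊢
    rw [h2, h3]
  | add a b ha hb =>
    intro β
    simp only [mul_add, add_mul, map_add, LinearMap.add_apply, smul_add, Finset.sum_add_distrib,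
      ha β, hb β]

lemma casimir_left {W : Type*} [AddCommGroup W] [Module ℝ W] (c : Cl s t)
    (β : Cl s t →ₗ[ℝ] Cl s t →ₗ[ℝ] W) :
    ∑ S, ε s t S • β (c * F s t S) (F s t S) = ∑ S, ε s t S • β (F s t S) (F s t S * c) :=
  (casimir c β.flip).symm

/-- The element `∑ ε_S F_S ⊗ F_S` is invariant under conjugation. -/
lemma casimir_conj {W : Type*} [AddCommGroup W] [Module ℝ W] (q : (Cl s t)ˣ)
    (β : Cl s t →ₗ[ℝ] Cl s t →ₗ[ℝ] W) :
    ∑ S, ε s t S • β (↑q * F s t S * ↑q⁻¹) (↑q * F s t S * ↑q⁻¹) =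
      ∑ S, ε s t S • β (F s t S) (F s t S) := by
  have h1 := casimir (q : Cl s t) ((((β.comp (LinearMap.mulRight ℝ (↑q⁻¹ : Cl s t))).comp
    (LinearMap.mulLeft ℝ (q : Cl s t))).flip.comp (LinearMap.mulRight ℝ (↑q⁻¹ : Cl s t))).flip)
  have h2 := casimir_left (q : Cl s t) ((β.flip.comp (LinearMap.mulRight ℝ (↑q⁻¹ : Cl s t))).flip)
  simp only [LinearMap.comp_apply, LinearMap.mulRight_apply, LinearMap.mulLeft_apply,
      LinearMap.flip_apply, mul_assoc, Units.mul_inv, mul_one] at h1 h2 ⊢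
  rw [← h1, h2]

/-- The coefficient of `1` with respect to the standard basis recovers an element `a` from the
products `F_S a`: the family `ε_S F_S` is dual to the standard basis for the trace form. -/
lemma exists_trace (h : 2 ^ (s + t) ≤ Module.finrank ℝ (Cl s t)) :
    ∃ τ : Cl s t →ₗ[ℝ] ℝ, (∀ S, τ (F s t S) = if S = ∅ then 1 else 0) ∧
      ∀ a, ∑ S, (ε s t S * τ (F s t S * a)) • F s t S = a := by
  have hcard : Fintype.card (Finset (Fin (s + t))) = Module.finrank ℝ (Cl s t) := by
    refine le_antisymm (by simpa using h) ?_
    rw [← finrank_top, ← span_range_F (s := s) (t := t)]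
    exact finrank_range_le_card _
  let b : Module.Basis (Finset (Fin (s + t))) ℝ (Cl s t) :=
    basisOfTopLeSpanOfCardEqFinrank (F s t) span_range_F.ge hcard
  have hb : ∀ S, b S = F s t S := fun S => by simp [b]
  refine ⟨b.coord ∅, fun S => ?_, fun a => ?_⟩
  · rw [← hb, Module.Basis.coord_apply, Module.Basis.repr_self, Finsupp.single_apply]
  have key : ∀ S T, b.coord ∅ (F s t S * F s t T) = if S = T then ε s t T else 0 := by
    intro S T
    split_ifs with hST
    · subst hST
      rw [F_mul_self, map_smul, ← F_empty, ← hb]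
      simp
    · obtain ⟨r, hr⟩ := exists_F_mul_F S T
      rw [hr, map_smul, ← hb, Module.Basis.coord_apply, Module.Basis.repr_self,
        Finsupp.single_eq_of_ne, smul_zero]
      rwa [ne_comm, ← Finset.bot_eq_empty, Ne, symmDiff_eq_bot]
  have hid : ∑ S, (ε s t S • (b.coord ∅).comp (LinearMap.mulLeft ℝ (F s t S))).smulRight (F s t S)
      = LinearMap.id := by
    refine b.ext fun T => ?_
    rw [hb]
    simp only [LinearMap.sum_apply, LinearMap.smulRight_apply, LinearMap.smul_apply,
      LinearMap.comp_apply, LinearMap.mulLeft_apply, key, smul_eq_mul, mul_ite, mul_zero, ite_smul,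
      zero_smul, Finset.sum_ite_eq', Finset.mem_univ, if_true, ε_mul_self, one_smul,
      LinearMap.id_apply]
  have h1 := LinearMap.congr_fun hid a
  simpa [LinearMap.sum_apply] using h1

/-- The Clifford algebra is commutative, or else a commutator in it is a unit. -/
lemma comm_or_exists_commutator (s t : ℕ) :
    (∀ a b : Cl s t, a * b = b * a) ∨ ∃ c d : Cl s t, IsUnit (d * c - c * d) := by
  by_cases h : ∃ i j : Fin (s + t), i ≠ j
  · right
    obtain ⟨i, j, hij⟩ := h
    have hu : ∀ i, IsUnit (gen s t i) := fun i => by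
      have h : IsUnit (gen s t i * gen s t i) := by
        rw [gen_mul_self]
        exact (isUnit_iff_ne_zero.2 (left_ne_zero_of_mul_eq_one (weight_mul_self i))).map _
      exact (isUnit_pow_iff two_ne_zero).1 (by rwa [sq])
    refine ⟨gen s t i, gen s t j, ?_⟩
    have h1 : gen s t j * gen s t i - gen s t i * gen s t j =
        algebraMap ℝ _ 2 * (gen s t j * gen s t i) := by
      rw [gen_mul_gen_of_ne hij, ← Algebra.smul_def, two_smul]
      abel
    rw [h1]
    exact ((isUnit_iff_ne_zero.2 two_ne_zero).map _).mul ((hu j).mul (hu i))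
  · left
    push Not at h
    intro a b
    change Commute a b
    induction a using cl_induction with
    | algebraMap r => exact Algebra.commutes r b
    | gen i =>
      induction b using cl_induction with
      | algebraMap r => exact (Algebra.commutes r _).symm
      | gen j => rw [h i j]
      | mul a b ha hb => exact ha.mul_right hb
      | add a b ha hb => exact ha.add_right hb
    | mul a b ha hb => exact ha.mul_left hb
    | add a b ha hb => exact ha.add_left hb

end clifford

/-! ### The Lie algebra `𝔤` as a normalizer -/

section model

variable {s t m : ℕ}

/-- The Lie algebra `𝔤𝔩(m,𝒪) + 𝔤𝔩(1,𝒪)` is the normalizer of `𝒪` in the endomorphisms of `𝒪^m`.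
Conversely to the obvious inclusion, averaging an element `B` of the normalizer over the standard
basis, `B₀ = 2^{-(s+t)} ∑ ε_S F_S B F_S`, gives an endomorphism commuting with `𝒪` and differing
from `B` by an affinor. -/
lemma mem_lieAlg_iff {B : V s t m →ₗ[ℝ] V s t m} :
    B ∈ lieAlg s t m ↔ ∀ a : Cl s t, ∃ a' : Cl s t, ∀ v, B (a • v) = a • B v + a' • v := by
  constructor
  · rintro ⟨b, B₀, hB⟩ a
    refine ⟨b * a - a * b, fun v => ?_⟩
    rw [hB, hB, map_smul, smul_add, sub_smul, mul_smul, mul_smul]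
    abel
  · intro h
    choose δ hδ using h
    let k : ℝ := (2 : ℝ) ^ (s + t)
    have hk : k ≠ 0 := pow_ne_zero _ two_ne_zero
    let Bf : V s t m → V s t m := fun v => k⁻¹ • ∑ S, ε s t S • F s t S • B (F s t S • v)
    have hlin : ∀ (c : Cl s t) v, Bf (c • v) = c • Bf v := by
      intro c v
      let β : Cl s t →ₗ[ℝ] Cl s t →ₗ[ℝ] V s t m :=
        LinearMap.mk₂ ℝ (fun x y => y • B (x • v))
          (fun x x' y => by rw [add_smul, map_add, smul_add])
          (fun r x y => by rw [smul_assoc, map_smul, smul_comm])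
          (fun x y y' => by rw [add_smul]) (fun r x y => by rw [smul_assoc])
      have h1 := casimir c β
      simp only [β, LinearMap.mk₂_apply, mul_smul] at h1
      simp only [Bf, h1]
      rw [smul_comm c k⁻¹, Finset.smul_sum (r := c)]
      simp only [smul_comm c (ε s t _)]
    let B₀ : V s t m →ₗ[Cl s t] V s t m :=
      { toFun := Bf
        map_add' := fun v w => by
          simp only [Bf, smul_add, map_add, Finset.sum_add_distrib]
        map_smul' := hlin }
    refine ⟨-(k⁻¹ • ∑ S, ε s t S • (F s t S * δ (F s t S))), B₀, fun v => ?_⟩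
    have h2 : B₀ v = B v + (k⁻¹ • ∑ S, ε s t S • (F s t S * δ (F s t S))) • v := by
      change Bf v = _
      simp only [Bf, hδ, smul_add, Finset.sum_add_distrib]
      congr 1
      · have h3 : ∀ S : Finset (Fin (s + t)), ε s t S • F s t S • F s t S • B v = B v := by
          intro S
          rw [← mul_smul (F s t S), F_mul_self, smul_assoc, one_smul, smul_smul, ε_mul_self,
            one_smul]
        simp only [h3, Finset.sum_const, Finset.card_univ, Fintype.card_finset, Fintype.card_fin]
        rw [← Nat.cast_smul_eq_nsmul ℝ, smul_smul]
        push_cast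
        rw [inv_mul_cancel₀ hk, one_smul]
      · rw [smul_assoc, Finset.sum_smul]
        congr 1
        refine Finset.sum_congr rfl fun S _ => ?_
        rw [smul_assoc, mul_smul]
    rw [h2, neg_smul, add_neg_cancel_right]

lemma exists_conj_of_mem_G {g : V s t m ≃ₗ[ℝ] V s t m} (hg : g ∈ G s t m) (a : Cl s t) :
    ∃ a' : Cl s t, ∀ v, g (a • v) = a' • g v := by
  obtain ⟨q, Q, hQ⟩ := hg
  refine ⟨q * a * ↑q⁻¹, fun v => ?_⟩
  rw [hQ, hQ, map_smul, smul_smul, smul_smul, mul_assoc, Units.inv_mul, mul_one]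

/-! ### The tensors `S^Υ` in the linear model -/

/-- The `𝒪`-valued linear form `X ↦ ∑ ε_S Υ(F_S X) F_S` on `𝒪^m` attached to a real linear
form `Υ`. -/
def clForm (Υ : V s t m →ₗ[ℝ] ℝ) : V s t m →ₗ[Cl s t] Cl s t where
  toFun v := ∑ S, ε s t S • Υ (F s t S • v) • F s t S
  map_add' v w := by
    simp only [smul_add, map_add, add_smul, Finset.sum_add_distrib]
  map_smul' c v := by
    let β : Cl s t →ₗ[ℝ] Cl s t →ₗ[ℝ] Cl s t :=
      LinearMap.mk₂ ℝ (fun x y => Υ (x • v) • y)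
        (fun x x' y => by rw [add_smul, map_add, add_smul])
        (fun r x y => by rw [smul_assoc, map_smul, smul_assoc])
        (fun x y y' => by rw [smul_add]) (fun r x y => by rw [smul_comm])
    have h1 := casimir c β
    simp only [β, LinearMap.mk₂_apply, mul_smul] at h1
    rw [h1, RingHom.id_apply, smul_eq_mul, Finset.mul_sum]
    exact Finset.sum_congr rfl fun S _ => by rw [mul_smul_comm, mul_smul_comm]

lemma clForm_apply (Υ : V s t m →ₗ[ℝ] ℝ) (v : V s t m) :
    clForm Υ v = ∑ S, ε s t S • Υ (F s t S • v) • F s t S := rfl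

lemma clForm_add (Υ Υ' : V s t m →ₗ[ℝ] ℝ) (v : V s t m) :
    clForm (Υ + Υ') v = clForm Υ v + clForm Υ' v := by
  simp only [clForm_apply, LinearMap.add_apply, add_smul, smul_add, Finset.sum_add_distrib]

lemma clForm_smul (r : ℝ) (Υ : V s t m →ₗ[ℝ] ℝ) (v : V s t m) :
    clForm (r • Υ) v = r • clForm Υ v := by
  simp only [clForm_apply, LinearMap.smul_apply, Finset.smul_sum]
  exact Finset.sum_congr rfl fun S _ => by rw [smul_assoc, smul_comm]

/-- The tensor `S^Υ(v, w) = ∑ ε_S (Υ(F_S v) F_S w + Υ(F_S w) F_S v)` on `𝒪^m`, that is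
`α(v) w + α(w) v` for the `𝒪`-linear form `α` attached to `Υ`. -/
def modelTensor : (V s t m →ₗ[ℝ] ℝ) →ₗ[ℝ] Bil s t m where
  toFun Υ := LinearMap.mk₂ ℝ (fun v w => clForm Υ v • w + clForm Υ w • v)
    (fun v v' w => by simp only [map_add, add_smul, smul_add]; abel)
    (fun r v w => by
      rw [← algebraMap_smul (Cl s t) r v, map_smul, algebraMap_smul, algebraMap_smul, smul_assoc,
        smul_add, smul_comm r (clForm Υ w)])
    (fun v w w' => by simp only [map_add, add_smul, smul_add]; abel)
    (fun r v w => by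
      rw [← algebraMap_smul (Cl s t) r w, map_smul, algebraMap_smul, algebraMap_smul, smul_assoc,
        smul_add, smul_comm r (clForm Υ v)])
  map_add' Υ Υ' := by
    refine LinearMap.ext₂ fun v w => ?_
    simp only [LinearMap.mk₂_apply, LinearMap.add_apply, clForm_add, add_smul]
    abel
  map_smul' r Υ := by
    refine LinearMap.ext₂ fun v w => ?_
    simp only [LinearMap.mk₂_apply, LinearMap.smul_apply, clForm_smul, smul_assoc, smul_add,
      RingHom.id_apply]

lemma modelTensor_apply (Υ : V s t m →ₗ[ℝ] ℝ) (v w : V s t m) :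
    modelTensor Υ v w = clForm Υ v • w + clForm Υ w • v := rfl

lemma modelTensor_comm (Υ : V s t m →ₗ[ℝ] ℝ) (v w : V s t m) :
    modelTensor Υ v w = modelTensor Υ w v := by
  rw [modelTensor_apply, modelTensor_apply, add_comm]

lemma modelTensor_eq_sum (Υ : V s t m →ₗ[ℝ] ℝ) (v w : V s t m) :
    modelTensor Υ v w = ∑ S, ε s t S •
      (Υ (F s t S • v) • F s t S • w + Υ (F s t S • w) • F s t S • v) := by
  simp only [modelTensor_apply, clForm_apply, Finset.sum_smul, smul_add, Finset.sum_add_distrib,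
    smul_assoc]

lemma modelTensor_mem_homLieAlg (Υ : V s t m →ₗ[ℝ] ℝ) : modelTensor Υ ∈ homLieAlg s t m := by
  intro v
  refine ⟨clForm Υ v, (clForm Υ).smulRight v, fun w => ?_⟩
  rw [modelTensor_apply, LinearMap.smulRight_apply, add_comm]

/-- The tensors `S^Υ` are natural for the action of `G`. -/
lemma modelTensor_conj {g : V s t m ≃ₗ[ℝ] V s t m} (hg : g ∈ G s t m) (Υ : V s t m →ₗ[ℝ] ℝ)
    (v w : V s t m) :
    g (modelTensor (Υ ∘ₗ (g : V s t m →ₗ[ℝ] V s t m)) v w) = modelTensor Υ (g v) (g w) := by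
  obtain ⟨q, Q, hQ⟩ := hg
  have hF : ∀ (a : Cl s t) x, g (a • x) = (q * a * ↑q⁻¹ : Cl s t) • g x := by
    intro a x
    rw [hQ, hQ, map_smul, smul_smul, smul_smul, mul_assoc, Units.inv_mul, mul_one]
  let β : Cl s t →ₗ[ℝ] Cl s t →ₗ[ℝ] V s t m :=
    LinearMap.mk₂ ℝ (fun x y => Υ (x • g v) • y • g w + Υ (x • g w) • y • g v)
      (fun x x' y => by simp only [add_smul, map_add]; abel)
      (fun r x y => by simp only [smul_assoc, map_smul, smul_add])
      (fun x y y' => by simp only [add_smul, smul_add]; abel)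
      (fun r x y => by
        rw [smul_assoc, smul_assoc, smul_add, smul_comm r (Υ _), smul_comm r (Υ _)])
  have h1 := casimir_conj q β
  simp only [β, LinearMap.mk₂_apply] at h1
  rw [modelTensor_eq_sum, modelTensor_eq_sum, ← h1, map_sum]
  refine Finset.sum_congr rfl fun S _ => ?_
  simp only [map_smul, map_add, hF, LinearMap.comp_apply, LinearEquiv.coe_coe]

end model

/-! ### Tensors with planar values in the first prolongation of `𝔤` -/

section prolongation

variable {A : Type*} [Ring A] [Algebra ℝ A] {m : ℕ}

/-- The first prolongation of `𝔤` in the noncommutative case. If `d` intertwines, say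
`S(X, cY) = c S(X, Y) + D_c(X) Y`, then comparing the two expansions of `S(cX, dY)` expresses
`[d, c] S(X, Y)` as `γ₁(X) Y + γ₂(Y) X`, and `[d, c]` is invertible for suitable `c` and `d`. -/
lemma exists_clForm_of_commutator {S : (Fin m → A) →ₗ[ℝ] (Fin m → A) →ₗ[ℝ] (Fin m → A)}
    (hS : ∀ X Y, S X Y = S Y X) (hg : ∀ X (c : A), ∃ d : A, ∀ Y, S X (c • Y) = c • S X Y + d • Y)
    {c d : A} (hcd : IsUnit (d * c - c * d)) :
    ∃ α : (Fin m → A) →ₗ[A] A, ∀ X Y, S X Y = α X • Y + α Y • X := by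
  rcases Nat.eq_zero_or_pos m with rfl | hm
  · exact ⟨0, fun X Y => Subsingleton.elim _ _⟩
  obtain ⟨u, hu, hu'⟩ := isUnit_iff_exists.1 hcd
  let i₀ : Fin m := ⟨0, hm⟩
  -- the derivation `D a X`, read off from the value at a basis vector
  let D : A → (Fin m → A) →ₗ[ℝ] A := fun a =>
    { toFun := fun X => (S X (a • Pi.single i₀ 1) - a • S X (Pi.single i₀ 1)) i₀
      map_add' := fun X X' => by
        simp only [map_add, LinearMap.add_apply, smul_add, Pi.sub_apply, Pi.add_apply]
        abel
      map_smul' := fun r X => by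
        simp only [map_smul, LinearMap.smul_apply, Pi.sub_apply, Pi.smul_apply, smul_sub,
          RingHom.id_apply, smul_comm a r] }
  have hD : ∀ a X Y, S X (a • Y) = a • S X Y + D a X • Y := by
    intro a X Y
    obtain ⟨e, he⟩ := hg X a
    have : D a X = e := by
      change (S X (a • Pi.single i₀ 1) - a • S X (Pi.single i₀ 1)) i₀ = e
      rw [he]
      simp
    rw [he, this]
  have hD' : ∀ a X Y, S (a • X) Y = a • S X Y + D a Y • X := by
    intro a X Y
    rw [hS, hD, hS]
  let L : A → A →ₗ[ℝ] A := fun a => LinearMap.mulLeft ℝ a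
  let γ₁ : (Fin m → A) →ₗ[ℝ] A := L u ∘ₗ (L c ∘ₗ D d - D d ∘ₗ Algebra.lsmul ℝ ℝ (Fin m → A) c)
  let γ₂ : (Fin m → A) →ₗ[ℝ] A := L u ∘ₗ (D c ∘ₗ Algebra.lsmul ℝ ℝ (Fin m → A) d - L d ∘ₗ D c)
  have h12 : ∀ X Y, S X Y = γ₁ X • Y + γ₂ Y • X := by
    intro X Y
    have h1 : S (c • X) (d • Y) = d • (c • S X Y + D c Y • X) + D d (c • X) • Y := by
      rw [hD, hD']
    have h2 : S (c • X) (d • Y) = c • (d • S X Y + D d X • Y) + D c (d • Y) • X := by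
      rw [hD', hD]
    have h3 : (d * c - c * d) • S X Y =
        (c * D d X - D d (c • X)) • Y + (D c (d • Y) - d * D c Y) • X := by
      have h4 := h1.symm.trans h2
      simp only [sub_smul, mul_smul, smul_add] at h4 ⊢
      rw [← sub_eq_zero] at h4 ⊢
      rw [← h4]
      abel
    have h5 := congrArg (u • ·) h3
    simp only [← mul_smul, hu', one_smul, smul_add] at h5
    exact h5
  let γ : (Fin m → A) →ₗ[ℝ] A := (2⁻¹ : ℝ) • (γ₁ + γ₂)
  have hγ : ∀ X Y, S X Y = γ X • Y + γ Y • X := by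
    intro X Y
    have h1 : S X Y = (2⁻¹ : ℝ) • (S X Y + S Y X) := by
      rw [hS Y X, ← two_smul ℝ, smul_smul, inv_mul_cancel₀ two_ne_zero, one_smul]
    rw [h1, h12 X Y, h12 Y X]
    simp only [γ, LinearMap.smul_apply, LinearMap.add_apply, smul_assoc, add_smul, smul_add]
    abel
  -- the failure of `A`-linearity of `γ`
  have hη : ∀ a, ∃ θ : (Fin m → A) → A, ∀ X Y, (γ (a • Y) - a * γ Y) • X = θ X • Y := by
    intro a
    refine ⟨fun X => D a X - γ X * a + a * γ X, fun X Y => ?_⟩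
    have h1 := hD a X Y
    rw [hγ, hγ] at h1
    simp only [sub_smul, add_smul, mul_smul, smul_add] at h1 ⊢
    rw [← sub_eq_zero] at h1 ⊢
    rw [← h1]
    abel
  have hlin : ∀ a Y, γ (a • Y) = a * γ Y := by
    intro a Y
    obtain ⟨θ, hθ⟩ := hη a
    set η : (Fin m → A) → A := fun Y => γ (a • Y) - a * γ Y with hηdef
    have hθ' : ∀ X Y, η Y • X = θ X • Y := hθ
    let e : Fin m → A := Pi.single i₀ 1
    have he : e i₀ = 1 := by simp [e]
    have hcoord : ∀ X, θ X = η e * X i₀ := by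
      intro X
      have := congrFun (hθ' X e) i₀
      simpa [he] using this.symm
    have hcoord' : ∀ Y, η Y = η e * Y i₀ := by
      intro Y
      have := congrFun (hθ' e Y) i₀
      rw [hcoord] at this
      simpa [he] using this
    have h0 : η e = 0 := by
      have h1 := congrFun (hθ' (c • e) (d • e)) i₀
      rw [hcoord, hcoord' (d • e)] at h1
      simp only [Pi.smul_apply, smul_eq_mul, he, mul_one] at h1
      have h2 : η e * (d * c - c * d) = 0 := by
        rw [mul_sub, ← mul_assoc, ← mul_assoc, h1, sub_self]
      rw [← mul_one (η e), ← hu, ← mul_assoc, h2, zero_mul]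
    have := hcoord' Y
    rw [h0, zero_mul, hηdef, sub_eq_zero] at this
    exact this
  exact ⟨{ γ with map_smul' := hlin }, hγ⟩

/-- The commutative case: here `S` is bilinear over `A`, and planarity on the vectors
`e_i ± e_j` determines `S(e_i, e_j)`. -/
lemma exists_clForm_of_comm (hA : ∀ a b : A, a * b = b * a)
    {S : (Fin m → A) →ₗ[ℝ] (Fin m → A) →ₗ[ℝ] (Fin m → A)}
    (hS : ∀ X Y, S X Y = S Y X) (hg : ∀ X (c : A) Y, S X (c • Y) = c • S X Y)
    (hpl : ∀ X, ∃ a : A, S X X = a • X) :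
    ∃ α : (Fin m → A) →ₗ[A] A, ∀ X Y, S X Y = α X • Y + α Y • X := by
  let e : Fin m → Fin m → A := fun i => Pi.single i 1
  have hee : ∀ i, e i i = 1 := fun i => by simp [e]
  have hne : ∀ i j, j ≠ i → e i j = 0 := fun i j h => by simp [e, h]
  choose μ hμ using hpl
  let α : (Fin m → A) →ₗ[A] A :=
    { toFun := fun X => ∑ i, X i * ((2⁻¹ : ℝ) • μ (e i))
      map_add' := fun X Y => by simp only [Pi.add_apply, add_mul, Finset.sum_add_distrib]
      map_smul' := fun a X => by
        simp only [Pi.smul_apply, smul_eq_mul, mul_assoc, Finset.mul_sum, RingHom.id_apply] }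
  have hαe : ∀ i, α (e i) = (2⁻¹ : ℝ) • μ (e i) := by
    intro i
    change ∑ j, e i j * ((2⁻¹ : ℝ) • μ (e j)) = _
    rw [Finset.sum_eq_single i (fun j _ h => by rw [hne i j h, zero_mul]) (by simp), hee, one_mul]
  have hbasis : ∀ i j, S (e i) (e j) = α (e i) • e j + α (e j) • e i := by
    intro i j
    rw [hαe, hαe]
    by_cases hij : i = j
    · subst hij
      rw [hμ, ← add_smul, ← two_smul ℝ (_ • μ (e i)), smul_smul, mul_inv_cancel₀ two_ne_zero,
        one_smul]
    · have h1 := hμ (e i + e j)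
      have h2 := hμ (e i - e j)
      simp only [map_add, map_sub, LinearMap.add_apply, LinearMap.sub_apply, hμ (e i), hμ (e j),
        hS (e j) (e i)] at h1 h2
      set x := S (e i) (e j)
      set p := μ (e i + e j)
      set q := μ (e i - e j)
      funext l
      have h1l := congrFun h1 l
      have h2l := congrFun h2 l
      simp only [Pi.add_apply, Pi.sub_apply, Pi.smul_apply, smul_eq_mul] at h1l h2l ⊢
      have hhalf : ∀ a b : A, a + a = b → a = (2⁻¹ : ℝ) • b := by
        rintro a _ rfl
        rw [← two_smul ℝ, smul_smul, inv_mul_cancel₀ two_ne_zero, one_smul]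
      have h1i := congrFun h1 i
      have h1j := congrFun h1 j
      have h2i := congrFun h2 i
      have h2j := congrFun h2 j
      simp only [Pi.add_apply, Pi.sub_apply, Pi.smul_apply, smul_eq_mul, hee, hne i j (Ne.symm hij),
        hne j i hij, mul_one, mul_zero, add_zero, sub_zero, zero_add, zero_sub, mul_neg]
        at h1i h1j h2i h2j
      by_cases hli : l = i
      · subst hli
        rw [hee, hne j l hij, mul_zero, mul_one, zero_add]
        linear_combination (norm := module) (4⁻¹ : ℝ) • h1i - (4⁻¹ : ℝ) • h2i - (4⁻¹ : ℝ) • h1j -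
          (4⁻¹ : ℝ) • h2j
      · by_cases hlj : l = j
        · subst hlj
          rw [hee, hne i l hli, mul_zero, mul_one, add_zero]
          linear_combination (norm := module) (4⁻¹ : ℝ) • h1j - (4⁻¹ : ℝ) • h2j - (4⁻¹ : ℝ) • h1i -
            (4⁻¹ : ℝ) • h2i
        · rw [hne i l hli, hne j l hlj] at h1l ⊢
          simp only [mul_zero, add_zero, zero_add] at h1l ⊢
          rw [hhalf _ _ h1l, smul_zero]
  refine ⟨α, fun X Y => ?_⟩
  have hsum : ∀ X : Fin m → A, X = ∑ i, X i • e i := by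
    intro X
    funext l
    rw [Finset.sum_apply, Finset.sum_eq_single l]
    · simp [hee]
    · intro i _ h
      simp [hne i l (Ne.symm h)]
    · simp
  have hl : ∀ Y, ∀ i, S (e i) Y = α (e i) • Y + α Y • e i := by
    intro Y i
    conv_lhs => rw [hsum Y]
    rw [map_sum]
    simp only [hg, hbasis, smul_add, Finset.sum_add_distrib]
    congr 1
    · conv_rhs => rw [hsum Y, Finset.smul_sum]
      exact Finset.sum_congr rfl fun j _ => by rw [← mul_smul, hA, mul_smul]
    · conv_rhs => rw [hsum Y, map_sum, Finset.sum_smul]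
      exact Finset.sum_congr rfl fun j _ => by rw [map_smul, smul_assoc]
  have hr : ∀ i (a : A), S (a • e i) Y = a • S (e i) Y := fun i a => by rw [hS, hg, hS]
  conv_lhs => rw [hsum X]
  rw [map_sum, LinearMap.sum_apply]
  simp only [hr, hl, smul_add, Finset.sum_add_distrib]
  congr 1
  · conv_rhs => rw [hsum X, map_sum, Finset.sum_smul]
    exact Finset.sum_congr rfl fun i _ => by rw [map_smul, smul_assoc]
  · conv_rhs => rw [hsum X, Finset.smul_sum]
    exact Finset.sum_congr rfl fun i _ => by rw [← mul_smul, hA, mul_smul]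

end prolongation

/-! ### Recovering `Υ` from `S^Υ` -/

section model

variable {s t m : ℕ}

/-- The real linear form `Υ` for which `S = S^Υ`, if there is one: the `𝒪`-linear form `α` with
`S(v, w) = α(v) w + α(w) v` is `e_j ↦ ½ S(e_j, e_j)_j` on the standard basis, and `Υ = τ ∘ α`. -/
def recoverForm (τ : Cl s t →ₗ[ℝ] ℝ) : Bil s t m →ₗ[ℝ] V s t m →ₗ[ℝ] ℝ where
  toFun S :=
    { toFun := fun v => ∑ j, τ (v j * (2⁻¹ : ℝ) • S (Pi.single j 1) (Pi.single j 1) j)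
      map_add' := fun v w => by
        simp only [Pi.add_apply, add_mul, map_add, Finset.sum_add_distrib]
      map_smul' := fun r v => by
        simp only [Pi.smul_apply, smul_mul_assoc, map_smul, Finset.smul_sum, RingHom.id_apply] }
  map_add' S T := by
    refine LinearMap.ext fun v => ?_
    simp only [LinearMap.add_apply, LinearMap.coe_mk, AddHom.coe_mk, Pi.add_apply, smul_add,
      mul_add, map_add, Finset.sum_add_distrib]
  map_smul' r S := by
    refine LinearMap.ext fun v => ?_
    simp only [LinearMap.smul_apply, LinearMap.coe_mk, AddHom.coe_mk, Pi.smul_apply,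
      RingHom.id_apply, Finset.smul_sum]
    exact Finset.sum_congr rfl fun j _ => by rw [smul_comm, mul_smul_comm, map_smul]

lemma recoverForm_apply (τ : Cl s t →ₗ[ℝ] ℝ) (S : Bil s t m) (v : V s t m) :
    recoverForm τ S v = ∑ j, τ (v j * (2⁻¹ : ℝ) • S (Pi.single j 1) (Pi.single j 1) j) := rfl

lemma recoverForm_of_eq (τ : Cl s t →ₗ[ℝ] ℝ) {S : Bil s t m} {α : V s t m →ₗ[Cl s t] Cl s t}
    (h : ∀ v w, S v w = α v • w + α w • v) (v : V s t m) : recoverForm τ S v = τ (α v) := by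
  have h1 : ∀ j, (2⁻¹ : ℝ) • S (Pi.single j 1) (Pi.single j 1) j = α (Pi.single j 1) := by
    intro j
    rw [h, ← two_smul ℝ, Pi.smul_apply, smul_smul, inv_mul_cancel₀ two_ne_zero, one_smul]
    simp
  have h2 : v = ∑ j, v j • (Pi.single j 1 : V s t m) := by
    conv_lhs => rw [← Finset.univ_sum_single v]
    refine Finset.sum_congr rfl fun j _ => ?_
    rw [← Pi.single_smul, smul_eq_mul, mul_one]
  conv_rhs => rw [h2, map_sum, map_sum]
  simp only [recoverForm_apply, h1, map_smul, smul_eq_mul]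

/-- `Υ ↦ S^Υ` is injective, and its values are the symmetric elements `S` of `𝔤 ⊗ 𝕍*` with
`S(v, v) ∈ 𝒪 v` for all `v`. The hypothesis on the dimension is used to see that the `F_S` are
linearly independent in the Clifford algebra; on a manifold a frame provides it. -/
lemma exists_recoverForm (h : Module.finrank ℝ (V s t m) = 2 ^ (s + t) * m) :
    ∃ τ : Cl s t →ₗ[ℝ] ℝ, (∀ Υ : V s t m →ₗ[ℝ] ℝ, recoverForm τ (modelTensor Υ) = Υ) ∧
      ∀ S ∈ homLieAlg s t m, (∀ v w, S v w = S w v) → (∀ v, ∃ a : Cl s t, S v v = a • v) →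
        modelTensor (recoverForm τ S) = S := by
  rcases Nat.eq_zero_or_pos m with rfl | hm
  · refine ⟨0, fun Υ => LinearMap.ext fun v => ?_, fun S _ _ _ => ?_⟩
    · rw [Subsingleton.elim v 0, map_zero, map_zero]
    · exact LinearMap.ext₂ fun v w => Subsingleton.elim _ _
  have hfin : 2 ^ (s + t) ≤ Module.finrank ℝ (Cl s t) := by
    rw [Module.finrank_pi_fintype] at h
    simp only [Finset.sum_const, Finset.card_univ, Fintype.card_fin, smul_eq_mul] at h
    rw [mul_comm] at h
    exact (Nat.eq_of_mul_eq_mul_right hm h).ge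
  obtain ⟨τ, hτ, hdual⟩ := exists_trace hfin
  refine ⟨τ, fun Υ => LinearMap.ext fun v => ?_, fun S hg hS hpl => ?_⟩
  · rw [recoverForm_of_eq τ (α := clForm Υ) (fun v w => rfl), clForm_apply, map_sum]
    simp only [map_smul, hτ, smul_eq_mul, mul_ite, mul_one, mul_zero, Finset.sum_ite_eq',
      Finset.mem_univ, if_true, F_empty, one_smul]
    simp [ε]
  · have hα : ∃ α : V s t m →ₗ[Cl s t] Cl s t, ∀ X Y, S X Y = α X • Y + α Y • X := by
      rcases comm_or_exists_commutator s t with hcomm | ⟨c, d, hcd⟩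
      · refine exists_clForm_of_comm hcomm hS (fun X c Y => ?_) hpl
        obtain ⟨a, B₀, hB⟩ := hg X
        rw [hB, hB, map_smul, smul_add, ← mul_smul, ← mul_smul, hcomm]
      · exact exists_clForm_of_commutator hS (fun X a => mem_lieAlg_iff.1 (hg X) a) hcd
    obtain ⟨α, hα⟩ := hα
    refine LinearMap.ext₂ fun v w => ?_
    have h1 : ∀ v, clForm (recoverForm τ S) v = α v := by
      intro v
      conv_rhs => rw [← hdual (α v)]
      rw [clForm_apply]
      refine Finset.sum_congr rfl fun T _ => ?_
      rw [recoverForm_of_eq τ hα, map_smul, smul_smul, smul_eq_mul]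
    rw [modelTensor_apply, h1, h1, hα]

/-! ### Normalizing the torsion -/

lemma exists_linear_correction {W : Type*} [AddCommMonoid W] [Module ℝ W] {a : W →ₗ[ℝ] W}
    {H D A : Submodule ℝ W} (h : H.map a ⊔ D = A) :
    ∃ ψ : W →ₗ[ℝ] W, ∀ T ∈ A, ψ T ∈ H ∧ T + a (ψ T) ∈ D := by
  let : AddCommGroup W := Module.addCommMonoidToAddCommGroup ℝ
  let f : (H × D) →ₗ[ℝ] A :=
    LinearMap.codRestrict A (D.subtype ∘ₗ LinearMap.snd ℝ H D -
      a ∘ₗ H.subtype ∘ₗ LinearMap.fst ℝ H D)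
      (fun x => by
        rw [← h]
        exact Submodule.sub_mem _ (Submodule.mem_sup_right x.2.2)
          (Submodule.mem_sup_left (Submodule.mem_map_of_mem x.1.2)))
  have hf : LinearMap.range f = ⊤ := by
    refine LinearMap.range_eq_top.2 fun T => ?_
    obtain ⟨_, ⟨φ, hφ, rfl⟩, d, hd, hT⟩ := Submodule.mem_sup.1 (h.ge T.2)
    refine ⟨(-⟨φ, hφ⟩, ⟨d, hd⟩), Subtype.ext ?_⟩
    rw [← hT]
    simp [f, add_comm]
  obtain ⟨g, hg⟩ := LinearMap.exists_rightInverse_of_surjective f hf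
  obtain ⟨ψ, hψ⟩ := LinearMap.exists_extend (H.subtype ∘ₗ LinearMap.fst ℝ H D ∘ₗ g)
  refine ⟨ψ, fun T hT => ?_⟩
  have h1 : ψ T = (g ⟨T, hT⟩).1 := LinearMap.congr_fun hψ ⟨T, hT⟩
  have h2 : ((g ⟨T, hT⟩).2 : W) - a (g ⟨T, hT⟩).1 = T :=
    congrArg Subtype.val (LinearMap.congr_fun hg ⟨T, hT⟩)
  rw [h1]
  refine ⟨(g ⟨T, hT⟩).1.2, ?_⟩
  nth_rw 1 [← h2]
  rw [sub_add_cancel]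
  exact (g ⟨T, hT⟩).2.2

variable {D : Submodule ℝ (Bil s t m)}

/-- The `𝒟`-part of an alternating map is reached by adding `∂φ` with `φ ∈ 𝔤 ⊗ 𝕍*` depending
linearly on the map. -/
lemma IsInvariantComplement.exists_correction (hD : IsInvariantComplement s t m D) :
    ∃ ψ : Bil s t m →ₗ[ℝ] Bil s t m, ∀ T ∈ altMaps s t m,
      ψ T ∈ homLieAlg s t m ∧ T + alternation s t m (ψ T) ∈ D :=
  exists_linear_correction hD.sup_eq

lemma IsInvariantComplement.symm_of_alternation_mem (hD : IsInvariantComplement s t m D)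
    {φ : Bil s t m} (hφ : φ ∈ homLieAlg s t m) (h : alternation s t m φ ∈ D) (v w : V s t m) :
    φ v w = φ w v := by
  have h1 : alternation s t m φ ∈ (homLieAlg s t m).map (alternation s t m) ⊓ D :=
    ⟨Submodule.mem_map_of_mem hφ, h⟩
  rw [hD.inf_eq, Submodule.mem_bot] at h1
  exact sub_eq_zero.1 (LinearMap.congr_fun₂ h1 v w)

end model

/-! ### Smooth local frames and covariant derivatives -/

section bundle

set_option linter.unusedSectionVars false

open scoped Topology

variable {E' : Type*} [NormedAddCommGroup E'] [NormedSpace ℝ E'] {H : Type*} [TopologicalSpace H]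
  {I : ModelWithCorners ℝ E' H} {M : Type*} [TopologicalSpace M] [ChartedSpace H M]
  {Fb : Type*} [NormedAddCommGroup Fb] [NormedSpace ℝ Fb] [FiniteDimensional ℝ Fb]
  {W : M → Type*} [TopologicalSpace (TotalSpace Fb W)] [∀ x, AddCommGroup (W x)]
  [∀ x, Module ℝ (W x)] [∀ x, TopologicalSpace (W x)] [∀ x, IsTopologicalAddGroup (W x)]
  [∀ x, ContinuousSMul ℝ (W x)] [FiberBundle Fb W] [VectorBundle ℝ Fb W]
  {n : ℕ∞ω} {x : M}

/-- A map into continuous linear maps from a finite-dimensional space is smooth if its evaluations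
at all vectors are. -/
lemma contMDiffAt_clm_of_apply {G' : Type*} [NormedAddCommGroup G'] [NormedSpace ℝ G']
    {f : M → Fb →L[ℝ] G'} (hf : ∀ v, ContMDiffAt I 𝓘(ℝ, G') n (fun y => f y v) x) :
    ContMDiffAt I 𝓘(ℝ, Fb →L[ℝ] G') n f x := by
  let b := Module.finBasis ℝ Fb
  have h1 : f = fun y => ∑ i, ContinuousLinearMap.smulRightL ℝ Fb G'
      (LinearMap.toContinuousLinearMap (b.coord i)) (f y (b i)) := by
    funext y
    ext v
    conv_lhs => rw [← b.sum_repr v, map_sum]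
    simp
  rw [h1]
  refine contMDiffAt_finsetSum fun i _ => ?_
  exact ((ContinuousLinearMap.contMDiff _).contMDiffAt).comp x (hf (b i))

variable {q : ∀ y, Fb ≃ₗ[ℝ] W y}

/-- The coordinates in a smooth frame `q` are obtained from those in a trivialization by a smooth
family of linear maps. -/
lemma exists_coord_eq [ContMDiffVectorBundle n Fb W I]
    (hq : ∀ v, ContMDiffAt I (I.prod 𝓘(ℝ, Fb)) n (fun y => TotalSpace.mk' Fb y (q y v)) x) :
    ∃ C : M → Fb →L[ℝ] Fb, ContMDiffAt I 𝓘(ℝ, Fb →L[ℝ] Fb) n C x ∧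
      ∀ᶠ y in 𝓝 x, ∀ w : W y, (q y).symm w =
        C y (trivializationAt Fb W x (TotalSpace.mk' Fb y w)).2 := by
  set e := trivializationAt Fb W x with he
  have hx : x ∈ e.baseSet := FiberBundle.mem_baseSet_trivializationAt' x
  let A : M → Fb →L[ℝ] Fb := fun y =>
    LinearMap.toContinuousLinearMap ((e.linearMapAt ℝ y).comp (q y : Fb →ₗ[ℝ] W y))
  have hA : ∀ y ∈ e.baseSet, ∀ v, A y v = (e (TotalSpace.mk' Fb y (q y v))).2 := by
    intro y hy v
    simp [A, e.coe_linearMapAt_of_mem hy]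
  have hAs : ContMDiffAt I 𝓘(ℝ, Fb →L[ℝ] Fb) n A x := by
    refine contMDiffAt_clm_of_apply fun v => ?_
    refine ((e.contMDiffAt_section_iff hx).1 (hq v)).congr_of_eventuallyEq ?_
    filter_upwards [e.open_baseSet.mem_nhds hx] with y hy
    exact hA y hy v
  let ex : ∀ y ∈ e.baseSet, Fb ≃L[ℝ] Fb := fun y hy =>
    ((q y).trans (e.linearEquivAt ℝ y hy)).toContinuousLinearEquiv
  have hex : ∀ y (hy : y ∈ e.baseSet), (ex y hy : Fb →L[ℝ] Fb) = A y := by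
    intro y hy
    ext v
    rw [hA y hy]
    rfl
  refine ⟨fun y => (A y).inverse, ?_, ?_⟩
  · have h1 : ContDiffAt ℝ n ContinuousLinearMap.inverse (A x) := by
      rw [← hex x hx]
      exact contDiffAt_map_inverse _
    exact ContMDiffAt.comp x h1.contMDiffAt hAs
  · filter_upwards [e.open_baseSet.mem_nhds hx] with y hy w
    rw [← hex y hy, ContinuousLinearMap.inverse_equiv]
    change _ = (ex y hy).symm (e.linearEquivAt ℝ y hy w)
    rw [ContinuousLinearEquiv.eq_symm_apply]
    change e.linearEquivAt ℝ y hy (q y ((q y).symm w)) = _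
    rw [LinearEquiv.apply_symm_apply]

lemma contMDiffAt_coord [ContMDiffVectorBundle n Fb W I]
    (hq : ∀ v, ContMDiffAt I (I.prod 𝓘(ℝ, Fb)) n (fun y => TotalSpace.mk' Fb y (q y v)) x)
    {σ : ∀ y, W y} (hσ : ContMDiffAt I (I.prod 𝓘(ℝ, Fb)) n (fun y => TotalSpace.mk' Fb y (σ y)) x) :
    ContMDiffAt I 𝓘(ℝ, Fb) n (fun y => (q y).symm (σ y)) x := by
  obtain ⟨C, hC, hCq⟩ := exists_coord_eq hq
  have h1 := ((trivializationAt Fb W x).contMDiffAt_section_iff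
    (FiberBundle.mem_baseSet_trivializationAt' x)).1 hσ
  refine (hC.clm_apply h1).congr_of_eventuallyEq ?_
  filter_upwards [hCq] with y hy
  exact hy _

lemma mdifferentiableAt_coord [ContMDiffVectorBundle 1 Fb W I]
    (hq : ∀ v, ContMDiffAt I (I.prod 𝓘(ℝ, Fb)) 1 (fun y => TotalSpace.mk' Fb y (q y v)) x)
    {σ : ∀ y, W y}
    (hσ : MDifferentiableAt I (I.prod 𝓘(ℝ, Fb)) (fun y => TotalSpace.mk' Fb y (σ y)) x) :
    MDifferentiableAt I 𝓘(ℝ, Fb) (fun y => (q y).symm (σ y)) x := by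
  obtain ⟨C, hC, hCq⟩ := exists_coord_eq hq
  have h1 := ((trivializationAt Fb W x).mdifferentiableAt_section_iff I _
    (FiberBundle.mem_baseSet_trivializationAt' x)).1 hσ
  refine ((hC.mdifferentiableAt one_ne_zero).clm_apply h1).congr_of_eventuallyEq ?_
  filter_upwards [hCq] with y hy
  exact hy _

variable {Fm : Type*} [NormedAddCommGroup Fm] [NormedSpace ℝ Fm] [FiniteDimensional ℝ Fm]

lemma eq_sum_frame {ql : ∀ y, Fm →ₗ[ℝ] W y} (h : M → Fm) :
    (fun y => ql y (h y)) = ∑ i, (fun y => (Module.finBasis ℝ Fm).coord i (h y)) •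
      fun y => ql y (Module.finBasis ℝ Fm i) := by
  funext y
  rw [Finset.sum_apply]
  conv_lhs => rw [← (Module.finBasis ℝ Fm).sum_repr (h y), map_sum]
  simp

lemma contMDiffAt_frame_apply {ql : ∀ y, Fm →ₗ[ℝ] W y}
    (hq : ∀ v, ContMDiffAt I (I.prod 𝓘(ℝ, Fb)) n (fun y => TotalSpace.mk' Fb y (ql y v)) x)
    {h : M → Fm} (hh : ContMDiffAt I 𝓘(ℝ, Fm) n h x) :
    ContMDiffAt I (I.prod 𝓘(ℝ, Fb)) n (fun y => TotalSpace.mk' Fb y (ql y (h y))) x := by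
  have h1 := eq_sum_frame (ql := ql) h
  have h2 : ∀ y, ql y (h y) = ∑ i, ((Module.finBasis ℝ Fm).coord i (h y)) •
      ql y (Module.finBasis ℝ Fm i) := fun y => by simpa using congrFun h1 y
  simp only [h2]
  refine ContMDiffAt.sum_section fun i _ => ContMDiffAt.smul_section ?_ (hq _)
  exact ((ContinuousLinearMap.contMDiff (LinearMap.toContinuousLinearMap
    ((Module.finBasis ℝ Fm).coord i))).contMDiffAt).comp x hh

lemma mdifferentiableAt_linear_comp {h : M → Fm} (hh : MDifferentiableAt I 𝓘(ℝ, Fm) h x)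
    (ℓ : Fm →ₗ[ℝ] ℝ) : MDifferentiableAt I 𝓘(ℝ, ℝ) (fun y => ℓ (h y)) x :=
  MDifferentiableAt.comp x (LinearMap.toContinuousLinearMap ℓ).differentiableAt.mdifferentiableAt hh

/-- The covariant derivative of a section with variable coordinates `h` in a frame. -/
lemma cov_frame_apply
    {cov : (∀ y : M, W y) → (∀ y : M, TangentSpace I y →L[ℝ] W y)} {u : Set M}
    (hcov : IsCovariantDerivativeOn Fb cov u) (hx : x ∈ u) {ql : ∀ y, Fm →ₗ[ℝ] W y}
    (hq : ∀ v, MDifferentiableAt I (I.prod 𝓘(ℝ, Fb)) (fun y => TotalSpace.mk' Fb y (ql y v)) x)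
    {h : M → Fm} (hh : MDifferentiableAt I 𝓘(ℝ, Fm) h x) (X : TangentSpace I x) :
    cov (fun y => ql y (h y)) x X =
      ql x (mvfderiv I h x X) + cov (fun y => ql y (h x)) x X := by
  have hsum : ∀ (T : Finset (Fin (Module.finrank ℝ Fm))) (g : Fin (Module.finrank ℝ Fm) → M → ℝ),
      (∀ i, MDifferentiableAt I 𝓘(ℝ, ℝ) (g i) x) →
      cov (∑ i ∈ T, g i • fun y => ql y (Module.finBasis ℝ Fm i)) x X =
        ∑ i ∈ T, (g i x • cov (fun y => ql y (Module.finBasis ℝ Fm i)) x X +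
          (mvfderiv I (g i) x X) • ql x (Module.finBasis ℝ Fm i)) := by
    intro T g hg
    induction T using Finset.induction_on with
    | empty => simp [hcov.zero hx]
    | insert i T hi ih =>
      rw [Finset.sum_insert hi, Finset.sum_insert hi, ← ih, hcov.add _ _ hx,
        hcov.leibniz (hq _) (hg i) hx]
      · rfl
      · exact (hg i).smul_section (hq _)
      · have := MDifferentiableAt.sum_section (s := T) (t := fun i =>
          g i • fun y => ql y (Module.finBasis ℝ Fm i)) (x₀ := x) (I := I) (F := Fb)
            fun j _ => (hg j).smul_section (hq _)
        simpa using this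
  have hc : ∀ i, mvfderiv I (fun y => (Module.finBasis ℝ Fm).coord i (h y)) x X =
      (Module.finBasis ℝ Fm).coord i (mvfderiv I h x X) := by
    intro i
    have h1 := mfderiv_comp x (I' := 𝓘(ℝ, Fm)) (I'' := 𝓘(ℝ, ℝ))
      (g := LinearMap.toContinuousLinearMap ((Module.finBasis ℝ Fm).coord i))
      (LinearMap.toContinuousLinearMap
        ((Module.finBasis ℝ Fm).coord i)).differentiableAt.mdifferentiableAt hh
    rw [mfderiv_eq_fderiv, ContinuousLinearMap.fderiv] at h1
    exact congrArg (fun L => L X) h1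
  rw [eq_sum_frame, hsum _ _ fun i => mdifferentiableAt_linear_comp hh _]
  conv_rhs => rw [eq_sum_frame (fun _ => h x), hsum _ _ fun i => mdifferentiableAt_const]
  rw [Finset.sum_add_distrib, Finset.sum_add_distrib, add_comm]
  congr 1
  · conv_rhs => rw [← (Module.finBasis ℝ Fm).sum_repr (mvfderiv I h x X), map_sum]
    refine Finset.sum_congr rfl fun i _ => ?_
    rw [hc, map_smul]
    rfl
  · simp [mvfderiv]

/-- A section of a bundle of homomorphisms is smooth if its values on a smooth frame are. -/
lemma contMDiffAt_hom_of_frame [ContMDiffVectorBundle n Fb W I]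
    {F₂ : Type*} [NormedAddCommGroup F₂] [NormedSpace ℝ F₂] [FiniteDimensional ℝ F₂]
    {W₂ : M → Type*} [TopologicalSpace (TotalSpace F₂ W₂)] [∀ x, AddCommGroup (W₂ x)]
    [∀ x, Module ℝ (W₂ x)] [∀ x, TopologicalSpace (W₂ x)] [∀ x, IsTopologicalAddGroup (W₂ x)]
    [∀ x, ContinuousSMul ℝ (W₂ x)] [FiberBundle F₂ W₂] [VectorBundle ℝ F₂ W₂]
    [ContMDiffVectorBundle n F₂ W₂ I]
    (hq : ∀ v, ContMDiffAt I (I.prod 𝓘(ℝ, Fb)) n (fun y => TotalSpace.mk' Fb y (q y v)) x)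
    {A : ∀ y, W y →L[ℝ] W₂ y}
    (hA : ∀ v, ContMDiffAt I (I.prod 𝓘(ℝ, F₂)) n (fun y => TotalSpace.mk' F₂ y (A y (q y v))) x) :
    ContMDiffAt I (I.prod 𝓘(ℝ, Fb →L[ℝ] F₂)) n
      (fun y => TotalSpace.mk' (Fb →L[ℝ] F₂) (E := fun y => W y →L[ℝ] W₂ y) y (A y)) x := by
  set e := trivializationAt Fb W x with he
  have hx : x ∈ e.baseSet := FiberBundle.mem_baseSet_trivializationAt' x
  set e₂ := trivializationAt F₂ W₂ x with he₂
  have hx₂ : x ∈ e₂.baseSet := FiberBundle.mem_baseSet_trivializationAt' x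
  rw [contMDiffAt_hom_bundle]
  refine ⟨contMDiffAt_id, contMDiffAt_clm_of_apply fun v => ?_⟩
  have h1 : ContMDiffAt I (I.prod 𝓘(ℝ, Fb)) n (fun y => TotalSpace.mk' Fb y (e.symm y v)) x := by
    rw [e.contMDiffAt_section_iff hx]
    refine (contMDiffAt_const (c := v)).congr_of_eventuallyEq ?_
    filter_upwards [e.open_baseSet.mem_nhds hx] with y hy
    change (e (TotalSpace.mk' Fb y (e.symm y v))).2 = v
    rw [e.apply_mk_symm hy]
  have h2 := contMDiffAt_frame_apply (ql := fun y => (A y : W y →ₗ[ℝ] W₂ y) ∘ₗ (q y).toLinearMap)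
    hA (contMDiffAt_coord hq h1)
  refine ((e₂.contMDiffAt_section_iff hx₂).1 h2).congr_of_eventuallyEq ?_
  filter_upwards [e.open_baseSet.mem_nhds hx, e₂.open_baseSet.mem_nhds hx₂] with y hy hy₂
  rw [ContinuousLinearMap.inCoordinates_eq hy hy₂]
  simp [he, he₂]

/-- The covariant derivative of a smooth local section is smooth. -/
lemma contMDiffAt_cov [FiniteDimensional ℝ E'] [T2Space M] [IsManifold I ∞ M]
    [ContMDiffVectorBundle ∞ Fb W I]
    {cov : CovariantDerivative I Fb W} (hcov : cov.ContMDiffCovariantDerivative ∞) {U : Set M}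
    (hU : IsOpen U) (hx : x ∈ U) {σ : ∀ y, W y}
    (hσ : ContMDiffOn I (I.prod 𝓘(ℝ, Fb)) ∞ (fun y => TotalSpace.mk' Fb y (σ y)) U) :
    ContMDiffAt I (I.prod 𝓘(ℝ, E' →L[ℝ] Fb)) ∞
      (fun y => TotalSpace.mk' (E' →L[ℝ] Fb) (E := fun y => TangentSpace I y →L[ℝ] W y)
        y (cov σ y)) x := by
  obtain ⟨f, -, hf⟩ := (SmoothBumpFunction.nhds_basis_tsupport (I := I) x).mem_iff.1
    (hU.mem_nhds hx)
  have h1 : ContMDiff I (I.prod 𝓘(ℝ, Fb)) ∞ (fun y => TotalSpace.mk' Fb y (f y • σ y)) :=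
    ContMDiffOn.smul_section_of_tsupport f.contMDiff.contMDiffOn hU hf hσ
  have h2 := (hcov.contMDiff.contMDiff (σ := fun y => f y • σ y) h1.contMDiffOn).contMDiffAt
    (x := x) Filter.univ_mem
  refine h2.congr_of_eventuallyEq ?_
  filter_upwards [f.eventuallyEq_one.eventually_nhds, hU.mem_nhds hx] with y hy hyU
  have h3 : MDifferentiableAt I (I.prod 𝓘(ℝ, Fb)) (fun y => TotalSpace.mk' Fb y (σ y)) y :=
    (hσ.contMDiffAt (hU.mem_nhds hyU)).mdifferentiableAt (by simp)
  have h4 : cov σ y = cov (fun y => f y • σ y) y := by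
    refine cov.isCovariantDerivativeOnUniv.congr_of_eventuallyEq h3
      ((h1 y).mdifferentiableAt (by simp)) Filter.univ_mem ?_
    filter_upwards [hy] with z hz
    rw [hz, Pi.one_apply, one_smul]
  exact congrArg (TotalSpace.mk' (E' →L[ℝ] Fb) (E := fun y => TangentSpace I y →L[ℝ] W y) y) h4

/-- Every vector of a fibre is the value of a smooth global section. -/
lemma exists_contMDiffSection_apply_eq [FiniteDimensional ℝ E'] [T2Space M] [IsManifold I ∞ M]
    [ContMDiffVectorBundle ∞ Fb W I] (w : W x) : ∃ σ : ContMDiffSection I Fb ∞ W, σ x = w := by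
  obtain ⟨u, hu, hσ⟩ := FiberBundle.exists_contMDiffOn_extend (k := ∞) I Fb w
  obtain ⟨U, hUu, hU, hxU⟩ := mem_nhds_iff.1 hu
  obtain ⟨f, -, hf⟩ := (SmoothBumpFunction.nhds_basis_tsupport (I := I) x).mem_iff.1
    (hU.mem_nhds hxU)
  refine ⟨⟨_, ContMDiffOn.smul_section_of_tsupport f.contMDiff.contMDiffOn hU hf (hσ.mono hUu)⟩, ?_⟩
  change f x • FiberBundle.extend Fb w x = w
  rw [FiberBundle.extend_apply_self, f.eq_one, one_smul]

end bundle

/-! ### Accelerations of curves and existence of planar curves -/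

section curves

open scoped Topology

variable {s t m : ℕ} {M : Type*} [TopologicalSpace M] [ChartedSpace (E s t m) M]
  [IsManifold 𝓘(ℝ, E s t m) ∞ M]

instance (x : M) : FiniteDimensional ℝ (TM s t m x) :=
  inferInstanceAs (FiniteDimensional ℝ (E s t m))

instance (x : M) : T2Space (TM s t m x) := inferInstanceAs (T2Space (E s t m))

lemma contMDiffAt_symmL
    (e : Trivialization (E s t m)
      (π (E s t m) (TangentSpace 𝓘(ℝ, E s t m) : M → Type _))) [MemTrivializationAtlas e]
    {x : M} (hx : x ∈ e.baseSet) (v : E s t m) :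
    ContMDiffAt 𝓘(ℝ, E s t m) (𝓘(ℝ, E s t m).prod 𝓘(ℝ, E s t m)) ∞
      (fun y => TotalSpace.mk' (E s t m) (E := TangentSpace 𝓘(ℝ, E s t m)) y
        (e.symmL ℝ y v)) x := by
  rw [e.contMDiffAt_section_iff hx]
  refine (contMDiffAt_const (c := v)).congr_of_eventuallyEq ?_
  filter_upwards [e.open_baseSet.mem_nhds hx] with y hy
  change (e (TotalSpace.mk' (E s t m) y (e.symmL ℝ y v))).2 = v
  rw [e.symmL_apply hy, e.apply_mk_symm hy]

lemma cov_congr (cov : Conn s t m M) {x : M} {σ σ' : ∀ y : M, TM s t m y}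
    (hσ : MDifferentiableAt 𝓘(ℝ, E s t m) (𝓘(ℝ, E s t m).prod 𝓘(ℝ, E s t m))
      (fun y => TotalSpace.mk' (E s t m) (E := TangentSpace 𝓘(ℝ, E s t m)) y (σ y)) x)
    (h : ∀ᶠ y in 𝓝 x, σ' y = σ y) : cov σ' x = cov σ x := by
  refine (cov.isCovariantDerivativeOnUniv.congr_of_eventuallyEq hσ ?_ Filter.univ_mem
    (h.mono fun y hy => hy.symm)).symm
  refine hσ.congr_of_eventuallyEq ?_
  filter_upwards [h] with y hy
  rw [hy]

lemma acceleration_eq_symmL (cov : Conn s t m M) (c : ℝ → M) (τ : ℝ) :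
    acceleration cov c τ =
      (trivializationAt (E s t m) (TangentSpace 𝓘(ℝ, E s t m) : M → Type _) (c τ)).symmL ℝ (c τ)
        (deriv (fun σ => (trivializationAt (E s t m) (TangentSpace 𝓘(ℝ, E s t m)) (c τ)
          (TotalSpace.mk' (E s t m) (E := TangentSpace 𝓘(ℝ, E s t m)) (c σ)
            (velocity (s := s) (t := t) (m := m) c σ))).2) τ) +
      cov (fun y => (trivializationAt (E s t m) (TangentSpace 𝓘(ℝ, E s t m) : M → Type _)
          (c τ)).symmL ℝ y (trivializationAt (E s t m) (TangentSpace 𝓘(ℝ, E s t m)) (c τ)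
          (TotalSpace.mk' (E s t m) (E := TangentSpace 𝓘(ℝ, E s t m)) (c τ)
            (velocity (s := s) (t := t) (m := m) c τ))).2) (c τ) (velocity c τ) := by
  have hx := FiberBundle.mem_baseSet_trivializationAt' (F := E s t m)
    (E := (TangentSpace 𝓘(ℝ, E s t m) : M → Type _)) (c τ)
  have h1 := cov_congr cov ((contMDiffAt_symmL _ hx (trivializationAt (E s t m)
    (TangentSpace 𝓘(ℝ, E s t m)) (c τ)
          (TotalSpace.mk' (E s t m) (E := TangentSpace 𝓘(ℝ, E s t m)) (c τ)
            (velocity (s := s) (t := t) (m := m) c τ))).2).mdifferentiableAt (by simp))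
    (by
      filter_upwards [(Trivialization.open_baseSet _).mem_nhds hx] with y hy
      exact (Trivialization.symmL_apply _ hy _).symm)
  rw [← h1, Trivialization.symmL_apply _ hx]
  rfl

/-- The acceleration may be computed in any trivialization of the tangent bundle. -/
lemma acceleration_eq (cov : Conn s t m M) {c : ℝ → M} {τ : ℝ}
    (hc : MDifferentiableAt 𝓘(ℝ, ℝ) 𝓘(ℝ, E s t m) c τ)
    (e : Trivialization (E s t m)
      (π (E s t m) (TangentSpace 𝓘(ℝ, E s t m) : M → Type _))) [MemTrivializationAtlas e]
    (he : c τ ∈ e.baseSet) {ξ : ℝ → E s t m}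
    (hξ : ∀ᶠ σ in 𝓝 τ, velocity c σ = e.symmL ℝ (c σ) (ξ σ)) (hd : DifferentiableAt ℝ ξ τ) :
    acceleration cov c τ = e.symmL ℝ (c τ) (deriv ξ τ) +
      cov (fun y => e.symmL ℝ y (ξ τ)) (c τ) (velocity c τ) := by
  rw [acceleration_eq_symmL]
  set e' := trivializationAt (E s t m) (TangentSpace 𝓘(ℝ, E s t m) : M → Type _) (c τ) with he'
  have hx' : c τ ∈ e'.baseSet := FiberBundle.mem_baseSet_trivializationAt' (c τ)
  -- `A` is the change of coordinates from `e` to `e'`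
  let A : M → E s t m →L[ℝ] E s t m := fun y => e.coordChangeL ℝ e' y
  have hU : e.baseSet ∩ e'.baseSet ∈ 𝓝 (c τ) :=
    (e.open_baseSet.inter e'.open_baseSet).mem_nhds ⟨he, hx'⟩
  have hA : MDifferentiableAt 𝓘(ℝ, E s t m) 𝓘(ℝ, E s t m →L[ℝ] E s t m) A (c τ) :=
    ((contMDiffOn_coordChangeL (n := 1) (IB := 𝓘(ℝ, E s t m)) e e').contMDiffAt
      hU).mdifferentiableAt one_ne_zero
  have hAe : ∀ y ∈ e.baseSet ∩ e'.baseSet, ∀ v, A y v = (e' ⟨y, e.symmL ℝ y v⟩).2 := by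
    intro y hy v
    rw [e.symmL_apply hy.1]
    exact e.coordChangeL_apply e' hy v
  have hAs : ∀ y ∈ e.baseSet ∩ e'.baseSet, ∀ v, e.symmL ℝ y v = e'.symmL ℝ y (A y v) := by
    intro y hy v
    rw [hAe y hy, e'.symmL_apply hy.2, e'.symm_apply_apply_mk hy.2]
  have hcU : ∀ᶠ σ in 𝓝 τ, c σ ∈ e.baseSet ∩ e'.baseSet := hc.continuousAt.eventually hU
  have hAv : ∀ v, MDifferentiableAt 𝓘(ℝ, E s t m) 𝓘(ℝ, E s t m) (fun y => A y v) (c τ) :=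
    fun v => hA.clm_apply mdifferentiableAt_const
  have hAc : DifferentiableAt ℝ (A ∘ c) τ := (MDifferentiableAt.comp τ hA hc).differentiableAt
  have hξ' : (fun σ => (e' (TotalSpace.mk' (E s t m) (E := TangentSpace 𝓘(ℝ, E s t m)) (c σ)
      (velocity (s := s) (t := t) (m := m) c σ))).2) =ᶠ[𝓝 τ] fun σ => (A ∘ c) σ (ξ σ) := by
    filter_upwards [hξ, hcU] with σ h1 h2
    rw [h1]
    exact (hAe _ h2 _).symm
  have hder := hAc.hasDerivAt.clm_apply hd.hasDerivAt
  have hev : deriv (fun σ => (A ∘ c) σ (ξ τ)) τ = deriv (A ∘ c) τ (ξ τ) := by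
    simpa using (hAc.hasDerivAt.clm_apply (hasDerivAt_const τ (ξ τ))).deriv
  have hchain : mvfderiv 𝓘(ℝ, E s t m) (fun y => A y (ξ τ)) (c τ) (velocity c τ) =
      deriv (A ∘ c) τ (ξ τ) := by
    rw [← hev, ← fderiv_apply_one_eq_deriv, ← mfderiv_eq_fderiv]
    have := mfderiv_comp τ (hAv (ξ τ)) hc
    exact (congrArg (fun L => L (1 : ℝ)) this).symm
  have hs := (contMDiffAt_symmL e he (ξ τ)).mdifferentiableAt (by simp)
  have hc1 := cov_congr cov hs (σ' := fun y => e'.symmL ℝ y (A y (ξ τ))) (by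
    filter_upwards [hU] with y hy
    exact (hAs y hy _).symm)
  have hc2 := cov_frame_apply cov.isCovariantDerivativeOnUniv (Set.mem_univ (c τ))
    (ql := fun y => (e'.symmL ℝ y : E s t m →ₗ[ℝ] TM s t m y)) (h := fun y => A y (ξ τ))
    (fun v => (contMDiffAt_symmL e' hx' v).mdifferentiableAt (by simp))
    (hAv (ξ τ)) (velocity c τ)
  change cov (fun y => e'.symmL ℝ y (A y (ξ τ))) (c τ) (velocity c τ) = e'.symmL ℝ _ _ +
    cov (fun y => e'.symmL ℝ y (A (c τ) (ξ τ))) (c τ) (velocity c τ) at hc2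
  have h0 := hξ'.self_of_nhds
  simp only at h0
  rw [hξ'.deriv_eq, hder.deriv, ← hc1, hc2, h0, hAs _ ⟨he, hx'⟩ (deriv ξ τ), hchain, map_add,
    add_comm (e'.symmL ℝ (c τ) (deriv (A ∘ c) τ (ξ τ))), add_assoc]
  rfl

/-- Two connections have accelerations differing by the difference tensor. -/
lemma acceleration_eq_add_difference (cov cov' : Conn s t m M) (c : ℝ → M) (τ : ℝ) :
    acceleration cov' c τ = acceleration cov c τ +
      cov'.difference cov (c τ) (velocity c τ) (velocity c τ) := by
  rw [acceleration_eq_symmL, acceleration_eq_symmL]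
  set e := trivializationAt (E s t m) (TangentSpace 𝓘(ℝ, E s t m) : M → Type _) (c τ) with he
  have hx : c τ ∈ e.baseSet := FiberBundle.mem_baseSet_trivializationAt' (c τ)
  have h1 := cov'.isCovariantDerivativeOnUniv.difference_apply cov.isCovariantDerivativeOnUniv
    (Set.mem_univ (c τ)) ((contMDiffAt_symmL e hx
      (e (TotalSpace.mk' (E s t m) (E := TangentSpace 𝓘(ℝ, E s t m)) (c τ)
      (velocity (s := s) (t := t) (m := m) c τ))).2).mdifferentiableAt (by simp))
  rw [e.symmL_apply hx, e.symm_apply_apply_mk hx] at h1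
  have h2 := congrArg (fun L => L (velocity c τ)) h1
  change cov'.difference cov (c τ) (velocity c τ) (velocity c τ) = _ at h2
  rw [h2, sub_apply, add_assoc, add_sub_cancel]

end curves

section geodesics

open scoped Topology

variable {s t m : ℕ} {M : Type*} [TopologicalSpace M] [ChartedSpace (E s t m) M]
  [IsManifold 𝓘(ℝ, E s t m) ∞ M]

/-- The covariant derivative of a vector field with constant coordinates in a frame depends
linearly on these coordinates. -/
lemma cov_frame_const (cov : Conn s t m M) {x : M} {Fm : Type*} [NormedAddCommGroup Fm]
    [NormedSpace ℝ Fm] [FiniteDimensional ℝ Fm] {ql : ∀ y : M, Fm →ₗ[ℝ] TM s t m y}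
    (hq : ∀ v, MDifferentiableAt 𝓘(ℝ, E s t m) (𝓘(ℝ, E s t m).prod 𝓘(ℝ, E s t m))
      (fun y => TotalSpace.mk' (E s t m) (E := TangentSpace 𝓘(ℝ, E s t m)) y (ql y v)) x) :
    ∃ B : Fm →ₗ[ℝ] TM s t m x →L[ℝ] TM s t m x, ∀ v, B v = cov (fun y => ql y v) x := by
  refine ⟨⟨⟨fun v => cov (fun y => ql y v) x, fun v w => ?_⟩, fun r v => ?_⟩, fun v => rfl⟩
  · rw [← cov.isCovariantDerivativeOnUniv.add (hq v) (hq w)]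
    congr 1
    funext y
    exact map_add _ _ _
  · rw [RingHom.id_apply]
    change _ = r • cov (fun y => ql y v) x
    rw [← cov.isCovariantDerivativeOnUniv.smul_const r (hq v)]
    change cov _ x = _
    congr 1
    funext y
    exact map_smul _ _ _

/-- Christoffel symbols: in a trivialization, `∇` is given by a quadratic expression with smooth
coefficients. -/
lemma exists_christoffel [T2Space M] {cov : Conn s t m M}
    (hcov : cov.ContMDiffCovariantDerivative ∞)
    (e : Trivialization (E s t m)
      (π (E s t m) (TangentSpace 𝓘(ℝ, E s t m) : M → Type _))) [MemTrivializationAtlas e] :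
    ∃ γ : M → E s t m → E s t m,
      ContMDiffOn (𝓘(ℝ, E s t m).prod 𝓘(ℝ, E s t m)) 𝓘(ℝ, E s t m) ∞ (fun z : M × E s t m =>
        γ z.1 z.2) (e.baseSet ×ˢ Set.univ) ∧
      (∀ y (r : ℝ) w, γ y (r • w) = r ^ 2 • γ y w) ∧
      ∀ y ∈ e.baseSet, ∀ w, cov (fun z => e.symmL ℝ z w) y (e.symmL ℝ y w) =
        e.symmL ℝ y (γ y w) := by
  let b := Module.finBasis ℝ (E s t m)
  let Γ : Fin _ → Fin _ → M → E s t m := fun i j y =>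
    (e (TotalSpace.mk' (E s t m) (E := TangentSpace 𝓘(ℝ, E s t m)) y
      (cov (fun z => e.symmL ℝ z (b i)) y (e.symmL ℝ y (b j))))).2
  have hΓ : ∀ i j, ContMDiffOn 𝓘(ℝ, E s t m) 𝓘(ℝ, E s t m) ∞ (Γ i j) e.baseSet := by
    intro i j y hy
    have h1 := contMDiffAt_cov hcov e.open_baseSet hy (σ := fun z => e.symmL ℝ z (b i))
      fun z hz => (contMDiffAt_symmL e hz (b i)).contMDiffWithinAt
    have h2 := ContMDiffAt.clm_bundle_apply h1 (contMDiffAt_symmL e hy (b j))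
    exact ((e.contMDiffAt_section_iff hy).1 h2).contMDiffWithinAt
  refine ⟨fun y w => ∑ i, ∑ j, (b.coord i w * b.coord j w) • Γ i j y, ?_, ?_, ?_⟩
  · refine contMDiffOn_finsetSum fun i _ => contMDiffOn_finsetSum fun j _ =>
      ContMDiffOn.smul (I := 𝓘(ℝ, ℝ)) (I' := 𝓘(ℝ, E s t m))
        (f := fun z : M × E s t m => b.coord i z.2 * b.coord j z.2)
        (g := fun z => Γ i j z.1) ?_ ?_
    · refine ContMDiff.contMDiffOn (ContMDiff.mul ?_ ?_)
      · exact ((ContinuousLinearMap.contMDiff (LinearMap.toContinuousLinearMap (b.coord i)))).comp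
          contMDiff_snd
      · exact ((ContinuousLinearMap.contMDiff (LinearMap.toContinuousLinearMap (b.coord j)))).comp
          contMDiff_snd
    · exact (hΓ i j).comp contMDiff_fst.contMDiffOn fun z hz => hz.1
  · intro y r w
    simp only [map_smul, smul_eq_mul, Finset.smul_sum, smul_smul]
    exact Finset.sum_congr rfl fun i _ => Finset.sum_congr rfl fun j _ => by ring_nf
  · intro y hy w
    obtain ⟨B, hB⟩ := cov_frame_const cov (x := y)
      (ql := fun z => (e.symmL ℝ z : E s t m →ₗ[ℝ] TM s t m z))
      fun v => (contMDiffAt_symmL e hy v).mdifferentiableAt (by simp)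
    have hG : ∀ i j, e.symmL ℝ y (Γ i j y) = B (b i) (e.symmL ℝ y (b j)) := by
      intro i j
      rw [e.symmL_apply hy, e.symm_apply_apply_mk hy, hB]
      rfl
    have h3 : cov (fun z => e.symmL ℝ z w) y (e.symmL ℝ y w) = B w (e.symmL ℝ y w) := by
      rw [hB]
      rfl
    rw [h3]
    conv_lhs => rw [← b.sum_repr w]
    simp only [map_sum, map_smul, hG, sum_apply, smul_apply,
      Finset.smul_sum, smul_smul]
    rw [Finset.sum_comm]
    refine Finset.sum_congr rfl fun i _ => Finset.sum_congr rfl fun j _ => ?_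
    simp [mul_comm]

/-- The second-order equation `u'' = -γ(u, u')`, in coordinates the equation of geodesics, has local
solutions with any given initial condition; they are smooth. -/
lemma exists_geodesic {γ : E s t m × E s t m → E s t m} {O : Set (E s t m × E s t m)}
    (hO : IsOpen O) (hγ : ContDiffOn ℝ ∞ γ O) {z₀ : E s t m × E s t m} (hz₀ : z₀ ∈ O) :
    ∃ (z : ℝ → E s t m × E s t m) (δ : ℝ), 0 < δ ∧ z 0 = z₀ ∧
      ∀ τ ∈ Set.Ioo (-δ) δ, z τ ∈ O ∧ ContDiffAt ℝ ∞ z τ ∧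
        HasDerivAt z ((z τ).2, -γ (z τ)) τ := by
  let f : E s t m × E s t m → E s t m × E s t m := fun z => (z.2, -γ z)
  have hf : ContDiffOn ℝ ∞ f O := contDiff_snd.contDiffOn.prodMk hγ.neg
  obtain ⟨z, hz, r, hr, hd⟩ :=
    ContDiffAt.exists_forall_mem_closedBall_exists_eq_forall_mem_Ioo_hasDerivAt₀
      (((hf.contDiffAt (hO.mem_nhds hz₀))).of_le (by simp) : ContDiffAt ℝ 1 f z₀) 0
  have hc : ContinuousAt z 0 := (hd 0 (by constructor <;> linarith)).continuousAt
  obtain ⟨δ', hδ', hz'⟩ := Metric.eventually_nhds_iff.1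
    (hc.eventually (by rw [hz]; exact hO.mem_nhds hz₀ : O ∈ 𝓝 (z 0)))
  let δ := min (δ' / 2) (r / 2)
  have hδ : 0 < δ := by positivity
  have h1 : δ ≤ δ' / 2 := min_le_left _ _
  have h2 : δ ≤ r / 2 := min_le_right _ _
  have hO' : Set.MapsTo z (Set.Icc (-δ) δ) O := by
    intro τ hτ
    refine hz' ?_
    rw [Real.dist_eq, sub_zero, abs_lt]
    constructor <;> linarith [hτ.1, hτ.2]
  have hD : ∀ τ ∈ Set.Icc (-δ) δ, HasDerivAt z (f (z τ)) τ := fun τ hτ =>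
    hd τ (by constructor <;> linarith [hτ.1, hτ.2])
  have hs : ContDiffOn ℝ ∞ z (Set.Icc (-δ) δ) := by
    refine ODE.contDiffOn_enat_Icc_of_hasDerivWithinAt (f := fun _ => f) (u := O) (n := ⊤) ?_
      (fun τ hτ => (hD τ hτ).hasDerivWithinAt) hO'
    exact hf.comp contDiff_snd.contDiffOn fun p hp => hp.2
  exact ⟨z, δ, hδ, hz, fun τ hτ => ⟨hO' (Set.Ioo_subset_Icc_self hτ),
    hs.contDiffAt (Icc_mem_nhds hτ.1 hτ.2), hD τ (Set.Ioo_subset_Icc_self hτ)⟩⟩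

lemma velocity_eq_symmL {x : M} {u : ℝ → E s t m} {u' : E s t m} {τ : ℝ}
    (hu : HasDerivAt u u' τ) (hτ : u τ ∈ (extChartAt 𝓘(ℝ, E s t m) x).target) :
    MDifferentiableAt 𝓘(ℝ, ℝ) 𝓘(ℝ, E s t m) (fun σ => (extChartAt 𝓘(ℝ, E s t m) x).symm (u σ)) τ ∧
    velocity (fun σ => (extChartAt 𝓘(ℝ, E s t m) x).symm (u σ)) τ =
      (trivializationAt (E s t m) (TangentSpace 𝓘(ℝ, E s t m) : M → Type _) x).symmL ℝ
        ((extChartAt 𝓘(ℝ, E s t m) x).symm (u τ)) u' := by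
  set φ := extChartAt 𝓘(ℝ, E s t m) x with hφ
  have hsrc : φ.symm (u τ) ∈ (chartAt (E s t m) x).source := by
    have := φ.map_target hτ
    rwa [hφ, extChartAt_source] at this
  have hm : MDifferentiableAt 𝓘(ℝ, E s t m) 𝓘(ℝ, E s t m) φ.symm (u τ) :=
    ((contMDiffOn_extChartAt_symm (n := 1) x).contMDiffAt
      ((isOpen_extChartAt_target x).mem_nhds hτ)).mdifferentiableAt one_ne_zero
  have hu' : MDifferentiableAt 𝓘(ℝ, ℝ) 𝓘(ℝ, E s t m) u τ :=
    hu.differentiableAt.mdifferentiableAt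
  refine ⟨MDifferentiableAt.comp τ hm hu', ?_⟩
  have h1 := mfderiv_comp τ hm hu'
  unfold velocity
  rw [TangentBundle.symmL_trivializationAt hsrc, ← hφ, φ.right_inv hτ]
  have h2 : mfderivWithin 𝓘(ℝ, E s t m) 𝓘(ℝ, E s t m) φ.symm (Set.range 𝓘(ℝ, E s t m)) (u τ) =
      mfderiv 𝓘(ℝ, E s t m) 𝓘(ℝ, E s t m) φ.symm (u τ) := by
    rw [ModelWithCorners.range_eq_univ, mfderivWithin_univ]
  rw [h2]
  have h3 : mfderiv 𝓘(ℝ, ℝ) 𝓘(ℝ, E s t m) u τ (1 : ℝ) = u' := by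
    rw [mfderiv_eq_fderiv]
    exact (fderiv_apply_one_eq_deriv).trans hu.deriv
  rw [← h3]
  exact congrArg (fun L => L (1 : ℝ)) h1

lemma one_mem_affinors (P : CliffordianStructure s t m M) (x : M) (r : ℝ) :
    r • ContinuousLinearMap.id ℝ (TM s t m x) ∈ P.affinors x := by
  obtain ⟨U, -, hxU, p, hp⟩ := P.exists_smooth x
  refine ⟨p x, hp.1 x hxU, algebraMap ℝ _ r, fun v => ?_⟩
  rw [algebraMap_smul, map_smul]
  rfl

/-- Every tangent vector is, up to a non-zero factor, the velocity of an `A`-planar curve. Such a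
curve is a local geodesic, reparametrized so as to be defined on the whole line: the acceleration of
a reparametrized geodesic is a multiple of its velocity. The velocity is compared with `X` in the
total space because the base points `c 0` and `x` are only propositionally equal. -/
lemma exists_planar_curve [T2Space M] (P : CliffordianStructure s t m M) {cov : Conn s t m M}
    (hcov : cov.ContMDiffCovariantDerivative ∞) (x : M) (X : TM s t m x) :
    ∃ c : ℝ → M, IsPlanar P cov c ∧ ∃ r : ℝ, r ≠ 0 ∧
      TotalSpace.mk' (E s t m) (E := TangentSpace 𝓘(ℝ, E s t m)) (c 0)
        (velocity (s := s) (t := t) (m := m) c 0) = TotalSpace.mk' (E s t m) x (r • X) := by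
  set φ := extChartAt 𝓘(ℝ, E s t m) x with hφ
  set e := trivializationAt (E s t m) (TangentSpace 𝓘(ℝ, E s t m) : M → Type _) x with he
  have hxe : x ∈ e.baseSet := FiberBundle.mem_baseSet_trivializationAt' x
  have hbase : ∀ u ∈ φ.target, φ.symm u ∈ e.baseSet := by
    intro u hu
    have := φ.map_target hu
    rwa [hφ, extChartAt_source] at this
  obtain ⟨γ, hγ, hγr, hγc⟩ := exists_christoffel hcov e
  have hφs : ContMDiffOn 𝓘(ℝ, E s t m) 𝓘(ℝ, E s t m) ∞ φ.symm φ.target :=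
    contMDiffOn_extChartAt_symm x
  have hγ' : ContDiffOn ℝ ∞ (fun z : E s t m × E s t m => γ (φ.symm z.1) z.2)
      (φ.target ×ˢ Set.univ) := by
    rw [← contMDiffOn_iff_contDiffOn]
    refine hγ.comp (g := fun z : M × E s t m => γ z.1 z.2)
      (f := fun z : E s t m × E s t m => (φ.symm z.1, z.2)) (ContMDiffOn.prodMk ?_ ?_) ?_
    · exact hφs.comp (contDiff_fst.contMDiff.contMDiffOn) fun z hz => hz.1
    · exact contDiff_snd.contMDiff.contMDiffOn
    · exact fun z hz => ⟨hbase _ hz.1, trivial⟩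
  obtain ⟨z, δ, hδ, hz0, hz⟩ := exists_geodesic ((isOpen_extChartAt_target x).prod isOpen_univ)
    hγ' (z₀ := (φ x, e.continuousLinearMapAt ℝ x X)) ⟨mem_extChartAt_target x, trivial⟩
  -- composition with `ψ`, a diffeomorphism of the line onto a subinterval of `(-δ, δ)`, gives a
  -- curve defined on the whole line
  let ψ : ℝ → ℝ := fun τ => δ / 2 * Real.arctan τ
  let ψ' : ℝ → ℝ := fun τ => δ / 2 * (1 / (1 + τ ^ 2))
  have hψ : ∀ τ, HasDerivAt ψ (ψ' τ) τ := fun τ => (Real.hasDerivAt_arctan τ).const_mul _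
  have hψ0 : ∀ τ, ψ' τ ≠ 0 := fun τ => by positivity
  have hψ's : Differentiable ℝ ψ' := by
    intro τ
    refine (DifferentiableAt.div ?_ ?_ (by positivity)).const_mul _ <;> fun_prop
  have hψm : ∀ τ, ψ τ ∈ Set.Ioo (-δ) δ := by
    intro τ
    have h1 := Real.neg_pi_div_two_lt_arctan τ
    have h2 := Real.arctan_lt_pi_div_two τ
    have h3 := Real.pi_lt_four
    constructor
    · change -δ < δ / 2 * Real.arctan τ
      nlinarith
    · change δ / 2 * Real.arctan τ < δ
      nlinarith
  have hψs : ContDiff ℝ ∞ ψ := contDiff_const.mul Real.contDiff_arctan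
  let u : ℝ → E s t m := fun τ => (z (ψ τ)).1
  let w : ℝ → E s t m := fun τ => (z (ψ τ)).2
  let c : ℝ → M := fun τ => φ.symm (u τ)
  have hO : ∀ τ, u τ ∈ φ.target := fun τ => (hz _ (hψm τ)).1.1
  have hzd : ∀ τ, HasDerivAt (fun σ => z (ψ σ)) (ψ' τ • (w τ, -γ (c τ) (w τ))) τ := fun τ =>
    HasDerivAt.scomp τ (hz _ (hψm τ)).2.2 (hψ τ)
  have hu : ∀ τ, HasDerivAt u (ψ' τ • w τ) τ := fun τ => (hzd τ).fst
  have hw : ∀ τ, HasDerivAt w (ψ' τ • -γ (c τ) (w τ)) τ := fun τ => (hzd τ).snd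
  have hv : ∀ τ, velocity c τ = e.symmL ℝ (c τ) (ψ' τ • w τ) := fun τ =>
    (velocity_eq_symmL (hu τ) (hO τ)).2
  have hc0 : c 0 = x := by
    simp only [c, u, ψ, Real.arctan_zero, mul_zero, hz0]
    exact extChartAt_to_inv x
  refine ⟨c, ⟨?_, fun τ => ?_⟩, ψ' 0, hψ0 0, ?_⟩
  · intro τ
    have h1 : ContDiffAt ℝ ∞ u τ := by
      exact contDiffAt_fst.comp τ ((hz _ (hψm τ)).2.1.comp τ hψs.contDiffAt)
    exact (hφs.contMDiffAt ((isOpen_extChartAt_target x).mem_nhds (hO τ))).comp τ h1.contMDiffAt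
  · refine ⟨(deriv ψ' τ / ψ' τ) • ContinuousLinearMap.id ℝ _, one_mem_affinors P _ _, ?_⟩
    have hξ := (hψ's τ).hasDerivAt.smul (hw τ)
    rw [acceleration_eq cov (velocity_eq_symmL (hu τ) (hO τ)).1 e (hbase _ (hO τ))
      (ξ := fun σ => ψ' σ • w σ) (Filter.Eventually.of_forall hv) hξ.differentiableAt,
      hv, hγc _ (hbase _ (hO τ)), hγr]
    have h2 : deriv (fun σ => ψ' σ • w σ) τ = _ := hξ.deriv
    rw [h2, ← map_add, smul_apply, ContinuousLinearMap.id_apply, ← map_smul]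
    congr 1
    rw [smul_smul (_ / _), div_mul_cancel₀ _ (hψ0 τ), smul_smul, smul_neg, pow_two]
    change -(_ • γ (c τ) (w τ)) + _ + _ • γ (c τ) (w τ) = _
    abel
  · have h3 : ∀ y, c 0 = y → TotalSpace.mk' (E s t m) (E := TangentSpace 𝓘(ℝ, E s t m)) (c 0)
        (velocity (s := s) (t := t) (m := m) c 0) =
        TotalSpace.mk' (E s t m) y (e.symmL ℝ y (ψ' 0 • w 0)) := by
      rintro y rfl
      rw [hv]
    rw [h3 x hc0]
    have h4 : w 0 = e.continuousLinearMapAt ℝ x X := by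
      simp only [w, ψ, Real.arctan_zero, mul_zero, hz0]
    rw [h4, map_smul, e.symmL_continuousLinearMapAt hxe]

end geodesics

/-! ### Affinors, tensors in frames, and connections preserving the structure -/

section frames

open scoped Topology

variable {s t m : ℕ} {M : Type*} [TopologicalSpace M] [ChartedSpace (E s t m) M]

/-- The expression in a frame `p` of a bilinear map on the tangent space. -/
def pullTensor {x : M} (p : V s t m ≃ₗ[ℝ] TM s t m x) :
    (TM s t m x →L[ℝ] TM s t m x →L[ℝ] TM s t m x) →ₗ[ℝ] Bil s t m where
  toFun S := LinearMap.mk₂ ℝ (fun v w => p.symm (S (p v) (p w)))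
    (fun v v' w => by simp only [map_add, add_apply])
    (fun r v w => by simp only [map_smul, smul_apply])
    (fun v w w' => by simp only [map_add])
    (fun r v w => by simp only [map_smul])
  map_add' S T := LinearMap.ext₂ fun v w => map_add p.symm _ _
  map_smul' r S := LinearMap.ext₂ fun v w => map_smul p.symm _ _

@[simp]
lemma pullTensor_apply {x : M} (p : V s t m ≃ₗ[ℝ] TM s t m x)
    (S : TM s t m x →L[ℝ] TM s t m x →L[ℝ] TM s t m x) (v w : V s t m) :
    pullTensor p S v w = p.symm (S (p v) (p w)) := rfl

/-- The bilinear map on the tangent space with a given expression in the frame `p`. -/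
def pushTensor {x : M} (p : V s t m ≃ₗ[ℝ] TM s t m x) :
    Bil s t m →ₗ[ℝ] TM s t m x →L[ℝ] TM s t m x →L[ℝ] TM s t m x where
  toFun φ := LinearMap.toContinuousLinearMap
    { toFun := fun X => LinearMap.toContinuousLinearMap
        (p.toLinearMap ∘ₗ φ (p.symm X) ∘ₗ p.symm.toLinearMap)
      map_add' := fun X Y => by ext; simp
      map_smul' := fun r X => by ext; simp }
  map_add' φ φ' := by ext; simp
  map_smul' r φ := by ext; simp

@[simp]
lemma pushTensor_apply {x : M} (p : V s t m ≃ₗ[ℝ] TM s t m x) (φ : Bil s t m)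
    (X Y : TM s t m x) : pushTensor p φ X Y = p (φ (p.symm X) (p.symm Y)) := rfl

lemma pushTensor_pullTensor {x : M} (p : V s t m ≃ₗ[ℝ] TM s t m x)
    (S : TM s t m x →L[ℝ] TM s t m x →L[ℝ] TM s t m x) : pushTensor p (pullTensor p S) = S := by
  ext; simp

lemma pullTensor_pushTensor {x : M} (p : V s t m ≃ₗ[ℝ] TM s t m x) (φ : Bil s t m) :
    pullTensor p (pushTensor p φ) = φ := by
  ext; simp

/-- The affinor which is multiplication by `a` in the frame `p`. -/
def affinor {x : M} (p : V s t m ≃ₗ[ℝ] TM s t m x) (a : Cl s t) : TM s t m x →L[ℝ] TM s t m x :=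
  LinearMap.toContinuousLinearMap
    (p.toLinearMap ∘ₗ Algebra.lsmul ℝ ℝ (V s t m) a ∘ₗ p.symm.toLinearMap)

lemma affinor_apply {x : M} (p : V s t m ≃ₗ[ℝ] TM s t m x) (a : Cl s t) (v : V s t m) :
    affinor p a (p v) = p (a • v) := by
  simp [affinor]

variable [IsManifold 𝓘(ℝ, E s t m) ∞ M] (P : CliffordianStructure s t m M)

namespace CliffordianStructure

lemma exists_mem_frames (x : M) : ∃ p, p ∈ P.frames x := by
  obtain ⟨U, -, hxU, p, hp⟩ := P.exists_smooth x
  exact ⟨p x, hp.1 x hxU⟩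

variable {P}

lemma mem_affinors_iff {x : M} {p : V s t m ≃ₗ[ℝ] TM s t m x} (hp : p ∈ P.frames x)
    {f : TM s t m x →L[ℝ] TM s t m x} :
    f ∈ P.affinors x ↔ ∃ a : Cl s t, ∀ v, f (p v) = p (a • v) := by
  refine ⟨fun ⟨p', hp', a, ha⟩ => ?_, fun ⟨a, ha⟩ => ⟨p, hp, a, ha⟩⟩
  obtain ⟨g, hg, rfl⟩ := (P.mem_iff x p hp p').1 hp'
  obtain ⟨a', ha'⟩ := exists_conj_of_mem_G hg a
  refine ⟨a', fun v => ?_⟩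
  have := ha (g.symm v)
  rw [LinearEquiv.trans_apply, LinearEquiv.trans_apply, ha', LinearEquiv.apply_symm_apply] at this
  exact this

lemma affinor_mem {x : M} {p : V s t m ≃ₗ[ℝ] TM s t m x} (hp : p ∈ P.frames x) (a : Cl s t) :
    affinor p a ∈ P.affinors x := ⟨p, hp, a, affinor_apply p a⟩

lemma sum_smul_mem_affinors {x : M} {ι : Type*} (T : Finset ι) (r : ι → ℝ)
    {f : ι → TM s t m x →L[ℝ] TM s t m x} (hf : ∀ i ∈ T, f i ∈ P.affinors x) :
    ∑ i ∈ T, r i • f i ∈ P.affinors x := by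
  obtain ⟨p, hp⟩ := P.exists_mem_frames x
  have h : ∀ i, ∃ a : Cl s t, i ∈ T → ∀ v, f i (p v) = p (a • v) := by
    intro i
    by_cases hi : i ∈ T
    · obtain ⟨a, ha⟩ := (mem_affinors_iff hp).1 (hf i hi)
      exact ⟨a, fun _ => ha⟩
    · exact ⟨0, fun h => absurd h hi⟩
  choose a ha using h
  refine (mem_affinors_iff hp).2 ⟨∑ i ∈ T, r i • a i, fun v => ?_⟩
  rw [sum_apply, Finset.sum_smul, map_sum]
  refine Finset.sum_congr rfl fun i hi => ?_
  rw [smul_apply, ha i hi, smul_assoc, LinearEquiv.map_smul p (r i)]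

lemma add_mem_affinors {x : M} {f g : TM s t m x →L[ℝ] TM s t m x} (hf : f ∈ P.affinors x)
    (hg : g ∈ P.affinors x) : f + g ∈ P.affinors x := by
  obtain ⟨p, hp⟩ := P.exists_mem_frames x
  obtain ⟨a, ha⟩ := (mem_affinors_iff hp).1 hf
  obtain ⟨b, hb⟩ := (mem_affinors_iff hp).1 hg
  refine (mem_affinors_iff hp).2 ⟨a + b, fun v => ?_⟩
  rw [add_apply, ha, hb, add_smul, map_add]

lemma frames_trans {x : M} {p p' : V s t m ≃ₗ[ℝ] TM s t m x} (hp : p ∈ P.frames x)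
    (hp' : p' ∈ P.frames x) : ∃ g ∈ G s t m, p' = g.trans p := (P.mem_iff x p hp p').1 hp'

end CliffordianStructure

open CliffordianStructure

/-- A field of endomorphisms which near `x` is a smooth section of `A`. -/
def IsAffinorFieldNear (f : ∀ y : M, TM s t m y →L[ℝ] TM s t m y) (x : M) : Prop :=
  ∀ᶠ y in 𝓝 x, f y ∈ P.affinors y ∧
    ContMDiffAt 𝓘(ℝ, E s t m) (𝓘(ℝ, E s t m).prod 𝓘(ℝ, E s t m →L[ℝ] E s t m)) ∞
      (fun y => TotalSpace.mk' (E s t m →L[ℝ] E s t m)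
        (E := fun z : M => TangentSpace 𝓘(ℝ, E s t m) z →L[ℝ] TangentSpace 𝓘(ℝ, E s t m) z)
        y (f y)) y

/-- `∇_X` maps smooth affinor fields to affinors, at the point `x`. -/
def PreservesAffinorsAt (cov : Conn s t m M) (x : M) : Prop :=
  ∀ f : (∀ y : M, TM s t m y →L[ℝ] TM s t m y), IsAffinorFieldNear P f x →
    ∀ X : TM s t m x, ∃ f' ∈ P.affinors x,
      ∀ Y : (∀ y : M, TM s t m y),
        MDifferentiableAt 𝓘(ℝ, E s t m) (𝓘(ℝ, E s t m).prod 𝓘(ℝ, E s t m))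
          (fun y => TotalSpace.mk' (E s t m) (E := TangentSpace 𝓘(ℝ, E s t m)) y (Y y)) x →
        cov (fun y => f y (Y y)) x X = f x (cov Y x X) + f' (Y x)

/-- The torsion at `x` has values in `𝒟`. -/
def TorsionMemAt (D : Submodule ℝ (Bil s t m)) (cov : Conn s t m M) (x : M) : Prop :=
  ∀ p ∈ P.frames x, pullTensor p (cov.torsion x) ∈ D

variable {P}

lemma preservesAffinors_iff {cov : Conn s t m M} :
    PreservesAffinors P cov ↔ ∀ x, PreservesAffinorsAt P cov x := by
  constructor
  · intro h x f hf X
    obtain ⟨U, hU, hUo, hxU⟩ := eventually_nhds_iff.1 hf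
    exact h U hUo f (fun y hy => (hU y hy).1) (fun y hy => (hU y hy).2.contMDiffWithinAt) x hxU X
  · intro h U hU f hf hfs x hx X
    refine h x f ?_ X
    filter_upwards [hU.mem_nhds hx] with y hy
    exact ⟨hf y hy, hfs.contMDiffAt (hU.mem_nhds hy)⟩

lemma torsionMemAt_iff {D : Submodule ℝ (Bil s t m)} (hD : IsInvariantComplement s t m D)
    {cov : Conn s t m M} {x : M} {p : V s t m ≃ₗ[ℝ] TM s t m x} (hp : p ∈ P.frames x) :
    TorsionMemAt P D cov x ↔ pullTensor p (cov.torsion x) ∈ D := by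
  refine ⟨fun h => h p hp, fun h p' hp' => ?_⟩
  obtain ⟨g, hg, rfl⟩ := frames_trans hp hp'
  have h1 := hD.invariant g⁻¹ ((G s t m).inv_mem hg) _ h
  convert h1 using 1
  ext v w
  simp [LinearEquiv.arrowCongr_apply]
  rfl

lemma exists_torsion_iff {D : Submodule ℝ (Bil s t m)} {cov : Conn s t m M} :
    (∀ x : M, ∀ p ∈ P.frames x, ∃ T ∈ D, ∀ v w : V s t m,
      cov.torsion x (p v) (p w) = p (T v w)) ↔ ∀ x, TorsionMemAt P D cov x := by
  refine forall_congr' fun x => forall₂_congr fun p hp => ⟨fun ⟨T, hT, h⟩ => ?_, fun h => ?_⟩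
  · convert hT
    ext v w
    simp [h]
  · exact ⟨_, h, fun v w => by simp⟩

variable {cov : Conn s t m M}

/-- A connection preserving `A` is a connection on `P`. -/
lemma PreservesAffinors.isGConnection (h : PreservesAffinors P cov) : IsGConnection P cov := by
  intro U hU p hp x hx X
  let κ : E s t m ≃ₗ[ℝ] V s t m := (p x).symm
  have hq : ∀ y ∈ U, ∀ v : E s t m, ContMDiffAt 𝓘(ℝ, E s t m)
      (𝓘(ℝ, E s t m).prod 𝓘(ℝ, E s t m)) ∞
      (fun y => TotalSpace.mk' (E s t m) (E := TangentSpace 𝓘(ℝ, E s t m)) y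
        (κ.trans (p y) v)) y :=
    fun y hy v => (hp.2 (κ v)).contMDiffAt (hU.mem_nhds hy)
  obtain ⟨B, hB⟩ := cov_frame_const cov (x := x) (ql := fun y => (κ.trans (p y)).toLinearMap)
    fun v => (hq x hx v).mdifferentiableAt (by simp)
  have hBV : ∀ v, B (κ.symm v) = cov (fun y => p y v) x := by
    intro v
    rw [hB]
    simp
  let B' : V s t m →ₗ[ℝ] V s t m :=
    { toFun := fun v => (p x).symm (B (κ.symm v) X)
      map_add' := fun v w => by simp only [map_add, add_apply]
      map_smul' := fun r v => by simp only [map_smul, smul_apply, RingHom.id_apply] }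
  have hB' : ∀ v, cov (fun y => p y v) x X = p x (B' v) := by
    intro v
    rw [← hBV]
    exact ((p x).apply_symm_apply _).symm
  refine ⟨B', mem_lieAlg_iff.2 fun a => ?_, hB'⟩
  obtain ⟨f', hf', h'⟩ := h U hU (fun y => affinor (p y) a) (fun y hy => affinor_mem (hp.1 y hy) a)
    (fun y hy => (contMDiffAt_hom_of_frame (q := fun z => κ.trans (p z)) (hq y hy) (fun v => by
        simp only [LinearEquiv.trans_apply, affinor_apply]
        exact (hp.2 (a • κ v)).contMDiffAt (hU.mem_nhds hy))).contMDiffWithinAt) x hx X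
  obtain ⟨a', ha'⟩ := (mem_affinors_iff (hp.1 x hx)).1 hf'
  refine ⟨a', fun v => (p x).injective ?_⟩
  have h2 := h' (fun y => p y v)
    (((hp.2 v).contMDiffAt (hU.mem_nhds hx)).mdifferentiableAt (by simp))
  simp only [affinor_apply] at h2
  rw [hB', hB', affinor_apply, ha'] at h2
  rw [h2, map_add]

/-- A tensor `A` which in a frame has values in `𝔤 ⊗ 𝕍*` can be added to a connection preserving the
affinors: the endomorphisms `Y ↦ A(Y, X)` normalize the affinors. -/
lemma PreservesAffinorsAt.addOneForm {x : M} (h : PreservesAffinorsAt P cov x)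
    {A : TensorField s t m M} {p : V s t m ≃ₗ[ℝ] TM s t m x} (hp : p ∈ P.frames x)
    (hAp : (pullTensor p (A x)).flip ∈ homLieAlg s t m) :
    PreservesAffinorsAt P (cov.addOneForm A) x := by
  intro f hf X
  obtain ⟨f', hf', h'⟩ := h f hf X
  obtain ⟨a, ha⟩ := (mem_affinors_iff hp).1 hf.self_of_nhds.1
  obtain ⟨a', ha'⟩ := mem_lieAlg_iff.1 (hAp (p.symm X)) a
  refine ⟨f' + affinor p a', add_mem_affinors hf' (affinor_mem hp a'), fun Y hY => ?_⟩
  have h1 := ha' (p.symm (Y x))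
  have h2 : A x (f x (Y x)) X = f x (A x (Y x) X) + affinor p a' (Y x) := by
    have h3 := congrArg p h1
    obtain ⟨v, hv⟩ := p.surjective (Y x)
    rw [← hv, ha, affinor_apply, ← p.apply_symm_apply (A x (p v) X), ha]
    simpa [← hv] using h3
  change cov (fun y => f y (Y y)) x X + A x (f x (Y x)) X =
    f x (cov Y x X + A x (Y x) X) + (f' (Y x) + affinor p a' (Y x))
  rw [h' Y hY, h2, map_add]
  abel

lemma torsion_addOneForm (A : TensorField s t m M) (x : M) (X Y : TM s t m x) :
    (cov.addOneForm A).torsion x X Y = cov.torsion x X Y + (A x Y X - A x X Y) := by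
  rw [CovariantDerivative.torsion_apply_eq_extend, CovariantDerivative.torsion_apply_eq_extend]
  change (cov _ x _ + A x _ _) - (cov _ x _ + A x _ _) - _ = _
  simp only [FiberBundle.extend_apply_self]
  abel

end frames

/-! ### Flat connections of local frames -/

section flat

open scoped Topology

variable {s t m : ℕ} {M : Type*} [TopologicalSpace M] [ChartedSpace (E s t m) M]

section calculus

variable {F₁ F₂ F₃ : Type*} [NormedAddCommGroup F₁] [NormedSpace ℝ F₁] [NormedAddCommGroup F₂]
  [NormedSpace ℝ F₂] [NormedAddCommGroup F₃] [NormedSpace ℝ F₃]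

lemma mvfderiv_clm_comp (L : F₁ →L[ℝ] F₂) {h : M → F₁} {x : M}
    (hh : MDifferentiableAt 𝓘(ℝ, E s t m) 𝓘(ℝ, F₁) h x) (X : TM s t m x) :
    mvfderiv 𝓘(ℝ, E s t m) (fun z => L (h z)) x X = L (mvfderiv 𝓘(ℝ, E s t m) h x X) := by
  have h1 := mfderiv_comp_apply (I' := 𝓘(ℝ, F₁)) (I'' := 𝓘(ℝ, F₂)) (g := L) x
    L.differentiableAt.mdifferentiableAt hh X
  rw [mfderiv_eq_fderiv, ContinuousLinearMap.fderiv] at h1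
  exact h1

lemma mvfderiv_bilin (β : F₁ →L[ℝ] F₂ →L[ℝ] F₃) {h : M → F₁} {η : M → F₂} {x : M}
    (hh : MDifferentiableAt 𝓘(ℝ, E s t m) 𝓘(ℝ, F₁) h x)
    (hη : MDifferentiableAt 𝓘(ℝ, E s t m) 𝓘(ℝ, F₂) η x) (X : TM s t m x) :
    mvfderiv 𝓘(ℝ, E s t m) (fun z => β (h z) (η z)) x X =
      β (mvfderiv 𝓘(ℝ, E s t m) h x X) (η x) + β (h x) (mvfderiv 𝓘(ℝ, E s t m) η x X) := by
  have hg := hh.prodMk_space hη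
  have h1 := mvfderiv_clm_comp (ContinuousLinearMap.fst ℝ F₁ F₂) hg X
  have h2 := mvfderiv_clm_comp (ContinuousLinearMap.snd ℝ F₁ F₂) hg X
  have hβ := β.isBoundedBilinearMap.hasFDerivAt (h x, η x)
  have h3 := mfderiv_comp_apply (I' := 𝓘(ℝ, F₁ × F₂)) (I'' := 𝓘(ℝ, F₃))
    (g := fun u : F₁ × F₂ => β u.1 u.2) x (f := fun z => (h z, η z))
    hβ.differentiableAt.mdifferentiableAt hg X
  change mvfderiv _ h x X = _ at h1
  change mvfderiv _ η x X = _ at h2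
  rw [h1, h2]
  rw [mfderiv_eq_fderiv, hβ.fderiv] at h3
  exact h3.trans (add_comm _ _)

lemma contMDiffAt_linear_comp [FiniteDimensional ℝ F₁] {h : M → F₁} {x : M} {n : ℕ∞ω}
    (hh : ContMDiffAt 𝓘(ℝ, E s t m) 𝓘(ℝ, F₁) n h x) (L : F₁ →ₗ[ℝ] F₂) :
    ContMDiffAt 𝓘(ℝ, E s t m) 𝓘(ℝ, F₂) n (fun z => L (h z)) x :=
  ((ContinuousLinearMap.contMDiff (LinearMap.toContinuousLinearMap L)).contMDiffAt).comp x hh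

lemma exists_linear_factor {W : Type*} [AddCommMonoid W] [Module ℝ W] {C : W →ₗ[ℝ] F₁}
    (hC : Function.Injective C) (Λ : W →ₗ[ℝ] F₂) : ∃ r : F₁ →ₗ[ℝ] F₂, ∀ w, Λ w = r (C w) := by
  let : AddCommGroup W := Module.addCommMonoidToAddCommGroup ℝ
  obtain ⟨r, hr⟩ := LinearMap.exists_leftInverse_of_injective C (LinearMap.ker_eq_bot.2 hC)
  exact ⟨Λ ∘ₗ r, fun w => (congrArg Λ (LinearMap.congr_fun hr w)).symm⟩

/-- A linear function of a bilinear map depending on a point is smooth if the values of the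
bilinear map are. -/
lemma contMDiffAt_linear_bil (κ : E s t m ≃ₗ[ℝ] V s t m) {T : M → Bil s t m} {x : M} {n : ℕ∞ω}
    (hT : ∀ v w, ContMDiffAt 𝓘(ℝ, E s t m) 𝓘(ℝ, E s t m) n (fun y => κ.symm (T y v w)) x)
    (Λ : Bil s t m →ₗ[ℝ] F₁) :
    ContMDiffAt 𝓘(ℝ, E s t m) 𝓘(ℝ, F₁) n (fun y => Λ (T y)) x := by
  let b := Module.finBasis ℝ (V s t m)
  let C : Bil s t m →ₗ[ℝ] (Fin (Module.finrank ℝ (V s t m)) × Fin (Module.finrank ℝ (V s t m))) →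
      E s t m :=
    { toFun := fun T ij => κ.symm (T (b ij.1) (b ij.2))
      map_add' := fun T T' => by ext1; simp
      map_smul' := fun r T => by ext1; simp }
  have hC : Function.Injective C := by
    refine fun T T' hT => b.ext fun i => b.ext fun j => κ.symm.injective ?_
    exact congrFun hT (i, j)
  obtain ⟨r, h1⟩ := exists_linear_factor hC Λ
  simp only [h1]
  refine contMDiffAt_linear_comp ?_ _
  rw [contMDiffAt_pi_space]
  exact fun ij => hT _ _

variable [IsManifold 𝓘(ℝ, E s t m) ∞ M]

lemma contMDiffAt_mvfderiv_apply {η : M → F₁} {U : Set M} (hU : IsOpen U) {x : M} (hx : x ∈ U)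
    (hη : ContMDiffOn 𝓘(ℝ, E s t m) 𝓘(ℝ, F₁) ∞ η U) {X : ∀ y : M, TM s t m y}
    (hX : ContMDiffAt 𝓘(ℝ, E s t m) (𝓘(ℝ, E s t m).prod 𝓘(ℝ, E s t m)) ∞
      (fun y => TotalSpace.mk' (E s t m) (E := TangentSpace 𝓘(ℝ, E s t m)) y (X y)) x) :
    ContMDiffAt 𝓘(ℝ, E s t m) 𝓘(ℝ, F₁) ∞ (fun y => mvfderiv 𝓘(ℝ, E s t m) η y (X y)) x := by
  have h1 := hη.contMDiffOn_tangentMapWithin (m := ∞) (by simp) hU.uniqueMDiffOn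
  have h2 : ContMDiffAt 𝓘(ℝ, E s t m).tangent 𝓘(ℝ, F₁).tangent ∞
      (tangentMapWithin 𝓘(ℝ, E s t m) 𝓘(ℝ, F₁) η U) (TotalSpace.mk' (E s t m) x (X x)) := by
    refine h1.contMDiffAt ?_
    exact (hU.preimage (FiberBundle.continuous_proj (E s t m)
      (TangentSpace 𝓘(ℝ, E s t m) : M → Type _))).mem_nhds hx
  have h3 := (contMDiff_snd_tangentBundle_modelSpace (n := ∞) F₁ 𝓘(ℝ, F₁)).contMDiffAt.comp x
    (ContMDiffAt.comp x (I' := 𝓘(ℝ, E s t m).tangent) h2 hX)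
  refine h3.congr_of_eventuallyEq ?_
  filter_upwards [hU.mem_nhds hx] with y hy
  change mfderiv 𝓘(ℝ, E s t m) 𝓘(ℝ, F₁) η y (X y) =
    mfderivWithin 𝓘(ℝ, E s t m) 𝓘(ℝ, F₁) η U y (X y)
  rw [mfderivWithin_of_isOpen hU hy]

end calculus

variable [IsManifold 𝓘(ℝ, E s t m) ∞ M]

/-- A family `Q y` of frames, smooth near `y`, defines a (not necessarily smooth) connection, equal
at `y` to the flat connection of `Q y`. -/
def flatConn (Q : ∀ _ z : M, E s t m ≃ₗ[ℝ] TM s t m z)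
    (hQ : ∀ y v, ContMDiffAt 𝓘(ℝ, E s t m) (𝓘(ℝ, E s t m).prod 𝓘(ℝ, E s t m)) 1
      (fun z => TotalSpace.mk' (E s t m) (E := TangentSpace 𝓘(ℝ, E s t m)) z (Q y z v)) y) :
    Conn s t m M where
  toFun σ y := LinearMap.toContinuousLinearMap ((Q y y).toLinearMap ∘ₗ
    (mvfderiv 𝓘(ℝ, E s t m) (fun z => (Q y z).symm (σ z)) y).toLinearMap)
  isCovariantDerivativeOnUniv :=
    { add := by
        intro σ σ' y hσ hσ' _
        ext X
        have h1 : (fun z => (Q y z).symm ((σ + σ') z)) =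
            (fun z => (Q y z).symm (σ z)) + fun z => (Q y z).symm (σ' z) := by
          funext z
          exact map_add (Q y z).symm _ _
        simp only [LinearMap.coe_toContinuousLinearMap', LinearMap.comp_apply, h1, add_apply]
        rw [mvfderiv_add (mdifferentiableAt_coord (hQ y) hσ) (mdifferentiableAt_coord (hQ y) hσ')]
        exact map_add (Q y y) _ _
      leibniz := by
        intro σ g y hσ hg _
        ext X
        have h1 : (fun z => (Q y z).symm ((g • σ) z)) = g • fun z => (Q y z).symm (σ z) := by
          funext z
          exact map_smul (Q y z).symm _ _
        simp only [LinearMap.coe_toContinuousLinearMap', LinearMap.comp_apply, h1, add_apply]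
        rw [mvfderiv_smul hg (mdifferentiableAt_coord (hQ y) hσ)]
        change Q y y (g y • _ + mvfderiv 𝓘(ℝ, E s t m) g y X • (Q y y).symm (σ y)) =
          g y • Q y y _ + mvfderiv 𝓘(ℝ, E s t m) g y X • σ y
        rw [map_add, map_smul, map_smul, LinearEquiv.apply_symm_apply] }

lemma flatConn_apply {Q : ∀ _ z : M, E s t m ≃ₗ[ℝ] TM s t m z}
    (hQ : ∀ y v, ContMDiffAt 𝓘(ℝ, E s t m) (𝓘(ℝ, E s t m).prod 𝓘(ℝ, E s t m)) 1
      (fun z => TotalSpace.mk' (E s t m) (E := TangentSpace 𝓘(ℝ, E s t m)) z (Q y z v)) y)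
    (σ : ∀ y : M, TM s t m y) (y : M) (X : TM s t m y) :
    flatConn Q hQ σ y X = Q y y (mvfderiv 𝓘(ℝ, E s t m) (fun z => (Q y z).symm (σ z)) y X) := rfl

end flat

/-! ### Local and global existence of `𝒟`-connections -/

section existence

open scoped Topology
open CliffordianStructure

variable {s t m : ℕ} {M : Type*} [TopologicalSpace M] [ChartedSpace (E s t m) M]
  [IsManifold 𝓘(ℝ, E s t m) ∞ M] {P : CliffordianStructure s t m M}

/-- The field of bilinear maps with smooth expression `T` in a smooth frame, applied to a smooth
vector field, is a smooth field of endomorphisms. -/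
lemma contMDiffAt_pushTensor {κ : E s t m ≃ₗ[ℝ] V s t m} {x : M}
    {p : ∀ y : M, V s t m ≃ₗ[ℝ] TM s t m y}
    (hp : ∀ v, ContMDiffAt 𝓘(ℝ, E s t m) (𝓘(ℝ, E s t m).prod 𝓘(ℝ, E s t m)) ∞
      (fun y => TotalSpace.mk' (E s t m) (E := TangentSpace 𝓘(ℝ, E s t m)) y (p y v)) x)
    {T : M → Bil s t m}
    (hT : ∀ v w, ContMDiffAt 𝓘(ℝ, E s t m) 𝓘(ℝ, E s t m) ∞ (fun y => κ.symm (T y v w)) x)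
    {σ : ∀ y : M, TM s t m y}
    (hσ : ContMDiffAt 𝓘(ℝ, E s t m) (𝓘(ℝ, E s t m).prod 𝓘(ℝ, E s t m)) ∞
      (fun y => TotalSpace.mk' (E s t m) (E := TangentSpace 𝓘(ℝ, E s t m)) y (σ y)) x) :
    ContMDiffAt 𝓘(ℝ, E s t m) (𝓘(ℝ, E s t m).prod 𝓘(ℝ, E s t m →L[ℝ] E s t m)) ∞
      (fun y => TotalSpace.mk' (E s t m →L[ℝ] E s t m)
        (E := fun z : M => TangentSpace 𝓘(ℝ, E s t m) z →L[ℝ] TangentSpace 𝓘(ℝ, E s t m) z)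
        y (pushTensor (p y) (T y) (σ y))) x := by
  have hq : ∀ v, ContMDiffAt 𝓘(ℝ, E s t m) (𝓘(ℝ, E s t m).prod 𝓘(ℝ, E s t m)) ∞
      (fun y => TotalSpace.mk' (E s t m) (E := TangentSpace 𝓘(ℝ, E s t m)) y
        (κ.trans (p y) v)) x := fun v => hp (κ v)
  refine contMDiffAt_hom_of_frame (q := fun y => κ.trans (p y)) hq fun u => ?_
  have h1 := contMDiffAt_frame_apply
    (ql := fun y => (p y).toLinearMap ∘ₗ (T y).flip (κ u) ∘ₗ κ.toLinearMap)
    (fun w => by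
      have h2 := contMDiffAt_frame_apply (ql := fun y => (κ.trans (p y)).toLinearMap) hq
        (hT (κ w) (κ u))
      simpa using h2) (contMDiffAt_coord hq hσ)
  simpa using h1

/-- The flat connection of a frame in `P` preserves the affinors: their matrices are
multiplications by elements of `𝒪`, and so are the derivatives of these matrices. -/
lemma preservesAffinorsAt_of_flat {cov : Conn s t m M} {U : Set M} (hU : IsOpen U)
    {p : ∀ y : M, V s t m ≃ₗ[ℝ] TM s t m y} (hp : IsSmoothFrameOn P.frames U p)
    (κ : E s t m ≃ₗ[ℝ] V s t m) {y : M} (hy : y ∈ U)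
    (hcov : ∀ (σ : ∀ z : M, TM s t m z) (X : TM s t m y), cov σ y X = (κ.trans (p y))
      (mvfderiv 𝓘(ℝ, E s t m) (fun z => (κ.trans (p z)).symm (σ z)) y X)) :
    PreservesAffinorsAt P cov y := by
  intro f hf X
  have hps : ∀ v, ContMDiffAt 𝓘(ℝ, E s t m) (𝓘(ℝ, E s t m).prod 𝓘(ℝ, E s t m)) ∞
      (fun z => TotalSpace.mk' (E s t m) (E := TangentSpace 𝓘(ℝ, E s t m)) z (p z v)) y :=
    fun v => (hp.2 v).contMDiffAt (hU.mem_nhds hy)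
  have hq : ∀ v, ContMDiffAt 𝓘(ℝ, E s t m) (𝓘(ℝ, E s t m).prod 𝓘(ℝ, E s t m)) ∞
      (fun z => TotalSpace.mk' (E s t m) (E := TangentSpace 𝓘(ℝ, E s t m)) z
        (κ.trans (p z) v)) y := fun v => hps (κ v)
  -- an element of `𝒪` is recovered from its action on the vector `1`
  obtain ⟨l, hl⟩ : ∃ l : V s t m →ₗ[ℝ] Cl s t, ∀ (a : Cl s t) (v : V s t m),
      l (a • (1 : V s t m)) • v = a • v := by
    rcases Nat.eq_zero_or_pos m with rfl | hm
    · exact ⟨0, fun a v => Subsingleton.elim _ _⟩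
    · refine ⟨LinearMap.proj ⟨0, hm⟩, fun a v => ?_⟩
      rw [LinearMap.proj_apply, Pi.smul_apply, Pi.one_apply, smul_eq_mul, mul_one]
  let h : M → E s t m := fun z => (κ.trans (p z)).symm (f z (p z 1))
  have hh : ContMDiffAt 𝓘(ℝ, E s t m) 𝓘(ℝ, E s t m) ∞ h y :=
    contMDiffAt_coord hq (hf.self_of_nhds.2.clm_bundle_apply (hps 1))
  have hfh : ∀ᶠ z in 𝓝 y, ∀ v, f z (p z v) = p z (l (κ (h z)) • v) := by
    filter_upwards [hf, hU.mem_nhds hy] with z hz hzU v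
    obtain ⟨a, ha⟩ := (mem_affinors_iff (hp.1 z hzU)).1 hz.1
    simp only [h, ha, LinearEquiv.trans_symm, LinearEquiv.trans_apply,
      LinearEquiv.symm_apply_apply, LinearEquiv.apply_symm_apply, hl]
  let β : E s t m →L[ℝ] E s t m →L[ℝ] E s t m :=
    LinearMap.toContinuousLinearMap (LinearMap.toContinuousLinearMap.toLinearMap ∘ₗ
      LinearMap.mk₂ ℝ (fun h η => κ.symm (l (κ h) • κ η))
        (fun h h' η => by simp only [map_add, add_smul])
        (fun r h η => by
          rw [LinearEquiv.map_smul κ r, l.map_smul, smul_assoc, LinearEquiv.map_smul κ.symm r])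
        (fun h η η' => by simp only [map_add, smul_add])
        (fun r h η => by
          rw [LinearEquiv.map_smul κ r, smul_comm, LinearEquiv.map_smul κ.symm r]))
  have hβ : ∀ u w, β u w = κ.symm (l (κ u) • κ w) := fun u w => rfl
  refine ⟨affinor (p y) (l (κ (mvfderiv 𝓘(ℝ, E s t m) h y X))), affinor_mem (hp.1 y hy) _,
    fun Y hY => ?_⟩
  let η : M → E s t m := fun z => (κ.trans (p z)).symm (Y z)
  have hη : MDifferentiableAt 𝓘(ℝ, E s t m) 𝓘(ℝ, E s t m) η y :=
    mdifferentiableAt_coord (fun v => (hq v).of_le (by simp)) hY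
  have hYη : ∀ z, Y z = p z (κ (η z)) := fun z => by simp [η]
  have hE : (fun z => (κ.trans (p z)).symm (f z (Y z))) =ᶠ[𝓝 y] fun z => β (h z) (η z) := by
    filter_upwards [hfh] with z hz
    rw [hYη, hz, hβ]
    simp
  have h1 : mvfderiv 𝓘(ℝ, E s t m) (fun z => (κ.trans (p z)).symm (f z (Y z))) y X =
      mvfderiv 𝓘(ℝ, E s t m) (fun z => β (h z) (η z)) y X :=
    congrArg (fun L : TM s t m y →L[ℝ] E s t m => L X) hE.mfderiv_eq
  rw [hcov, h1, mvfderiv_bilin β (hh.mdifferentiableAt (by simp)) hη X, hcov, map_add]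
  refine (add_comm _ _).trans (congrArg₂ _ ?_ ?_)
  · rw [hβ, LinearEquiv.trans_apply, LinearEquiv.apply_symm_apply, LinearEquiv.trans_apply,
      hfh.self_of_nhds]
  · rw [hβ, LinearEquiv.trans_apply, LinearEquiv.apply_symm_apply, hYη y, affinor_apply]

/-- Near every point there is a `𝒟`-connection preserving the affinors: the flat connection of a
frame, with its torsion corrected. -/
lemma exists_local_connection {D : Submodule ℝ (Bil s t m)} (hD : IsInvariantComplement s t m D)
    (x : M) :
    ∃ U : Set M, IsOpen U ∧ x ∈ U ∧ ∃ cov : Conn s t m M,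
      ContMDiffCovariantDerivativeOn (E s t m) ∞ cov.toFun U ∧
      ∀ y ∈ U, PreservesAffinorsAt P cov y ∧ TorsionMemAt P D cov y := by
  classical
  obtain ⟨ψ, hψ⟩ := hD.exists_correction
  obtain ⟨U, hU, hxU, p, hpP, hp⟩ := P.exists_smooth x
  choose U' hU' hxU' p' hp' using P.exists_smooth
  let κ : E s t m ≃ₗ[ℝ] V s t m := (p x).symm
  have hps : ∀ y ∈ U, ∀ v, ContMDiffAt 𝓘(ℝ, E s t m) (𝓘(ℝ, E s t m).prod 𝓘(ℝ, E s t m)) ∞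
      (fun z => TotalSpace.mk' (E s t m) (E := TangentSpace 𝓘(ℝ, E s t m)) z (p z v)) y :=
    fun y hy v => (hp v).contMDiffAt (hU.mem_nhds hy)
  let q : ∀ z : M, E s t m ≃ₗ[ℝ] TM s t m z := fun z => κ.trans (p z)
  have hq : ∀ y ∈ U, ∀ v, ContMDiffAt 𝓘(ℝ, E s t m) (𝓘(ℝ, E s t m).prod 𝓘(ℝ, E s t m)) ∞
      (fun z => TotalSpace.mk' (E s t m) (E := TangentSpace 𝓘(ℝ, E s t m)) z (q z v)) y :=
    fun y hy v => hps y hy (κ v)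
  -- outside `U` any local frames will do: there the connection need not be smooth
  let Q : ∀ _ z : M, E s t m ≃ₗ[ℝ] TM s t m z := fun y =>
    if y ∈ U then q else fun z => κ.trans (p' y z)
  have hQU : ∀ y ∈ U, Q y = q := fun y hy => if_pos hy
  have hQ : ∀ y v, ContMDiffAt 𝓘(ℝ, E s t m) (𝓘(ℝ, E s t m).prod 𝓘(ℝ, E s t m)) 1
      (fun z => TotalSpace.mk' (E s t m) (E := TangentSpace 𝓘(ℝ, E s t m)) z (Q y z v)) y := by
    intro y v
    by_cases hy : y ∈ U
    · rw [hQU y hy]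
      exact (hq y hy v).of_le (by simp)
    · have : Q y = fun z => κ.trans (p' y z) := if_neg hy
      rw [this]
      exact (((hp' y).2 (κ v)).contMDiffAt ((hU' y).mem_nhds (hxU' y))).of_le (by simp)
  let cov₀ : Conn s t m M := flatConn Q hQ
  have hcov₀ : ∀ y ∈ U, ∀ (σ : ∀ z : M, TM s t m z) (X : TM s t m y), cov₀ σ y X =
      q y (mvfderiv 𝓘(ℝ, E s t m) (fun z => (q z).symm (σ z)) y X) := by
    intro y hy σ X
    have h1 : cov₀ σ y X = Q y y (mvfderiv 𝓘(ℝ, E s t m) (fun z => (Q y z).symm (σ z)) y X) :=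
      flatConn_apply hQ σ y X
    rw [h1, hQU y hy]
  have hparallel : ∀ y ∈ U, ∀ v, cov₀ (fun z => p z v) y = 0 := by
    intro y hy v
    ext X
    rw [hcov₀ y hy]
    have h1 : (fun z => (q z).symm (p z v)) = fun _ => κ.symm v := by
      funext z
      simp [q]
    rw [h1, mvfderiv_const]
    exact map_zero (q y)
  -- the torsion of the flat connection, as seen in the frame
  let T : M → Bil s t m := fun y => pullTensor (p y) (cov₀.torsion y)
  have hT : ∀ y ∈ U, ∀ v w, ContMDiffAt 𝓘(ℝ, E s t m) 𝓘(ℝ, E s t m) ∞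
      (fun z => κ.symm (T z v w)) y := by
    intro y hy v w
    have : IsManifold 𝓘(ℝ, E s t m) (minSmoothness ℝ 2) M := by
      rw [minSmoothness_of_isRCLikeNormedField]
      infer_instance
    have : IsManifold 𝓘(ℝ, E s t m) (∞ + 1) M := by
      rw [show (∞ + 1 : ℕ∞ω) = ∞ from rfl]
      infer_instance
    have h1 := ContMDiffAt.mlieBracket_vectorField (m := ⊤) (n := ⊤) (hps y hy v) (hps y hy w)
      (by simp)
    have h2 := contMDiffAt_coord (hq y hy) h1
    refine h2.neg.congr_of_eventuallyEq ?_
    filter_upwards [hU.mem_nhds hy] with z hz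
    have h3 := cov₀.torsion_apply ((hps z hz v).mdifferentiableAt (by simp))
      ((hps z hz w).mdifferentiableAt (by simp))
    rw [hparallel z hz, hparallel z hz] at h3
    change κ.symm ((p z).symm (cov₀.torsion z (p z v) (p z w))) = -(q z).symm _
    rw [h3]
    simp [q]
  have hTalt : ∀ y, T y ∈ altMaps s t m := by
    intro y v
    simp [T]
  let A : TensorField s t m M := fun y =>
    if y ∈ U then pushTensor (p y) (ψ (T y)).flip else 0
  have hA : ∀ y ∈ U, A y = pushTensor (p y) (ψ (T y)).flip := fun y hy => if_pos hy
  refine ⟨U, hU, hxU, cov₀.addOneForm A, ⟨?_⟩, fun y hy => ⟨?_, ?_⟩⟩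
  · intro σ hσ y hy
    have hσ' : ∀ z ∈ U, ContMDiffAt 𝓘(ℝ, E s t m) (𝓘(ℝ, E s t m).prod 𝓘(ℝ, E s t m)) ∞
        (fun y => TotalSpace.mk' (E s t m) (E := TangentSpace 𝓘(ℝ, E s t m)) y (σ y)) z :=
      fun z hz => hσ.contMDiffAt (hU.mem_nhds hz)
    have h1 : ContMDiffAt 𝓘(ℝ, E s t m) (𝓘(ℝ, E s t m).prod 𝓘(ℝ, E s t m →L[ℝ] E s t m)) ∞
        (fun y => TotalSpace.mk' (E s t m →L[ℝ] E s t m)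
          (E := fun z : M => TangentSpace 𝓘(ℝ, E s t m) z →L[ℝ] TangentSpace 𝓘(ℝ, E s t m) z)
          y (cov₀ σ y)) y := by
      refine contMDiffAt_hom_of_frame (hq y hy) fun u => ?_
      have h2 := contMDiffAt_frame_apply (ql := fun z => (q z).toLinearMap) (hq y hy)
        (contMDiffAt_mvfderiv_apply hU hy (η := fun z => (q z).symm (σ z))
          (fun z hz => (contMDiffAt_coord (hq z hz) (hσ' z hz)).contMDiffWithinAt) (hq y hy u))
      refine h2.congr_of_eventuallyEq ?_
      filter_upwards [hU.mem_nhds hy] with z hz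
      rw [hcov₀ z hz]
      rfl
    have h2 : ContMDiffAt 𝓘(ℝ, E s t m) (𝓘(ℝ, E s t m).prod 𝓘(ℝ, E s t m →L[ℝ] E s t m)) ∞
        (fun y => TotalSpace.mk' (E s t m →L[ℝ] E s t m)
          (E := fun z : M => TangentSpace 𝓘(ℝ, E s t m) z →L[ℝ] TangentSpace 𝓘(ℝ, E s t m) z)
          y (A y (σ y))) y := by
      have h3 := contMDiffAt_pushTensor (κ := κ) (hps y hy) (T := fun z => (ψ (T z)).flip)
        (fun v w => contMDiffAt_linear_bil κ (hT y hy)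
          (κ.symm.toLinearMap ∘ₗ LinearMap.applyₗ v ∘ₗ LinearMap.applyₗ w ∘ₗ ψ)) (hσ' y hy)
      refine h3.congr_of_eventuallyEq ?_
      filter_upwards [hU.mem_nhds hy] with z hz
      rw [hA z hz]
    exact (h1.add_section h2).contMDiffWithinAt
  · refine PreservesAffinorsAt.addOneForm ?_ (hpP y hy) ?_
    · exact preservesAffinorsAt_of_flat hU ⟨hpP, hp⟩ κ hy (hcov₀ y hy)
    · rw [hA y hy, pullTensor_pushTensor, LinearMap.flip_flip]
      exact (hψ _ (hTalt y)).1
  · rw [torsionMemAt_iff hD (hpP y hy)]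
    convert (hψ _ (hTalt y)).2
    ext v w
    simp [torsion_addOneForm, hA y hy, T, alternation]

end existence

section gluing

open scoped Topology
open CliffordianStructure

variable {s t m : ℕ} {M : Type*} [TopologicalSpace M] [ChartedSpace (E s t m) M]
  [IsManifold 𝓘(ℝ, E s t m) ∞ M] {P : CliffordianStructure s t m M}

/-- Connections can be glued with a partition of unity. -/
lemma exists_glued_connection {ι : Type*}
    (ρ : SmoothPartitionOfUnity ι 𝓘(ℝ, E s t m) M Set.univ) (U : ι → Set M)
    (hU : ∀ i, IsOpen (U i)) (hρ : ρ.IsSubordinate U) (cov : ι → Conn s t m M)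
    (hcov : ∀ i, ContMDiffCovariantDerivativeOn (E s t m) ∞ (cov i).toFun (U i)) :
    ∃ cov' : Conn s t m M, cov'.ContMDiffCovariantDerivative ∞ ∧
      ∀ σ x, cov' σ x = ∑ i ∈ ρ.finsupport x, ρ i x • cov i σ x := by
  have hsum : ∀ x, ∑ i ∈ ρ.finsupport x, ρ i x = 1 := fun x => ρ.sum_finsupport x (Set.mem_univ x)
  let cov' : Conn s t m M :=
    { toFun := fun σ x => ∑ i ∈ ρ.finsupport x, ρ i x • cov i σ x
      isCovariantDerivativeOnUniv :=
        { add := by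
            intro σ σ' x hσ hσ' _
            rw [← Finset.sum_add_distrib]
            refine Finset.sum_congr rfl fun i _ => ?_
            rw [(cov i).isCovariantDerivativeOnUniv.add hσ hσ', smul_add]
          leibniz := by
            intro σ g x hσ hg _
            have h1 : ∀ i, ρ i x • cov i (g • σ) x = g x • ρ i x • cov i σ x +
                ρ i x • (mvfderiv 𝓘(ℝ, E s t m) g x).smulRight (σ x) := by
              intro i
              rw [(cov i).isCovariantDerivativeOnUniv.leibniz hσ hg, smul_add, smul_comm]
            rw [Finset.sum_congr rfl fun i _ => h1 i, Finset.sum_add_distrib, ← Finset.smul_sum,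
              ← Finset.sum_smul, hsum, one_smul] } }
  refine ⟨cov', ⟨⟨fun {σ} hσ => ?_⟩⟩, fun σ x => rfl⟩
  have h1 : ∀ x, cov' σ x = ∑ᶠ i, ρ i x • cov i σ x := fun x =>
    ρ.toPartitionOfUnity.sum_finsupport_smul_eq_finsum (φ := fun i y => cov i σ x)
  have h2 : ContMDiff 𝓘(ℝ, E s t m) (𝓘(ℝ, E s t m).prod 𝓘(ℝ, E s t m →L[ℝ] E s t m)) ∞
      (fun y => TotalSpace.mk' (E s t m →L[ℝ] E s t m)
        (E := fun z : M => TangentSpace 𝓘(ℝ, E s t m) z →L[ℝ] TangentSpace 𝓘(ℝ, E s t m) z)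
        y (∑ᶠ i, ρ i y • cov i σ y)) := by
    refine ContMDiff.finsum_section_of_locallyFinite ?_ fun i => ?_
    · refine ρ.locallyFinite.subset fun i x hx => ?_
      exact fun h0 => hx (by rw [h0, zero_smul])
    · exact ContMDiffOn.smul_section_of_tsupport (ρ i).contMDiff.contMDiffOn (hU i) (hρ i)
        ((hcov i).contMDiff (hσ.mono (Set.subset_univ _)))
  refine ContMDiff.contMDiffOn ?_
  simp only [← h1] at h2
  exact h2

lemma exists_isDConnection [T2Space M] [SigmaCompactSpace M] {D : Submodule ℝ (Bil s t m)}
    (hD : IsInvariantComplement s t m D) (P : CliffordianStructure s t m M) :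
    ∃ cov : Conn s t m M, IsDConnection P D cov ∧ PreservesAffinors P cov := by
  choose U hU hxU cov hcov hcovU using exists_local_connection (P := P) hD
  obtain ⟨ρ, hρ⟩ := SmoothPartitionOfUnity.exists_isSubordinate 𝓘(ℝ, E s t m) isClosed_univ U hU
    fun x _ => Set.mem_iUnion.2 ⟨x, hxU x⟩
  obtain ⟨cov', hs, hcov'⟩ := exists_glued_connection ρ U hU hρ cov hcov
  have hsum : ∀ x, ∑ i ∈ ρ.finsupport x, ρ i x = 1 := fun x => ρ.sum_finsupport x (Set.mem_univ x)
  have hmem : ∀ x, ∀ i ∈ ρ.finsupport x, x ∈ U i := by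
    intro x i hi
    refine hρ i (subset_tsupport _ ?_)
    simpa using hi
  have hA : PreservesAffinors P cov' := by
    refine preservesAffinors_iff.2 fun x f hf X => ?_
    have h1 : ∀ i, ∃ f', i ∈ ρ.finsupport x → f' ∈ P.affinors x ∧
        ∀ Y : (∀ y : M, TM s t m y),
        MDifferentiableAt 𝓘(ℝ, E s t m) (𝓘(ℝ, E s t m).prod 𝓘(ℝ, E s t m))
          (fun y => TotalSpace.mk' (E s t m) (E := TangentSpace 𝓘(ℝ, E s t m)) y (Y y)) x →
        cov i (fun y => f y (Y y)) x X = f x (cov i Y x X) + f' (Y x) := by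
      intro i
      by_cases hi : i ∈ ρ.finsupport x
      · obtain ⟨f', hf', h'⟩ := (hcovU i x (hmem x i hi)).1 f hf X
        exact ⟨f', fun _ => ⟨hf', h'⟩⟩
      · exact ⟨0, fun h => absurd h hi⟩
    choose f' hf' using h1
    refine ⟨∑ i ∈ ρ.finsupport x, ρ i x • f' i,
      sum_smul_mem_affinors _ _ fun i hi => (hf' i hi).1, fun Y hY => ?_⟩
    rw [hcov', hcov']
    simp only [sum_apply, smul_apply, map_sum, map_smul]
    rw [← Finset.sum_add_distrib]
    refine Finset.sum_congr rfl fun i hi => ?_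
    rw [(hf' i hi).2 Y hY, smul_add]
  refine ⟨cov', ⟨hs, hA.isGConnection, exists_torsion_iff.2 fun x p hp => ?_⟩, hA⟩
  have h1 : cov'.torsion x = ∑ i ∈ ρ.finsupport x, ρ i x • (cov i).torsion x := by
    ext X Y
    simp only [sum_apply, smul_apply, CovariantDerivative.torsion_apply_eq_extend, hcov', smul_sub]
    rw [Finset.sum_sub_distrib, Finset.sum_sub_distrib, ← Finset.sum_smul, hsum, one_smul]
  rw [h1, map_sum]
  refine D.sum_mem fun i hi => ?_
  rw [map_smul]
  exact D.smul_mem _ ((hcovU i x (hmem x i hi)).2 p hp)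

end gluing

/-! ### The class of connections with the same planar curves -/

section planar

open scoped Topology
open CliffordianStructure

variable {s t m : ℕ} {M : Type*} [TopologicalSpace M] [ChartedSpace (E s t m) M]

/-- The tensor `S^λ` on the tangent space at `x`, for a covector `λ` at `x`, built with the
frame `p`. -/
def covTensor {x : M} (p : V s t m ≃ₗ[ℝ] TM s t m x) :
    (TM s t m x →ₗ[ℝ] ℝ) →ₗ[ℝ] TM s t m x →L[ℝ] TM s t m x →L[ℝ] TM s t m x where
  toFun l := pushTensor p (modelTensor (l ∘ₗ p.toLinearMap))
  map_add' l l' := by rw [LinearMap.add_comp, map_add, map_add]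
  map_smul' r l := by rw [LinearMap.smul_comp, map_smul, map_smul]; rfl

lemma covTensor_eq {x : M} (p : V s t m ≃ₗ[ℝ] TM s t m x) (l : TM s t m x →ₗ[ℝ] ℝ) :
    covTensor p l = pushTensor p (modelTensor (l ∘ₗ p.toLinearMap)) := rfl

lemma pullTensor_covTensor {x : M} (p : V s t m ≃ₗ[ℝ] TM s t m x) (l : TM s t m x →ₗ[ℝ] ℝ) :
    pullTensor p (covTensor p l) = modelTensor (l ∘ₗ p.toLinearMap) :=
  pullTensor_pushTensor _ _

lemma contMDiffAt_modelTensor {κ : E s t m ≃ₗ[ℝ] V s t m} {l : M → V s t m →ₗ[ℝ] ℝ} {x : M}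
    {n : ℕ∞ω} (hl : ∀ v, ContMDiffAt 𝓘(ℝ, E s t m) 𝓘(ℝ, ℝ) n (fun y => l y v) x) (v w : V s t m) :
    ContMDiffAt 𝓘(ℝ, E s t m) 𝓘(ℝ, E s t m) n (fun y => κ.symm (modelTensor (l y) v w)) x := by
  let b := Module.finBasis ℝ (V s t m)
  let C : (V s t m →ₗ[ℝ] ℝ) →ₗ[ℝ] Fin (Module.finrank ℝ (V s t m)) → ℝ :=
    { toFun := fun l i => l (b i)
      map_add' := fun l l' => rfl
      map_smul' := fun r l => rfl }
  have hC : Function.Injective C := fun l l' h => b.ext fun i => congrFun h i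
  obtain ⟨r, hr⟩ := exists_linear_factor hC
    (κ.symm.toLinearMap ∘ₗ LinearMap.applyₗ w ∘ₗ LinearMap.applyₗ v ∘ₗ modelTensor)
  have h1 : ∀ y, κ.symm (modelTensor (l y) v w) = r (C (l y)) := fun y => hr (l y)
  simp only [h1]
  refine contMDiffAt_linear_comp ?_ r
  rw [contMDiffAt_pi_space]
  exact fun i => hl (b i)

variable [IsManifold 𝓘(ℝ, E s t m) ∞ M] {P : CliffordianStructure s t m M}

lemma covTensor_eq_of_mem {x : M} {p p' : V s t m ≃ₗ[ℝ] TM s t m x} (hp : p ∈ P.frames x)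
    (hp' : p' ∈ P.frames x) (l : TM s t m x →ₗ[ℝ] ℝ) : covTensor p' l = covTensor p l := by
  obtain ⟨g, hg, rfl⟩ := frames_trans hp hp'
  ext X Y
  have h1 := modelTensor_conj hg (l ∘ₗ p.toLinearMap) (g.symm (p.symm X)) (g.symm (p.symm Y))
  rw [LinearEquiv.apply_symm_apply, LinearEquiv.apply_symm_apply] at h1
  exact congrArg p h1

lemma difference_apply_apply (cov cov' : Conn s t m M) {x : M} {σ : ∀ y : M, TM s t m y}
    (hσ : MDifferentiableAt 𝓘(ℝ, E s t m) (𝓘(ℝ, E s t m).prod 𝓘(ℝ, E s t m))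
      (fun y => TotalSpace.mk' (E s t m) (E := TangentSpace 𝓘(ℝ, E s t m)) y (σ y)) x)
    (X : TM s t m x) :
    cov'.difference cov x (σ x) X = cov' σ x X - cov σ x X := by
  have h1 := cov'.isCovariantDerivativeOnUniv.difference_apply cov.isCovariantDerivativeOnUniv
    (Set.mem_univ x) hσ
  exact congrArg (fun L => L X) h1

lemma difference_addOneForm (cov : Conn s t m M) (A : TensorField s t m M) :
    (cov.addOneForm A).difference cov = A := by
  funext x
  ext Y X
  have h1 := difference_apply_apply cov (cov.addOneForm A)
    (FiberBundle.mdifferentiableAt_extend 𝓘(ℝ, E s t m) (E s t m) Y) X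
  rw [FiberBundle.extend_apply_self] at h1
  rw [h1]
  change cov _ x X + A x _ X - _ = _
  rw [FiberBundle.extend_apply_self]
  abel

lemma torsion_eq_add_difference (cov cov' : Conn s t m M) (x : M) (X Y : TM s t m x) :
    cov'.torsion x X Y = cov.torsion x X Y +
      (cov'.difference cov x Y X - cov'.difference cov x X Y) := by
  have h1 := difference_apply_apply cov cov'
    (FiberBundle.mdifferentiableAt_extend 𝓘(ℝ, E s t m) (E s t m) Y) X
  have h2 := difference_apply_apply cov cov'
    (FiberBundle.mdifferentiableAt_extend 𝓘(ℝ, E s t m) (E s t m) X) Y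
  rw [FiberBundle.extend_apply_self] at h1 h2
  rw [CovariantDerivative.torsion_apply_eq_extend, CovariantDerivative.torsion_apply_eq_extend,
    h1, h2]
  simp only [FiberBundle.extend_apply_self]
  abel

/-- If two connections have the same planar curves, their difference tensor `S` satisfies
`S(X, X) ∈ A(X)`. -/
lemma exists_affinor_of_planar [T2Space M] {cov cov' : Conn s t m M}
    (hcov : cov.ContMDiffCovariantDerivative ∞)
    (h : ∀ c : ℝ → M, IsPlanar P cov c → IsPlanar P cov' c) (x : M) (X : TM s t m x) :
    ∃ f ∈ P.affinors x, cov'.difference cov x X X = f X := by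
  obtain ⟨c, hc, r, hr, hX⟩ := exists_planar_curve P hcov x X
  have h0 : ∃ f ∈ P.affinors (c 0), cov'.difference cov (c 0) (velocity c 0) (velocity c 0) =
      f (velocity c 0) := by
    obtain ⟨f, hf, hf'⟩ := hc.2 0
    obtain ⟨g, hg, hg'⟩ := (h c hc).2 0
    rw [acceleration_eq_add_difference cov cov', hf'] at hg'
    obtain ⟨p, hp⟩ := P.exists_mem_frames (c 0)
    obtain ⟨a, ha⟩ := (mem_affinors_iff hp).1 hf
    obtain ⟨b, hb⟩ := (mem_affinors_iff hp).1 hg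
    refine ⟨g - f, (mem_affinors_iff hp).2 ⟨b - a, fun v => ?_⟩, ?_⟩
    · rw [sub_apply, ha, hb, sub_smul, map_sub]
    · rw [sub_apply, ← hg', add_sub_cancel_left]
  have h1 : ∀ z : TotalSpace (E s t m) (TangentSpace 𝓘(ℝ, E s t m) : M → Type _),
      z = TotalSpace.mk' (E s t m) x (r • X) →
      (∃ f ∈ P.affinors z.1, cov'.difference cov z.1 z.2 z.2 = f z.2) →
      ∃ f ∈ P.affinors x, cov'.difference cov x (r • X) (r • X) = f (r • X) := by
    rintro z rfl hz
    exact hz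
  obtain ⟨f, hf, hf'⟩ := h1 _ hX h0
  obtain ⟨p, hp⟩ := P.exists_mem_frames x
  obtain ⟨a, ha⟩ := (mem_affinors_iff hp).1 hf
  refine ⟨r⁻¹ • f, (mem_affinors_iff hp).2 ⟨r⁻¹ • a, fun v => ?_⟩, ?_⟩
  · rw [smul_apply, ha, smul_assoc, LinearEquiv.map_smul p r⁻¹]
  · simp only [map_smul, smul_apply] at hf' ⊢
    have h2 := congrArg (fun Z => (r⁻¹ * r⁻¹) • Z) hf'
    simp only [smul_smul] at h2
    rw [mul_assoc, inv_mul_cancel_left₀ hr, inv_mul_cancel₀ hr, one_smul, mul_assoc,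
      inv_mul_cancel₀ hr, mul_one] at h2
    exact h2

variable {D : Submodule ℝ (Bil s t m)}

/-- The difference tensor of two connections in the same class is of the form `S^λ` at every
point. -/
lemma exists_covTensor_eq_difference [T2Space M] (hD : IsInvariantComplement s t m D)
    {cov cov' : Conn s t m M} (hcov : IsDConnection P D cov) (hcov' : IsDConnection P D cov')
    (h : ∀ c : ℝ → M, IsPlanar P cov c → IsPlanar P cov' c) (x : M) :
    ∃ l : TM s t m x →ₗ[ℝ] ℝ, ∀ p ∈ P.frames x, cov'.difference cov x = covTensor p l := by
  obtain ⟨U, hU, hxU, p, hp⟩ := P.exists_smooth x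
  have hpx := hp.1 x hxU
  set S := pullTensor (p x) (cov'.difference cov x) with hS
  have hdim : Module.finrank ℝ (V s t m) = 2 ^ (s + t) * m := by
    rw [(p x).finrank_eq]
    exact finrank_euclideanSpace_fin
  obtain ⟨τ, -, hτ⟩ := exists_recoverForm hdim
  have hg : S.flip ∈ homLieAlg s t m := by
    intro v
    obtain ⟨B, hB, hB'⟩ := hcov.isGConnection U hU p hp x hxU (p x v)
    obtain ⟨B₁, hB₁, hB₁'⟩ := hcov'.isGConnection U hU p hp x hxU (p x v)
    convert (lieAlg s t m).sub_mem hB₁ hB using 1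
    refine LinearMap.ext fun w => ?_
    rw [LinearMap.flip_apply, hS, pullTensor_apply,
      difference_apply_apply cov cov' (σ := fun y => p y w)
      (((hp.2 w).contMDiffAt (hU.mem_nhds hxU)).mdifferentiableAt (by simp)), hB', hB₁', ← map_sub,
      LinearEquiv.symm_apply_apply]
    rfl
  have hsymm : ∀ v w, S v w = S w v := by
    have h1 : alternation s t m S.flip ∈ D := by
      have h2 := D.add_mem (exists_torsion_iff.1 hcov'.torsion_mem x _ hpx)
        (D.smul_mem (-1 : ℝ) (exists_torsion_iff.1 hcov.torsion_mem x _ hpx))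
      convert h2 using 1
      refine LinearMap.ext₂ fun v w => ?_
      simp [torsion_eq_add_difference cov cov', alternation, hS]
    intro v w
    exact (hD.symm_of_alternation_mem hg h1 w v)
  have hS' : modelTensor (recoverForm τ S) = S := by
    refine hτ S ?_ hsymm fun v => ?_
    · have : S.flip = S := LinearMap.ext₂ fun v w => hsymm w v
      rwa [this] at hg
    · obtain ⟨f, hf, hf'⟩ := exists_affinor_of_planar hcov.smooth h x (p x v)
      obtain ⟨a, ha⟩ := (mem_affinors_iff hpx).1 hf
      refine ⟨a, ?_⟩
      rw [hS, pullTensor_apply, hf', ha, LinearEquiv.symm_apply_apply]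
  refine ⟨recoverForm τ S ∘ₗ (p x).symm.toLinearMap, fun p' hp' => ?_⟩
  rw [covTensor_eq_of_mem hpx hp', covTensor_eq, LinearMap.comp_assoc]
  have h2 : (p x).symm.toLinearMap ∘ₗ (p x).toLinearMap = LinearMap.id := by
    refine LinearMap.ext fun v => ?_
    simp
  rw [h2, LinearMap.comp_id, hS', hS, pushTensor_pullTensor]

/-- Adding a smooth tensor field of the form `S^Υ` to a connection does not leave its class. -/
lemma addOneForm_mem_planarClass {cov : Conn s t m M} (hcov : IsDConnection P D cov)
    (hA : PreservesAffinors P cov) {A : TensorField s t m M}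
    (hAs : ∀ x, ∀ σ : ∀ y : M, TM s t m y,
      ContMDiff 𝓘(ℝ, E s t m) (𝓘(ℝ, E s t m).prod 𝓘(ℝ, E s t m)) ∞
        (fun y => TotalSpace.mk' (E s t m) (E := TangentSpace 𝓘(ℝ, E s t m)) y (σ y)) →
      ContMDiffAt 𝓘(ℝ, E s t m) (𝓘(ℝ, E s t m).prod 𝓘(ℝ, E s t m →L[ℝ] E s t m)) ∞
        (fun y => TotalSpace.mk' (E s t m →L[ℝ] E s t m)
          (E := fun z : M => TangentSpace 𝓘(ℝ, E s t m) z →L[ℝ] TangentSpace 𝓘(ℝ, E s t m) z)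
          y (A y (σ y))) x)
    (hAc : ∀ x, ∃ l : TM s t m x →ₗ[ℝ] ℝ, ∀ p ∈ P.frames x, A x = covTensor p l) :
    cov.addOneForm A ∈ planarClass P D cov := by
  have hpull : ∀ x, ∀ p ∈ P.frames x, ∃ l : V s t m →ₗ[ℝ] ℝ,
      pullTensor p (A x) = modelTensor l := by
    intro x p hp
    obtain ⟨l, hl⟩ := hAc x
    exact ⟨_, by rw [hl p hp, pullTensor_covTensor]⟩
  have hflip : ∀ l : V s t m →ₗ[ℝ] ℝ, (modelTensor l).flip = modelTensor l := fun l =>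
    LinearMap.ext₂ fun v w => modelTensor_comm l w v
  have hA' : PreservesAffinors P (cov.addOneForm A) := by
    refine preservesAffinors_iff.2 fun x => ?_
    obtain ⟨p, hp⟩ := P.exists_mem_frames x
    obtain ⟨l, hl⟩ := hpull x p hp
    refine PreservesAffinorsAt.addOneForm (preservesAffinors_iff.1 hA x) hp ?_
    rw [hl, hflip]
    exact modelTensor_mem_homLieAlg l
  have htor : (cov.addOneForm A).torsion = cov.torsion := by
    funext x
    ext X Y
    obtain ⟨p, hp⟩ := P.exists_mem_frames x
    obtain ⟨l, hl⟩ := hpull x p hp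
    rw [torsion_addOneForm, ← pushTensor_pullTensor p (A x), hl, pushTensor_apply, pushTensor_apply,
      modelTensor_comm, sub_self, add_zero]
  have haff : ∀ x (X : TM s t m x), ∃ f ∈ P.affinors x, A x X X = f X := by
    intro x X
    obtain ⟨p, hp⟩ := P.exists_mem_frames x
    obtain ⟨l, hl⟩ := hpull x p hp
    obtain ⟨v, rfl⟩ := p.surjective X
    refine ⟨affinor p ((2 : ℝ) • clForm l v), affinor_mem hp _, ?_⟩
    rw [← pushTensor_pullTensor p (A x), hl, affinor_apply, pushTensor_apply, modelTensor_apply,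
      LinearEquiv.symm_apply_apply, smul_assoc, two_smul]
  refine ⟨⟨⟨⟨fun {σ} hσ => ?_⟩⟩, hA'.isGConnection, ?_⟩, hA', fun c => ?_⟩
  · rw [contMDiffOn_univ] at hσ ⊢
    have h1 := hcov.smooth.contMDiff.contMDiff (σ := σ) hσ.contMDiffOn
    rw [contMDiffOn_univ] at h1
    exact fun x => (h1 x).add_section (hAs x σ hσ)
  · rw [htor]
    exact hcov.torsion_mem
  · refine and_congr_right fun _ => forall_congr' fun τ => ?_
    rw [acceleration_eq_add_difference cov (cov.addOneForm A), difference_addOneForm]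
    obtain ⟨g, hg, hg'⟩ := haff (c τ) (velocity c τ)
    obtain ⟨p, hp⟩ := P.exists_mem_frames (c τ)
    constructor
    · rintro ⟨f, hf, h⟩
      refine ⟨f + (-1 : ℝ) • g, add_mem_affinors hf ?_, ?_⟩
      · obtain ⟨a, ha⟩ := (mem_affinors_iff hp).1 hg
        refine (mem_affinors_iff hp).2 ⟨(-1 : ℝ) • a, fun v => ?_⟩
        rw [smul_apply, ha, smul_assoc, LinearEquiv.map_smul p (-1 : ℝ)]
      · rw [add_apply, ← h, hg', smul_apply, neg_one_smul, add_neg_cancel_right]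
    · rintro ⟨f, hf, h⟩
      exact ⟨f + g, add_mem_affinors hf hg, by rw [add_apply, h, hg']⟩

end planar

/-! ### One-forms as difference tensors -/

section forms

open scoped Topology
open CliffordianStructure

variable {s t m : ℕ} {M : Type*} [TopologicalSpace M] [ChartedSpace (E s t m) M]

lemma finrank_model {x : M} (p : V s t m ≃ₗ[ℝ] TM s t m x) :
    Module.finrank ℝ (V s t m) = 2 ^ (s + t) * m := by
  rw [p.finrank_eq]
  exact finrank_euclideanSpace_fin

lemma covTensor_injective {x : M} (p : V s t m ≃ₗ[ℝ] TM s t m x) :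
    Function.Injective (covTensor p) := by
  intro l l' h
  obtain ⟨τ, hτ, -⟩ := exists_recoverForm (finrank_model p)
  have h1 := congrArg (fun S => recoverForm τ (pullTensor p S)) h
  simp only [pullTensor_covTensor, hτ] at h1
  refine LinearMap.ext fun X => ?_
  have h2 := LinearMap.congr_fun h1 (p.symm X)
  simpa using h2

lemma covTensor_apply_apply {x : M} (p : V s t m ≃ₗ[ℝ] TM s t m x) (l : TM s t m x →ₗ[ℝ] ℝ)
    (v w : V s t m) :
    covTensor p l (p v) (p w) = ∑ S : Finset (Fin (s + t)), ε s t S •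
      (l (p (F s t S • v)) • p (F s t S • w) + l (p (F s t S • w)) • p (F s t S • v)) := by
  rw [covTensor_eq, pushTensor_apply, LinearEquiv.symm_apply_apply, LinearEquiv.symm_apply_apply,
    modelTensor_eq_sum, map_sum]
  refine Finset.sum_congr rfl fun S _ => ?_
  rw [LinearEquiv.map_smul p (ε s t S), map_add, LinearEquiv.map_smul p (_ : ℝ),
    LinearEquiv.map_smul p (_ : ℝ)]
  rfl

lemma contMDiffAt_trivial_iff {g : M → ℝ} {x : M} :
    ContMDiffAt 𝓘(ℝ, E s t m) (𝓘(ℝ, E s t m).prod 𝓘(ℝ, ℝ)) ∞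
      (fun y => TotalSpace.mk' ℝ (E := Trivial M ℝ) y (g y)) x ↔
    ContMDiffAt 𝓘(ℝ, E s t m) 𝓘(ℝ, ℝ) ∞ g x := by
  rw [contMDiffAt_section]
  rfl

variable [IsManifold 𝓘(ℝ, E s t m) ∞ M]

lemma contMDiffAt_form_apply (Υ : OneForm s t m M) {x : M} {σ : ∀ y : M, TM s t m y}
    (hσ : ContMDiffAt 𝓘(ℝ, E s t m) (𝓘(ℝ, E s t m).prod 𝓘(ℝ, E s t m)) ∞
      (fun y => TotalSpace.mk' (E s t m) (E := TangentSpace 𝓘(ℝ, E s t m)) y (σ y)) x) :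
    ContMDiffAt 𝓘(ℝ, E s t m) 𝓘(ℝ, ℝ) ∞ (fun y => (Υ y (σ y) : ℝ)) x :=
  contMDiffAt_trivial_iff.1 ((Υ.contMDiff x).clm_bundle_apply hσ)

variable (P : CliffordianStructure s t m M)

/-- The tensor field `S^Υ` of a one-form `Υ`. The frames used at the points of `M` are chosen
arbitrarily: by `covTensor_eq_of_mem` the choice does not matter. -/
def formTensor : OneForm s t m M →ₗ[ℝ] TensorField s t m M where
  toFun Υ x := covTensor (P.exists_mem_frames x).choose (Υ x).toLinearMap
  map_add' Υ Υ' := by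
    funext x
    exact map_add (covTensor _) (Υ x).toLinearMap (Υ' x).toLinearMap
  map_smul' r Υ := by
    funext x
    exact map_smul (covTensor _) r (Υ x).toLinearMap

variable {P}

lemma formTensor_eq {x : M} {p : V s t m ≃ₗ[ℝ] TM s t m x} (hp : p ∈ P.frames x)
    (Υ : OneForm s t m M) : formTensor P Υ x = covTensor p (Υ x).toLinearMap :=
  covTensor_eq_of_mem hp (P.exists_mem_frames x).choose_spec _

lemma formTensor_injective : Function.Injective (formTensor P) := by
  intro Υ Υ' h
  ext x X
  have h1 := covTensor_injective _ (congrFun h x)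
  exact LinearMap.congr_fun h1 X

lemma contMDiffAt_formTensor (Υ : OneForm s t m M) (x : M) {σ : ∀ y : M, TM s t m y}
    (hσ : ContMDiffAt 𝓘(ℝ, E s t m) (𝓘(ℝ, E s t m).prod 𝓘(ℝ, E s t m)) ∞
      (fun y => TotalSpace.mk' (E s t m) (E := TangentSpace 𝓘(ℝ, E s t m)) y (σ y)) x) :
    ContMDiffAt 𝓘(ℝ, E s t m) (𝓘(ℝ, E s t m).prod 𝓘(ℝ, E s t m →L[ℝ] E s t m)) ∞
      (fun y => TotalSpace.mk' (E s t m →L[ℝ] E s t m)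
        (E := fun z : M => TangentSpace 𝓘(ℝ, E s t m) z →L[ℝ] TangentSpace 𝓘(ℝ, E s t m) z)
        y (formTensor P Υ y (σ y))) x := by
  obtain ⟨U, hU, hxU, p, hpP, hp⟩ := P.exists_smooth x
  have hps := fun v => (hp v).contMDiffAt (hU.mem_nhds hxU)
  let κ : E s t m ≃ₗ[ℝ] V s t m := (p x).symm
  have h1 := contMDiffAt_pushTensor (κ := κ) hps
    (T := fun y => modelTensor ((Υ y).toLinearMap ∘ₗ (p y).toLinearMap))
    (contMDiffAt_modelTensor fun v => contMDiffAt_form_apply Υ (hps v)) hσ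
  refine h1.congr_of_eventuallyEq ?_
  filter_upwards [hU.mem_nhds hxU] with y hy
  rw [formTensor_eq (hpP y hy), covTensor_eq]

variable {D : Submodule ℝ (Bil s t m)}

lemma addOneForm_formTensor_mem {cov : Conn s t m M} (hcov : IsDConnection P D cov)
    (hA : PreservesAffinors P cov) (Υ : OneForm s t m M) :
    cov.addOneForm (formTensor P Υ) ∈ planarClass P D cov :=
  addOneForm_mem_planarClass hcov hA (fun x _ hσ => contMDiffAt_formTensor Υ x (hσ x))
    fun _ => ⟨_, fun _ hp => formTensor_eq hp Υ⟩

/-- The difference tensor of two connections in the same class is `S^Υ` for a smooth one-form `Υ`: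
the covectors `Υ_x` depend smoothly on `x` because they are recovered linearly from the difference
tensor, which is smooth. -/
lemma exists_formTensor_eq_difference [T2Space M] (hD : IsInvariantComplement s t m D)
    {cov cov' : Conn s t m M} (hcov : IsDConnection P D cov)
    (h : cov' ∈ planarClass P D cov) : ∃ Υ, formTensor P Υ = cov'.difference cov := by
  obtain ⟨hcov', -, h⟩ := h
  choose l hl using exists_covTensor_eq_difference hD hcov hcov' fun c => (h c).2
  let Υ : ∀ y : M, TangentSpace 𝓘(ℝ, E s t m) y →L[ℝ] Trivial M ℝ y := fun y =>
    LinearMap.toContinuousLinearMap (l y)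
  have hΥ : ContMDiff 𝓘(ℝ, E s t m) (𝓘(ℝ, E s t m).prod 𝓘(ℝ, E s t m →L[ℝ] ℝ)) ∞
      (fun y => TotalSpace.mk' (E s t m →L[ℝ] ℝ)
        (E := fun z : M => TangentSpace 𝓘(ℝ, E s t m) z →L[ℝ] Trivial M ℝ z) y (Υ y)) := by
    intro x
    obtain ⟨U, hU, hxU, p, hpP, hp⟩ := P.exists_smooth x
    have hps := fun v => (hp v).contMDiffAt (hU.mem_nhds hxU)
    obtain ⟨τ, hτ, -⟩ := exists_recoverForm (finrank_model (p x))
    let κ : E s t m ≃ₗ[ℝ] V s t m := (p x).symm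
    have hq : ∀ v, ContMDiffAt 𝓘(ℝ, E s t m) (𝓘(ℝ, E s t m).prod 𝓘(ℝ, E s t m)) ∞
        (fun y => TotalSpace.mk' (E s t m) (E := TangentSpace 𝓘(ℝ, E s t m)) y
          (κ.trans (p y) v)) x := fun v => hps (κ v)
    have hS : ∀ v w, ContMDiffAt 𝓘(ℝ, E s t m) 𝓘(ℝ, E s t m) ∞
        (fun y => κ.symm (pullTensor (p y) (cov'.difference cov y) v w)) x := by
      intro v w
      have h1 := (contMDiffAt_cov hcov'.smooth hU hxU (hp v)).clm_bundle_apply (hps w)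
      have h2 := (contMDiffAt_cov hcov.smooth hU hxU (hp v)).clm_bundle_apply (hps w)
      refine (contMDiffAt_coord hq (h1.sub_section h2)).congr_of_eventuallyEq ?_
      filter_upwards [hU.mem_nhds hxU] with y hy
      rw [pullTensor_apply, difference_apply_apply cov cov' (σ := fun y => p y v)
        (((hp v).contMDiffAt (hU.mem_nhds hy)).mdifferentiableAt (by simp))]
      rfl
    refine contMDiffAt_hom_of_frame (W₂ := Trivial M ℝ) hq fun u => contMDiffAt_trivial_iff.2 ?_
    refine (contMDiffAt_linear_bil κ hS
      (LinearMap.applyₗ (κ u) ∘ₗ recoverForm τ)).congr_of_eventuallyEq ?_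
    filter_upwards [hU.mem_nhds hxU] with y hy
    rw [LinearMap.comp_apply, hl y (p y) (hpP y hy), pullTensor_covTensor, hτ]
    rfl
  refine ⟨⟨Υ, hΥ⟩, funext fun x => ?_⟩
  obtain ⟨p, hp⟩ := P.exists_mem_frames x
  rw [hl x p hp, formTensor_eq hp]
  rfl

/-- Every covector at a point is the value of a smooth one-form. -/
lemma exists_oneForm_apply_eq [T2Space M] (x : M) (l : TM s t m x →ₗ[ℝ] ℝ) :
    ∃ Υ : OneForm s t m M, (Υ x).toLinearMap = l := by
  obtain ⟨Υ, hΥ⟩ := exists_contMDiffSection_apply_eq (I := 𝓘(ℝ, E s t m)) (Fb := E s t m →L[ℝ] ℝ)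
    (W := fun y : M => TangentSpace 𝓘(ℝ, E s t m) y →L[ℝ] Trivial M ℝ y)
    (LinearMap.toContinuousLinearMap l)
  exact ⟨Υ, by rw [hΥ]; rfl⟩

end forms

end AlmostCliffordian

end

theorem mainTheorem2 (s t m : ℕ) (hdim : 2 * (s + t) ≤ 2 ^ (s + t) * m)
    {M : Type*} [TopologicalSpace M] [T2Space M] [SigmaCompactSpace M]
    [ChartedSpace (AlmostCliffordian.E s t m) M]
    [IsManifold 𝓘(ℝ, AlmostCliffordian.E s t m) ∞ M]
    (P : AlmostCliffordian.CliffordianStructure s t m M)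
    (D : Submodule ℝ (AlmostCliffordian.Bil s t m))
    (hD : AlmostCliffordian.IsInvariantComplement s t m D) :
    (∃ cov : AlmostCliffordian.Conn s t m M,
      AlmostCliffordian.IsDConnection P D cov ∧ AlmostCliffordian.PreservesAffinors P cov) ∧
    ∀ cov : AlmostCliffordian.Conn s t m M,
      AlmostCliffordian.IsDConnection P D cov → AlmostCliffordian.PreservesAffinors P cov →
      (∃ Φ : AlmostCliffordian.OneForm s t m M →ₗ[ℝ] AlmostCliffordian.TensorField s t m M,
        Function.Injective Φ ∧
        Set.range Φ =
          {S | ∃ cov' ∈ AlmostCliffordian.planarClass P D cov, cov'.difference cov = S} ∧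
        ∀ (Υ : AlmostCliffordian.OneForm s t m M) (x : M), ∀ p ∈ P.frames x,
          ∀ v w : AlmostCliffordian.V s t m,
            Φ Υ x (p v) (p w) =
              ∑ S : Finset (Fin (s + t)), AlmostCliffordian.ε s t S •
                ((Υ x (p (AlmostCliffordian.F s t S • v)) : ℝ) •
                    p (AlmostCliffordian.F s t S • w) +
                  (Υ x (p (AlmostCliffordian.F s t S • w)) : ℝ) •
                    p (AlmostCliffordian.F s t S • v))) ∧
      ∀ x : M, ∃ L : Module.Dual ℝ (AlmostCliffordian.E s t m) →ₗ[ℝ]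
          (AlmostCliffordian.TM s t m x →L[ℝ] AlmostCliffordian.TM s t m x →L[ℝ]
            AlmostCliffordian.TM s t m x),
        Function.Injective L ∧
        Set.range L =
          {S | ∃ cov' ∈ AlmostCliffordian.planarClass P D cov, cov'.difference cov x = S} := by
  open AlmostCliffordian in
  refine ⟨exists_isDConnection hD P, fun cov hcov hA => ⟨⟨formTensor P, formTensor_injective, ?_,
    fun Υ x p hp v w => ?_⟩, fun x => ?_⟩⟩
  · refine Set.Subset.antisymm ?_ ?_
    · rintro _ ⟨Υ, rfl⟩
      exact ⟨_, addOneForm_formTensor_mem hcov hA Υ, difference_addOneForm _ _⟩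
    · rintro _ ⟨cov', h, rfl⟩
      exact exists_formTensor_eq_difference hD hcov h
  · rw [formTensor_eq hp]
    exact covTensor_apply_apply p _ v w
  · obtain ⟨p, hp⟩ := P.exists_mem_frames x
    refine ⟨covTensor p, covTensor_injective p, Set.Subset.antisymm ?_ ?_⟩
    · rintro _ ⟨l, rfl⟩
      obtain ⟨Υ, hΥ⟩ := exists_oneForm_apply_eq x l
      refine ⟨_, addOneForm_formTensor_mem hcov hA Υ, ?_⟩
      rw [difference_addOneForm, formTensor_eq hp, hΥ]
      rfl
    · rintro _ ⟨cov', h, rfl⟩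
      obtain ⟨Υ, hΥ⟩ := exists_formTensor_eq_difference hD hcov h
      exact ⟨(Υ x).toLinearMap, by
        rw [← hΥ, formTensor_eq hp]
        rfl⟩
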